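/- **Setting.** Let $\mathcal X$ be a state space and $\Pi$ a parameter set. For each $\Theta\in\Pi$ let $\mathcal F^\Theta:\mathbb N\times\Omega_\Theta\times\mathcal X\to\mathcal X$ be a random dynamical system over a probability space $(\Omega_\Theta,P_\Theta)$ with measure-preserving semigroup $\mu_\Theta$, i.e. $\mathcal F^\Theta(0,\omega,x)=x$ and $\mathcal F^\Theta(r+s,\omega,x)=\mathcal F^\Theta(r,\mu_\Theta(s)\omega,\mathcal F^\Theta(s,\omega,x))$; its Koopman operator is $[\mathscr K(\Theta)g](x)=\mathbb E\,g(\mathcal F^\Theta(1,\omega,x))$. Let $\Lambda:\mathbb R^{d_\phi\times d_\phi}\to\mathbb R_{\ge0}$ be a spectrum cost. In episode $t=0,1,\dots$ an adversary, knowing the past, chooses initial states and horizons $X_0^t=\{(x^t_{0,n},H^t_n)\}_{n<N^t}$ ($N^t,H^t_n\ge1$) and a cost $c^t:\mathcal X\to\mathbb R_{\ge0}$; the learner picks $\Theta^t\in\Pi$ and observes $x^t_{h,n}=\mathcal F^{\Theta^t}(h,\omega^t_n,x^t_{0,n})$, $h\le H^t_n$, with fresh $\omega_n^t\sim P_{\Theta^t}$,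 independent across $n$. Put $J^\Theta(X_0;c)=\sum_{n}\mathbb E\sum_{h<H_n}c(\mathcal F^\Theta(h,\omega,x_{0,n}))$ and $$\mathrm{Regret}_T=\sum_{t<T}\Big(\Lambda[\mathscr K(\Theta^t)]+\sum_{n<N^t}\sum_{h<H_n^t}c^t(x^t_{h,n})\Big)-\sum_{t<T}\inf_{\Theta\in\Pi}\big(\Lambda[\mathscr K(\Theta)]+J^\Theta(X^t_0;c^t)\big).$$ **Assumptions.** 1. There are linearly independent functions $\phi_1,\dots,\phi_{d_\phi}$ on $\mathcal X$ whose real span is invariant under all $\mathscr K(\Theta)$, with $\phi_i(\mathcal F^\Theta(1,\omega,x))=[\mathscr K(\Theta)\phi_i](x)+\epsilon_i(\omega)$, where the noise is $\mathcal N(0,\sigma^2)$, $\sigma>0$, independent across time steps and indices. Write $\boldsymbol\phi_x=(\phi_i(x))_i\in\mathbb R^{d_\phi}$ and let $\mathscr K(\Theta)$ also denote the matrix with $\boldsymbol\phi_{\mathcal F^\Theta(1,\omega,x)}=\mathscr K(\Theta)\boldsymbol\phi_x+\epsilon(\omega)$. 2. There are a real Hilbert space $\mathcal H'$ and a map $\Psi:\Pi\to\mathcal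 L(\mathbb R^{d_\phi};\mathcal H')$ such that for each $v\in\mathbb R^{d_\phi}$ some $\psi\in\mathcal H'$ satisfies $\mathscr K(\Theta)v=\Psi(\Theta)^\dagger\psi$ for all $\Theta$. Hence $\mathscr K(\Theta)=\Psi(\Theta)^\dagger\circ M^\star$ for all $\Theta$, for some linear $M^\star:\mathbb R^{d_\phi}\to\mathcal H'$; fix such an $M^\star\neq0$ and a set $\mathrm{Ball}^0\ni M^\star$. 3. $c^t(x)=w^t(\boldsymbol\phi_x)$ for some $w^t:\mathbb R^{d_\phi}\to\mathbb R_{\ge0}$. 4. For some $L\ge0$, $\alpha\in(0,1]$, $\Lambda_{\max}\ge0$: $|\Lambda[\mathscr A]-\Lambda[\mathscr K(\Theta)]|\le L\max\{\|\mathscr A-\mathscr K(\Theta)\|^2,\|\mathscr A-\mathscr K(\Theta)\|^\alpha\}$ (operator norm) for all $\mathscr A\in\mathbb R^{d_\phi\times d_\phi}$ and $\Theta\in\Pi$, and $|\Lambda[\Psi(\Theta)^\dagger\circ M]|\le\Lambda_{\max}$ for all $\Theta\in\Pi$, $M\in\mathrm{Ball}^0$. 5. For some $C>0$ and $H\in\mathbb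 Z_{>0}$ and all $t$: the smallest eigenvalue of $\sum_{n<N^t}\boldsymbol\phi_{x^t_{0,n}}\boldsymbol\phi_{x^t_{0,n}}^\dagger$ is at least $C$, and $\sum_{n<N^t}H^t_n\le H$. 6. For some $V_{\max}>0$ and all $t$: $\sup_{\Theta}\sum_{n<N^t}\mathbb E\big(\sum_{h<H^t_n}c^t(\mathcal F^\Theta(h,\omega,x^t_{0,n}))\big)^2\le V_{\max}$. **Algorithm KS-LC³.** Let $\lambda=\sigma^2/\|M^\star\|^2$ (operator norm). On the Hilbert space of operators $M:\mathbb R^{d_\phi}\to\mathcal H'$ with the Hilbert–Schmidt inner product let $\mathscr A^t_{h,n}(M)=\Psi(\Theta^t)^\dagger M\boldsymbol\phi_{x^t_{h,n}}$, $\mathscr B^t(M)=\Psi(\Theta^t)^\dagger\circ M$, $$\Sigma^t_{\mathscr A}=\lambda I+\sum_{\tau<t}\sum_{n<N^\tau}\sum_{h<H_n^\tau}(\mathscr A^\tau_{h,n})^\dagger\mathscr A^\tau_{h,n},\qquad \Sigma^t_{\mathscr B}=\lambda I+\sum_{\tau<t}(\mathscr B^\tau)^\dagger\mathscr B^\tau,$$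 and let $\overline M^t$ minimize $\sum_{\tau<t}\sum_n\sum_{h<H^\tau_n}\|\boldsymbol\phi_{x^\tau_{h+1,n}}-\mathscr A^\tau_{h,n}(M)\|^2+\lambda\|M\|_{\rm HS}^2$. For $t\ge1$ let $\mathrm{Ball}^t$ be the set of $M\in\mathrm{Ball}^0$ with $$\|(\Sigma_{\mathscr A}^t)^{1/2}(M-\overline M^t)\|_{\rm HS}^2\le 20\sigma^2\Big(d_\phi+\log\Big(t\,\frac{\det\Sigma^t_{\mathscr A}}{\det\Sigma^0_{\mathscr A}}\Big)\Big),$$ where $\det S/\det(\lambda I)$ means the Fredholm determinant of $\lambda^{-1}S$. In episode $t$ an oracle (OptDynamics) returns $(\Theta^t,\hat M_t)$ minimizing $\Lambda[\Psi(\Theta)^\dagger\circ M]+J^\Theta(X_0^t;M;c^t)$ over $\Theta\in\Pi$, $M\in\mathrm{Ball}^t$ (with $\Theta^t$ arbitrary if $\mathrm{Ball}^t=\emptyset$); here $J^\Theta(X_0;M;c)=\sum_n\mathbb E\sum_{h<H_n}w(z_{h,n})$ with $z_{0,n}=\boldsymbol\phi_{x_{0,n}}$, $z_{h+1,n}=\Psi(\Theta)^\dagger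 Mz_{h,n}+\epsilon_h$, $\epsilon_h$ i.i.d. $\mathcal N(0,\sigma^2I)$. **Information gains.** With the maximum (supremum) over all learning algorithms facing the same adversary, let $\gamma_{T,\mathscr A}=2\max\mathbb E\log\frac{\det\Sigma^T_{\mathscr A}}{\det\Sigma^0_{\mathscr A}}$, $\gamma_{2,T,\mathscr A}=2\max\mathbb E\big(\log\frac{\det\Sigma^T_{\mathscr A}}{\det\Sigma^0_{\mathscr A}}\big)^2$, $\gamma_{T,\mathscr B}=2\max\mathbb E\log\frac{\det\Sigma^T_{\mathscr B}}{\det\Sigma^0_{\mathscr B}}$, all assumed finite. **Theorem.** There is an absolute constant $C_1$ such that in every such setting and for all $T$, the regret of KS-LC³ is integrable and $$\mathbb E[\mathrm{Regret}_T]\le C_1(\tilde d_{T,1}+\tilde d_{T,2})\,T^{1-\alpha/2},$$ where $$\tilde d_{T,1}^2=(1+\gamma_{T,\mathscr B})\big[L^2(1+C^{-1})^2\tilde\beta_{2,T}+(L^2+\Lambda_{\max}L)(1+C^{-1})\tilde\beta_{1,T}+\Lambda_{\max}^2+L^2\big],$$ $$\tilde d_{T,2}^2=\gamma_{T,\mathscr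 A}HV_{\max}(\gamma_{T,\mathscr A}+d_\phi+\log T+H),$$ $$\tilde\beta_{1,T}=\sigma^2(d_\phi+\log T+\gamma_{T,\mathscr A}),\qquad \tilde\beta_{2,T}=\sigma^4\big((d_\phi+\log T+\gamma_{T,\mathscr A})^2+\gamma_{2,T,\mathscr A}\big).$$ In particular, if $\alpha=1$ and the three information gains grow at most polylogarithmically in $T$, then $\mathbb E[\mathrm{Regret}_T]=\tilde O(\sqrt T)$, that is, at most $b(1+\log T)^q\sqrt T$ for some $b,q$ and all $T\ge1$. -/

import Mathlib

open MeasureTheory ProbabilityTheory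
open scoped NNReal ENNReal

universe uΩ uX uP uH

noncomputable section

namespace KSNR

/-- The coordinate space `ℝ^d` with its Euclidean norm. -/
abbrev E (d : ℕ) : Type := EuclideanSpace ℝ (Fin d)

/-! ### Random dynamical systems and Koopman operators -/

/-- A random dynamical system on `𝒳` in discrete time: a probability space with a semigroup of
measure preserving maps, and a measurable cocycle over it. -/
structure RDS (𝒳 : Type uX) [MeasurableSpace 𝒳] where
  Ω : Type uΩ
  mΩ : MeasurableSpace Ω
  P : Measure Ω
  prob : IsProbabilityMeasure P
  shift : ℕ → Ω → Ω
  shift_zero : shift 0 = id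
  shift_add : ∀ r s, shift (r + s) = shift r ∘ shift s
  shift_mp : ∀ r, MeasurePreserving (shift r) P P
  F : ℕ → Ω → 𝒳 → 𝒳
  F_meas : ∀ r, Measurable fun p : Ω × 𝒳 => F r p.1 p.2
  F_zero : ∀ ω x, F 0 ω x = x
  F_add : ∀ r s ω x, F (r + s) ω x = F r (shift s ω) (F s ω x)

attribute [instance] RDS.mΩ RDS.prob

/-- The Koopman operator `[𝒦 g](x) = 𝔼[g(F(1, ω, x))]`. -/
def RDS.koopman {𝒳 : Type uX} [MeasurableSpace 𝒳] (D : RDS.{uΩ} 𝒳) (g : 𝒳 → ℝ) (x : 𝒳) : ℝ :=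
  ∫ ω, g (D.F 1 ω x) ∂D.P

/-- The law of the trajectory `(F(h, ω, x))_{h ≥ 0}` started at `x`. -/
def RDS.trajLaw {𝒳 : Type uX} [MeasurableSpace 𝒳] (D : RDS.{uΩ} 𝒳) (x : 𝒳) : Measure (ℕ → 𝒳) :=
  D.P.map fun ω h => D.F h ω x

/-! ### Hilbert–Schmidt operators `ℝ^d → H'` and the functional determinant -/

section HS

variable {d : ℕ} {H' : Type*} [NormedAddCommGroup H'] [InnerProductSpace ℝ H']

/-- The Hilbert space of (all, hence Hilbert–Schmidt) operators `ℝ^d → H'`; an operator `M` is stored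
as the family `(M e_i)_i`, so that `⟪M, N⟫ = ∑ i, ⟪M e_i, N e_i⟫` and the norm is the
Hilbert–Schmidt norm. -/
abbrev HSOp (d : ℕ) (H' : Type*) : Type _ := PiLp 2 fun _ : Fin d => H'

/-- The identification of `HSOp d H'` with the bounded operators `ℝ^d → H'` (the latter carry the
operator norm). -/
def HSOp.op : HSOp d H' ≃ₗ[ℝ] (E d →L[ℝ] H') :=
  (WithLp.linearEquiv 2 ℝ (Fin d → H')).trans
    (((EuclideanSpace.basisFun (Fin d) ℝ).toBasis.constr ℝ).trans LinearMap.toContinuousLinearMap)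

theorem HSOp.op_apply (M : HSOp d H') (z : E d) : HSOp.op M z = ∑ i, z i • M i := by
  simp [HSOp.op, Module.Basis.constr_apply_fintype]

/-- The operator `M ↦ Q (M z)`, see `evalOp_apply`. -/
def evalOp (Q : H' →L[ℝ] E d) (z : E d) : HSOp d H' →L[ℝ] E d :=
  Q ∘L ∑ i, z i • PiLp.proj 2 (fun _ : Fin d => H') i

theorem evalOp_apply (Q : H' →L[ℝ] E d) (z : E d) (M : HSOp d H') :
    evalOp Q z M = Q (HSOp.op M z) := by
  simp [evalOp, HSOp.op_apply]

/-- The operator `M ↦ Q ∘ M`, see `op_compOp`. -/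
def compOp (Q : H' →L[ℝ] E d) : HSOp d H' →L[ℝ] HSOp d (E d) :=
  ((PiLp.continuousLinearEquiv 2 ℝ fun _ : Fin d => E d).symm : (Fin d → E d) →L[ℝ] HSOp d (E d)) ∘L
    ContinuousLinearMap.pi fun i => Q ∘L PiLp.proj 2 (fun _ : Fin d => H') i

theorem op_compOp (Q : H' →L[ℝ] E d) (M : HSOp d H') :
    HSOp.op (compOp Q M) = Q ∘L HSOp.op M := by
  ext1 z
  simp [compOp, HSOp.op_apply]

end HS

/-- The functional (Fredholm) determinant of an operator `S = I + K` with `K` of finite rank: the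
determinant of the endomorphism that `S` induces on the range of `K = S - I`. In finite dimension it
is the usual determinant. -/
def fredholmDet {V : Type*} [NormedAddCommGroup V] [NormedSpace ℝ V] (S : V →L[ℝ] V) : ℝ :=
  LinearMap.det (M := LinearMap.range ((S - 1 : V →L[ℝ] V) : V →ₗ[ℝ] V))
    (LinearMap.id +
      ((S - 1 : V →L[ℝ] V) : V →ₗ[ℝ] V).rangeRestrict ∘ₗ
        (LinearMap.range ((S - 1 : V →L[ℝ] V) : V →ₗ[ℝ] V)).subtype)

/-! ### The learning problem -/

/-- The data of the learning problem: a random dynamical system for every parameter, features, the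
noise level, the operators `𝒦(Θ)` on `ℝ^d`, the feature operators `Ψ(Θ)`, the spectrum cost `Λ` and
the initial set of candidate operators. What is assumed of them is stated separately. -/
structure Model (Par : Type uP) (𝒳 : Type uX) [MeasurableSpace 𝒳] (d : ℕ) (H' : Type uH) [NormedAddCommGroup H']
    [InnerProductSpace ℝ H'] where
  sys : Par → RDS.{uΩ} 𝒳
  φ : Fin d → 𝒳 → ℝ
  σ : ℝ
  𝒦 : Par → E d →L[ℝ] E d
  Ψ : Par → E d →L[ℝ] H'
  Λ : (E d →L[ℝ] E d) → ℝ≥0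
  Ball₀ : Set (HSOp d H')

/-- What the adversary picks for one episode: `N` initial states with horizons (only the indices
`n < N` matter), the single-step cost `c`, and its expression `w` in terms of the features. -/
structure Ctx (𝒳 : Type*) (d : ℕ) where
  N : ℕ
  x₀ : ℕ → 𝒳
  hor : ℕ → ℕ
  c : 𝒳 → ℝ≥0
  w : E d → ℝ≥0

/-- The record of one episode: the parameter that was played and the trajectories `x n h`. -/
abbrev Ep (Par 𝒳 : Type*) : Type _ := Par × (ℕ → ℕ → 𝒳)

/-- The history of the first `t` episodes. -/
abbrev Hist (Par 𝒳 : Type*) (t : ℕ) : Type _ := Fin t → Ep Par 𝒳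

/-- The part of a history that precedes episode `τ`. -/
def Hist.before {Par 𝒳 : Type*} {t : ℕ} (h : Hist Par 𝒳 t) (τ : Fin t) : Hist Par 𝒳 τ :=
  fun i => h ⟨i, i.2.trans τ.2⟩

/-- An (adaptive) adversary: at the beginning of each episode it picks `X₀^t` and `c^t`, knowing the
history. -/
abbrev Adversary (Par 𝒳 : Type*) (d : ℕ) : Type _ := (t : ℕ) → Hist Par 𝒳 t → Ctx 𝒳 d

/-- An algorithm: at each episode it picks a parameter, knowing the history. (The adversary's move of
the current episode is itself a function of the history.) -/
abbrev Policy (Par 𝒳 : Type*) : Type _ := (t : ℕ) → Hist Par 𝒳 t → Par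

section Problem

variable {Par : Type uP} {𝒳 : Type uX} [MeasurableSpace Par] [MeasurableSpace 𝒳] {d : ℕ}
  {H' : Type uH} [NormedAddCommGroup H'] [InnerProductSpace ℝ H'] [CompleteSpace H']

namespace Model

variable (S : Model.{uΩ} Par 𝒳 d H')

/-- The feature vector `𝛟_x`. -/
def feat (x : 𝒳) : E d := WithLp.toLp 2 fun i => S.φ i x

/-- `Ψ(Θ)† ∘ M`. -/
def lift (Θ : Par) (M : HSOp d H') : E d →L[ℝ] E d :=
  ContinuousLinearMap.adjoint (S.Ψ Θ) ∘L HSOp.op M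

/-! #### Costs -/

/-- The expected cumulative cost `J^Θ(X₀; c)` under the true dynamics. -/
def J (Θ : Par) (X : Ctx 𝒳 d) : ℝ≥0∞ :=
  ∑ n ∈ Finset.range X.N,
    ∫⁻ ω, ∑ h ∈ Finset.range (X.hor n), (X.c ((S.sys Θ).F h ω (X.x₀ n)) : ℝ≥0∞) ∂(S.sys Θ).P

/-- The law of i.i.d. noise variables `ε_{h,i} ∼ 𝒩(0, σ²)`. -/
def noiseLaw : Measure (ℕ × Fin d → ℝ) :=
  Measure.infinitePi fun _ => gaussianReal 0 ⟨S.σ ^ 2, sq_nonneg _⟩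

end Model

/-- The feature trajectory `z_{h+1} = A z_h + ε_h` with `z_0 = z`. -/
def chain (A : E d →L[ℝ] E d) (z : E d) (e : ℕ × Fin d → ℝ) : ℕ → E d
  | 0 => z
  | h + 1 => A (chain A z e h) + WithLp.toLp 2 fun i => e (h, i)

namespace Model

variable (S : Model.{uΩ} Par 𝒳 d H')

/-- The expected cumulative cost `J^Θ(X₀; M; c)` under the dynamics in which the features evolve by
`𝛟_{x_{h+1}} = [Ψ(Θ)† ∘ M] 𝛟_{x_h} + ε`; the cost is a function `w` of the features. -/
def modelJ (Θ : Par) (X : Ctx 𝒳 d) (M : HSOp d H') : ℝ≥0∞ :=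
  ∑ n ∈ Finset.range X.N,
    ∫⁻ e, ∑ h ∈ Finset.range (X.hor n),
      (X.w (chain (S.lift Θ M) (S.feat (X.x₀ n)) e h) : ℝ≥0∞) ∂S.noiseLaw

/-- `min_Θ (Λ[𝒦(Θ)] + J^Θ(X₀; c))`. -/
def optValue (X : Ctx 𝒳 d) : ℝ≥0∞ := ⨅ Θ, ((S.Λ (S.𝒦 Θ) : ℝ≥0∞) + S.J Θ X)

/-- The regret after `T` episodes, as a function of what happened in them. -/
def regret (adv : Adversary Par 𝒳 d) {T : ℕ} (h : Hist Par 𝒳 T) : ℝ :=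
  ∑ τ : Fin T,
      ((S.Λ (S.𝒦 (h τ).1) : ℝ) +
        ∑ n ∈ Finset.range (adv τ (h.before τ)).N,
          ∑ k ∈ Finset.range ((adv τ (h.before τ)).hor n),
            ((adv τ (h.before τ)).c ((h τ).2 n k) : ℝ)) -
    ∑ τ : Fin T, (S.optValue (adv τ (h.before τ))).toReal

/-! #### The interaction protocol -/

/-- The law of the trajectories of one episode: independent across the initial states. -/
def episodeLaw (Θ : Par) (x₀ : ℕ → 𝒳) : Measure (ℕ → ℕ → 𝒳) :=
  Measure.infinitePi fun n => (S.sys Θ).trajLaw (x₀ n)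

/-- The law of the history of the first `t` episodes when `pol` plays against `adv`. -/
def histLaw (adv : Adversary Par 𝒳 d) (pol : Policy Par 𝒳) : (t : ℕ) → Measure (Hist Par 𝒳 t)
  | 0 => Measure.dirac Fin.elim0
  | t + 1 => (histLaw adv pol t).bind fun h =>
      (S.episodeLaw (pol t h) (adv t h).x₀).map fun x =>
        Fin.snoc (α := fun _ => Ep Par 𝒳) h (pol t h, x)

/-! #### Confidence sets -/

/-- `𝒜(M) = [Ψ(Θ)† ∘ M](𝛟_x)`. -/
def opA (Θ : Par) (x : 𝒳) : HSOp d H' →L[ℝ] E d :=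
  evalOp (ContinuousLinearMap.adjoint (S.Ψ Θ)) (S.feat x)

/-- `ℬ(M) = Ψ(Θ)† ∘ M`. -/
def opB (Θ : Par) : HSOp d H' →L[ℝ] HSOp d (E d) :=
  compOp (ContinuousLinearMap.adjoint (S.Ψ Θ))

/-- `Σ_𝒜^t`. -/
def sigmaA (lam : ℝ) (adv : Adversary Par 𝒳 d) {t : ℕ} (h : Hist Par 𝒳 t) :
    HSOp d H' →L[ℝ] HSOp d H' :=
  lam • 1 + ∑ τ : Fin t, ∑ n ∈ Finset.range (adv τ (h.before τ)).N,
    ∑ k ∈ Finset.range ((adv τ (h.before τ)).hor n),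
      ContinuousLinearMap.adjoint (S.opA (h τ).1 ((h τ).2 n k)) ∘L S.opA (h τ).1 ((h τ).2 n k)

/-- `Σ_ℬ^t`. -/
def sigmaB (lam : ℝ) {t : ℕ} (h : Hist Par 𝒳 t) : HSOp d H' →L[ℝ] HSOp d H' :=
  lam • 1 + ∑ τ : Fin t, ContinuousLinearMap.adjoint (S.opB (h τ).1) ∘L S.opB (h τ).1

/-- `det Σ_𝒜^t / det Σ_𝒜^0`, with `Σ_𝒜^0 = λ I`, as the functional determinant of `λ⁻¹ Σ_𝒜^t`. -/
def detRatioA (lam : ℝ) (adv : Adversary Par 𝒳 d) {t : ℕ} (h : Hist Par 𝒳 t) : ℝ :=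
  fredholmDet (lam⁻¹ • S.sigmaA lam adv h)

/-- `det Σ_ℬ^t / det Σ_ℬ^0`, with `Σ_ℬ^0 = λ I`, as the functional determinant of `λ⁻¹ Σ_ℬ^t`. -/
def detRatioB (lam : ℝ) {t : ℕ} (h : Hist Par 𝒳 t) : ℝ :=
  fredholmDet (lam⁻¹ • S.sigmaB lam h)

/-- The regularized least squares loss that defines `M̄^t`. -/
def ridgeLoss (lam : ℝ) (adv : Adversary Par 𝒳 d) {t : ℕ} (h : Hist Par 𝒳 t) (M : HSOp d H') : ℝ :=
  ∑ τ : Fin t, ∑ n ∈ Finset.range (adv τ (h.before τ)).N,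
      ∑ k ∈ Finset.range ((adv τ (h.before τ)).hor n),
        ‖S.feat ((h τ).2 n (k + 1)) - S.opA (h τ).1 ((h τ).2 n k) M‖ ^ 2 +
    lam * ‖M‖ ^ 2

/-- The radius `β_M^t`. -/
def beta (lam : ℝ) (adv : Adversary Par 𝒳 d) {t : ℕ} (h : Hist Par 𝒳 t) : ℝ :=
  20 * S.σ ^ 2 * (d + Real.log (t * S.detRatioA lam adv h))

/-- The confidence set `Ball_M^t`: the given set for `t = 0`, and its intersection with the ellipsoid
`‖(Σ_𝒜^t)^{1/2} (M - M̄^t)‖² ≤ β_M^t` afterwards (Hilbert–Schmidt norm, so that the left-hand side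
is `⟪M - M̄^t, Σ_𝒜^t (M - M̄^t)⟫`). -/
def ball (lam : ℝ) (adv : Adversary Par 𝒳 d) {t : ℕ} (h : Hist Par 𝒳 t) : Set (HSOp d H') :=
  {M ∈ S.Ball₀ | t ≠ 0 → ∃ Mbar, IsMinOn (S.ridgeLoss lam adv h) Set.univ Mbar ∧
    inner ℝ (M - Mbar) (S.sigmaA lam adv h (M - Mbar)) ≤ S.beta lam adv h}

/-- `pol` is KS-LC³ during the first `T` episodes: in each of them the oracle returns a joint
minimizer over `Θ` and over `M` in the current confidence set. (The algorithm does not say what to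
play should the confidence set be empty; then any choice is allowed.) -/
def IsKSLC3 (lam : ℝ) (adv : Adversary Par 𝒳 d) (pol : Policy Par 𝒳) (T : ℕ) : Prop :=
  (∀ t, Measurable (pol t)) ∧
    ∃ Mhat : (t : ℕ) → Hist Par 𝒳 t → HSOp d H', ∀ t < T, ∀ᵐ h ∂S.histLaw adv pol t,
      (S.ball lam adv h).Nonempty →
        Mhat t h ∈ S.ball lam adv h ∧
        ∀ Θ, ∀ M ∈ S.ball lam adv h,
          (S.Λ (S.lift (pol t h) (Mhat t h)) : ℝ≥0∞) + S.modelJ (pol t h) (adv t h) (Mhat t h) ≤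
            (S.Λ (S.lift Θ M) : ℝ≥0∞) + S.modelJ Θ (adv t h) M

/-! #### Expected maximum information gains -/

/-- `γ_{T,𝒜}(λ)`; the maximum is over all algorithms, against the given adversary. -/
def gainA (lam : ℝ) (adv : Adversary Par 𝒳 d) (T : ℕ) : ℝ≥0∞ :=
  2 * ⨆ (pol : Policy Par 𝒳) (_ : ∀ t, Measurable (pol t)),
    ∫⁻ h, ENNReal.ofReal (Real.log (S.detRatioA lam adv h)) ∂S.histLaw adv pol T

/-- `γ_{2,T,𝒜}(λ)`. -/
def gainA₂ (lam : ℝ) (adv : Adversary Par 𝒳 d) (T : ℕ) : ℝ≥0∞ :=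
  2 * ⨆ (pol : Policy Par 𝒳) (_ : ∀ t, Measurable (pol t)),
    ∫⁻ h, ENNReal.ofReal (Real.log (S.detRatioA lam adv h) ^ 2) ∂S.histLaw adv pol T

/-- `γ_{T,ℬ}(λ)`. -/
def gainB (lam : ℝ) (adv : Adversary Par 𝒳 d) (T : ℕ) : ℝ≥0∞ :=
  2 * ⨆ (pol : Policy Par 𝒳) (_ : ∀ t, Measurable (pol t)),
    ∫⁻ h, ENNReal.ofReal (Real.log (S.detRatioB lam h)) ∂S.histLaw adv pol T

/-! #### Assumptions -/

/-- The features are a basis of a function space that is invariant under all Koopman operators, and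
one step of the dynamics perturbs the features by additive Gaussian noise that is independent across
time steps and indices. -/
def GaussianFeatures : Prop :=
  LinearIndependent ℝ S.φ ∧ (∀ i, Measurable (S.φ i)) ∧
    ∀ Θ, (∀ i, (S.sys Θ).koopman (S.φ i) ∈ Submodule.span ℝ (Set.range S.φ)) ∧
      ∃ ε : Fin d → (S.sys Θ).Ω → ℝ, (∀ i, Measurable (ε i)) ∧
        (∀ x ω i, S.φ i ((S.sys Θ).F 1 ω x) = (S.sys Θ).koopman (S.φ i) x + ε i ω) ∧
        (∀ i, (S.sys Θ).P.map (ε i) = gaussianReal 0 ⟨S.σ ^ 2, sq_nonneg _⟩) ∧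
        iIndepFun (fun (p : ℕ × Fin d) ω => ε p.2 ((S.sys Θ).shift p.1 ω)) (S.sys Θ).P

/-- `𝒦(Θ)` is the realization of the Koopman operator on `ℝ^d`. -/
def IsKoopmanRealization : Prop :=
  ∀ Θ x i, (S.sys Θ).koopman (S.φ i) x = S.𝒦 Θ (S.feat x) i

/-- The function-valued RKHS model: for every `v` the map `Θ ↦ 𝒦(Θ) v` is `Θ ↦ Ψ(Θ)† ψ` for some
`ψ`. -/
def RKHS : Prop :=
  ∀ v : E d, ∃ ψ : H', ∀ Θ, S.𝒦 Θ v = ContinuousLinearMap.adjoint (S.Ψ Θ) ψ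

/-- `M⋆` represents the Koopman operators: `𝒦(Θ) = Ψ(Θ)† ∘ M⋆`. -/
def Represents (Mstar : HSOp d H') : Prop := ∀ Θ, S.𝒦 Θ = S.lift Θ Mstar

/-- In the function-valued RKHS model an operator `M⋆` as above exists. -/
theorem exists_represents (hS : S.RKHS) : ∃ Mstar, S.Represents Mstar := by
  choose ψ hψ using fun i => hS (EuclideanSpace.basisFun (Fin d) ℝ i)
  refine ⟨WithLp.toLp 2 ψ, fun Θ => ?_⟩
  ext1 z
  conv_lhs => rw [← (EuclideanSpace.basisFun (Fin d) ℝ).sum_repr z]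
  simp only [map_sum, map_smul, hψ, lift, ContinuousLinearMap.comp_apply, HSOp.op_apply,
    EuclideanSpace.basisFun_repr]

/-- The modified Hölder condition on `Λ` and its boundedness on the initial set. -/
def HolderCost (L α Λmax : ℝ) : Prop :=
  (∀ (A : E d →L[ℝ] E d) (Θ : Par), |(S.Λ A : ℝ) - S.Λ (S.𝒦 Θ)| ≤
      L * max (‖A - S.𝒦 Θ‖ ^ 2) (‖A - S.𝒦 Θ‖ ^ α)) ∧
    ∀ Θ, ∀ M ∈ S.Ball₀, |(S.Λ (S.lift Θ M) : ℝ)| ≤ Λmax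

/-- The cost is the function `w` of the features. -/
def Realizable (X : Ctx 𝒳 d) : Prop := ∀ x, X.c x = X.w (S.feat x)

/-- There is at least one initial state, all horizons are positive, the smallest eigenvalue of
`∑ n, 𝛟_{x_{0,n}} 𝛟_{x_{0,n}}†` is at least `C`, and the horizons add up to at most `H`. -/
def Excites (X : Ctx 𝒳 d) (C : ℝ) (H : ℕ) : Prop :=
  0 < X.N ∧ (∀ n < X.N, 0 < X.hor n) ∧
    (∀ v : E d, C * ‖v‖ ^ 2 ≤ ∑ n ∈ Finset.range X.N, inner ℝ (S.feat (X.x₀ n)) v ^ 2) ∧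
    ∑ n ∈ Finset.range X.N, X.hor n ≤ H

/-- The second moments of the cumulative costs are bounded by `Vmax`, uniformly in `Θ`. -/
def MomentBound (X : Ctx 𝒳 d) (Vmax : ℝ) : Prop :=
  ∀ Θ, ∑ n ∈ Finset.range X.N,
    ∫⁻ ω, (∑ h ∈ Finset.range (X.hor n), (X.c ((S.sys Θ).F h ω (X.x₀ n)) : ℝ≥0∞)) ^ 2
      ∂(S.sys Θ).P ≤ ENNReal.ofReal Vmax

/-- Measurable dependence on the parameter: `Ψ` is measurable, and the trajectory laws form a
kernel. -/
def MeasurableModel : Prop :=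
  StronglyMeasurable S.Ψ ∧ Measurable fun p : Par × 𝒳 => (S.sys p.1).trajLaw p.2

end Model

/-- Measurable dependence of the adversary's moves on the history. -/
def MeasurableAdversary (adv : Adversary Par 𝒳 d) : Prop :=
  ∀ t, Measurable (fun h => (adv t h).N) ∧ (∀ n, Measurable fun h => (adv t h).hor n) ∧
    (∀ n, Measurable fun h => (adv t h).x₀ n) ∧
    Measurable fun p : Hist Par 𝒳 t × E d => (adv t p.1).w p.2

end Problem

/-! ### The quantities in the bound -/

/-- `β̃_{1,T}`. -/
def betaTilde₁ (σ : ℝ) (d T : ℕ) (γA : ℝ) : ℝ := σ ^ 2 * (d + Real.log T + γA)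

/-- `β̃_{2,T}`. -/
def betaTilde₂ (σ : ℝ) (d T : ℕ) (γA γA₂ : ℝ) : ℝ := σ ^ 4 * ((d + Real.log T + γA) ^ 2 + γA₂)

/-- `d̃_{T,1}`. -/
def dTilde₁ (σ : ℝ) (d T : ℕ) (L Λmax C γA γA₂ γB : ℝ) : ℝ :=
  Real.sqrt ((1 + γB) *
    (L ^ 2 * (1 + C⁻¹) ^ 2 * betaTilde₂ σ d T γA γA₂ +
      (L ^ 2 + Λmax * L) * (1 + C⁻¹) * betaTilde₁ σ d T γA + Λmax ^ 2 + L ^ 2))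

/-- `d̃_{T,2}`. -/
def dTilde₂ (d T H : ℕ) (Vmax γA : ℝ) : ℝ :=
  Real.sqrt (γA * H * Vmax * (γA + d + Real.log T + H))

end KSNR

end

open KSNR

/-! The theorem is optimism in the face of uncertainty, carried out in feature space. Along a
trajectory of the true system the features form a linear Gaussian chain z' = 𝒦(Θ) z + ε
(`map_feat_trajLaw`), so expected costs, estimation errors and comparisons of models all concern
such chains.

Confidence. Every coordinate of every observed step is a scalar observation ⟨a, M⋆⟩ + noise, with a
vector a in the Hilbert–Schmidt space that is known before the noise is drawn. With ξ the sum of the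
noise-weighted vectors and Σ the information operator, the mean of exp(⟨ξ, Σ⁻¹ξ⟩/(2σ²)) / √det(λ⁻¹Σ)
is preserved by one more Gaussian observation (`selfNorm_add_rankOne`). It therefore has mean at
most one along the history, and by Markov's inequality it exceeds t in episode t with probability at
most 1/t. Otherwise the ridge error puts M⋆ into the confidence set, and all members of the set are
close to M⋆ (`mem_ball_of_histSelfNorm_le`).

Good episodes. Since M⋆ competes in the joint minimization, the value that the chosen model predicts
for the chosen Θ is at most the optimal value. What remains is the difference between the true and
the predicted value of the same Θ. The spectral part uses the Hölder condition. The operator error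
is measured in the metric of Σ_ℬ, which is at most (1 + C⁻¹) Σ_𝒜 because the initial states are
exciting (`inner_sigmaB_le`). The cost part uses that the expected costs of two chains differ by at
most twice the root of the second moment under the true chain times the Hellinger distance
(`chainCost_le`), and that the squared Hellinger distance is at most 5 𝔼 min(1, gap), where the gap
is accumulated along the true chain (`hell_le`). Both bounds involve the model chain only through
its operator, so nothing has to be assumed about costs under the model. The proof of `hell_le`
compares with a chain that follows the model drift only while the accumulated gap is at most one.

Bad episodes. The chosen parameter is compared with a near-optimal one, both through the zero
operator. The regularization controls this distance by the information after one more episode. As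
the information gains are suprema over all algorithms, they also bound what a one-episode deviation
to the comparator would gain (`lintegral_infoNext_le`). A failure probability 1/t costs about 1/√t
after Cauchy–Schwarz, which sums to √T.

Summation. Truncated step informations are dominated by increments of twice the log-determinant
(`min_one_le_log_det_sub`), and these telescope to the information gains. Cauchy–Schwarz over the
episodes gives √T for the costs. For the spectrum, w^α is replaced by its affine bound η^α + η^(α-1)
w with η = (1 + γ_ℬ)/T, which gives T^(1-α/2). -/

set_option linter.unusedSectionVars false

noncomputable section

namespace KSNR

/-! ### The functional determinant of a finite rank perturbation -/

section Determinant

/-- The Weinstein–Aronszajn identity for linear maps. -/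
theorem det_id_add_comp_comm {A B : Type*} [AddCommGroup A] [Module ℝ A] [FiniteDimensional ℝ A]
    [AddCommGroup B] [Module ℝ B] [FiniteDimensional ℝ B] (f : A →ₗ[ℝ] B) (g : B →ₗ[ℝ] A) :
    LinearMap.det (LinearMap.id + g ∘ₗ f) = LinearMap.det (LinearMap.id + f ∘ₗ g) := by
  classical
  let a := Module.finBasis ℝ A
  let b := Module.finBasis ℝ B
  rw [← LinearMap.det_toMatrix a, ← LinearMap.det_toMatrix b, map_add, map_add,
    LinearMap.toMatrix_comp a b a, LinearMap.toMatrix_comp b a b, LinearMap.toMatrix_id,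
    LinearMap.toMatrix_id, Matrix.det_one_add_mul_comm]

variable {V : Type*} [NormedAddCommGroup V] [InnerProductSpace ℝ V]

/-- The functional determinant can be computed through any factorization of `S - 1`. -/
theorem fredholmDet_eq_of_factor {B : Type*} [AddCommGroup B] [Module ℝ B] [FiniteDimensional ℝ B]
    (S : V →L[ℝ] V) (f : V →ₗ[ℝ] B) (g : B →ₗ[ℝ] V) (h : ∀ x, S x = x + g (f x)) :
    fredholmDet S = LinearMap.det (LinearMap.id + f ∘ₗ g) := by
  have hK : ((S - 1 : V →L[ℝ] V) : V →ₗ[ℝ] V) = g ∘ₗ f := by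
    ext x; simp [h]
  unfold fredholmDet
  rw [hK]
  set W := LinearMap.range (g ∘ₗ f)
  set W' := LinearMap.range g
  have hfin : FiniteDimensional ℝ W' := inferInstance
  have hle : W ≤ W' := LinearMap.range_comp_le_range f g
  have hfin' : FiniteDimensional ℝ W := Submodule.finiteDimensional_of_le hle
  -- The determinant is defined on the range of `g ∘ₗ f`. Two cyclic swaps carry it to the range of
  -- `g` and from there to `B`, where it no longer depends on the factorized operator's range.
  have e1 : (g ∘ₗ f).rangeRestrict ∘ₗ W.subtype =
      ((g ∘ₗ f).rangeRestrict ∘ₗ W'.subtype) ∘ₗ Submodule.inclusion hle := by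
    ext x; simp
  rw [e1, det_id_add_comp_comm]
  have e2 : Submodule.inclusion hle ∘ₗ (g ∘ₗ f).rangeRestrict ∘ₗ W'.subtype =
      g.rangeRestrict ∘ₗ (f ∘ₗ W'.subtype) := by
    ext x; simp
  rw [e2, det_id_add_comp_comm]
  congr 1

/-- The functional determinant of `1 + ∑ i, u i ⊗ v i`. -/
theorem fredholmDet_one_add_sum {ι : Type*} [Fintype ι] [DecidableEq ι] (S : V →L[ℝ] V)
    (u v : ι → V) (h : ∀ x, S x = x + ∑ i, inner ℝ (v i) x • u i) :
    fredholmDet S = (1 + Matrix.of fun i j => inner ℝ (v i) (u j)).det := by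
  let f : V →ₗ[ℝ] (ι → ℝ) := LinearMap.pi fun i => (innerSL ℝ (v i) : V →ₗ[ℝ] ℝ)
  let g : (ι → ℝ) →ₗ[ℝ] V := Fintype.linearCombination ℝ u
  have hfg : ∀ x, S x = x + g (f x) := by
    intro x; rw [h]; simp [f, g, Fintype.linearCombination_apply]
  rw [fredholmDet_eq_of_factor S f g hfg, ← LinearMap.det_toMatrix', map_add, LinearMap.toMatrix'_id]
  congr 2
  ext i j
  simp [f, g, LinearMap.toMatrix'_apply, Fintype.linearCombination_apply, Pi.single_apply]

end Determinant

/-! ### Information operators `λ + ∑ i, a i ⊗ a i` -/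

section InfoOp

variable {V : Type*} [NormedAddCommGroup V] [InnerProductSpace ℝ V]
variable {ι κ : Type*} [Fintype ι] [Fintype κ]

/-- The operator `λ + ∑ i, a i ⊗ a i`. -/
def infoOp (lam : ℝ) (a : ι → V) : V →L[ℝ] V :=
  lam • 1 + ∑ i, InnerProductSpace.rankOne ℝ (a i) (a i)

theorem infoOp_apply (lam : ℝ) (a : ι → V) (x : V) :
    infoOp lam a x = lam • x + ∑ i, inner ℝ (a i) x • a i := by
  simp [infoOp]

theorem infoOp_sumElim (lam : ℝ) (a : ι → V) (b : κ → V) :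
    infoOp lam (Sum.elim a b) =
      infoOp lam a + ∑ j, InnerProductSpace.rankOne ℝ (b j) (b j) := by
  simp [infoOp, add_assoc]

theorem inner_infoOp (lam : ℝ) (a : ι → V) (x y : V) :
    inner ℝ x (infoOp lam a y) = lam * inner ℝ x y + ∑ i, inner ℝ (a i) x * inner ℝ (a i) y := by
  simp only [infoOp_apply, inner_add_right, inner_smul_right, inner_sum]
  congr 1
  refine Finset.sum_congr rfl fun i _ => ?_
  rw [real_inner_comm x]; ring

theorem inner_infoOp_self (lam : ℝ) (a : ι → V) (x : V) :
    inner ℝ x (infoOp lam a x) = lam * ‖x‖ ^ 2 + ∑ i, inner ℝ (a i) x ^ 2 := by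
  rw [inner_infoOp, real_inner_self_eq_norm_sq]
  simp [pow_two]

theorem infoOp_symm (lam : ℝ) (a : ι → V) (x y : V) :
    inner ℝ (infoOp lam a x) y = inner ℝ x (infoOp lam a y) := by
  rw [real_inner_comm, inner_infoOp, inner_infoOp, real_inner_comm x y]
  simp [mul_comm]

theorem inner_infoOp_self_nonneg {lam : ℝ} (hl : 0 < lam) (a : ι → V) (x : V) :
    0 ≤ inner ℝ x (infoOp lam a x) := by
  rw [inner_infoOp_self]; positivity

/-- The rank-one terms factor through `ι → ℝ`, which reduces the determinant to that of a finite
Gram matrix. Positivity and measurability of the determinant are both read off from this form. -/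
theorem fredholmDet_infoOp [DecidableEq ι] {lam : ℝ} (hl : 0 < lam) (a : ι → V) :
    fredholmDet (lam⁻¹ • infoOp lam a) = (1 + lam⁻¹ • Matrix.gram ℝ a).det := by
  rw [fredholmDet_one_add_sum (lam⁻¹ • infoOp lam a) (fun i => lam⁻¹ • a i) a]
  · congr 2
    ext i j
    simp [Matrix.gram_apply, inner_smul_right]
  · intro x
    simp only [smul_apply, infoOp_apply, smul_add, smul_smul,
      inv_mul_cancel₀ hl.ne', one_smul, Finset.smul_sum]
    simp only [mul_comm]

/-- In terms of the nonnegative eigenvalues μ_i this is 1 + ∑ μ_i ≤ ∏ (1 + μ_i). -/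
theorem one_add_trace_le_det_one_add [DecidableEq ι] {G : Matrix ι ι ℝ} (hG : G.PosSemidef) :
    1 + G.trace ≤ (1 + G).det := by
  have h1 : (1 + G).det = ∏ i, (1 + hG.isHermitian.eigenvalues i) := by
    -- The characteristic polynomial at -1 is det(-(1 + G)) and also ∏ (-1 - μ_i); the sign (-1)^n
    -- cancels.
    have hc := hG.isHermitian.charpoly_eq
    have h2 := congrArg (Polynomial.eval (-1)) hc
    rw [Matrix.eval_charpoly, Polynomial.eval_prod] at h2
    have h3 : (Matrix.scalar ι (-1 : ℝ) - G) = -(1 + G) := by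
      rw [map_neg, map_one]; abel
    rw [h3, Matrix.det_neg] at h2
    have h4 : ∏ i, Polynomial.eval (-1 : ℝ)
        (Polynomial.X - Polynomial.C ((hG.isHermitian.eigenvalues i : ℝ) : ℝ)) =
        (-1) ^ Fintype.card ι * ∏ i, (1 + hG.isHermitian.eigenvalues i) := by
      rw [← Finset.card_univ, ← Finset.prod_const, ← Finset.prod_mul_distrib]
      refine Finset.prod_congr rfl fun i _ => ?_
      simp; ring
    have h5 := h2.trans h4
    have h6 : ((-1 : ℝ)) ^ Fintype.card ι ≠ 0 := pow_ne_zero _ (by norm_num)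
    exact mul_left_cancel₀ h6 h5
  rw [h1, hG.isHermitian.trace_eq_sum_eigenvalues]
  have hnn := hG.eigenvalues_nonneg
  have : ∀ s : Finset ι, 1 + ∑ i ∈ s, hG.isHermitian.eigenvalues i ≤
      ∏ i ∈ s, (1 + hG.isHermitian.eigenvalues i) := by
    intro s
    induction s using Finset.induction_on with
    | empty => simp
    | insert i s hi ih =>
      rw [Finset.sum_insert hi, Finset.prod_insert hi]
      have : 0 ≤ ∑ i ∈ s, hG.isHermitian.eigenvalues i := Finset.sum_nonneg fun i _ => hnn i
      nlinarith [hnn i, mul_nonneg (hnn i) this]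
  simpa using this Finset.univ

theorem one_le_fredholmDet_infoOp {lam : ℝ} (hl : 0 < lam) (a : ι → V) :
    1 ≤ fredholmDet (lam⁻¹ • infoOp lam a) := by
  classical
  rw [fredholmDet_infoOp hl]
  have h2 := one_add_trace_le_det_one_add ((Matrix.posSemidef_gram ℝ a).smul (inv_nonneg.2 hl.le))
  have h3 := ((Matrix.posSemidef_gram ℝ a).smul (inv_nonneg.2 hl.le)).trace_nonneg
  linarith

variable [CompleteSpace V]

/-- Coercivity, ⟨Tx, x⟩ ≥ λ‖x‖², gives invertibility even when `V` is infinite dimensional. -/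
theorem isUnit_infoOp {lam : ℝ} (hl : 0 < lam) (a : ι → V) : IsUnit (infoOp lam a) := by
  refine ContinuousLinearMap.isUnit_of_forall_le_norm_inner_map _ (c := ⟨lam, hl.le⟩) hl fun x => ?_
  rw [infoOp_symm, inner_infoOp_self, Real.norm_eq_abs]
  refine le_trans ?_ (le_abs_self _)
  have : 0 ≤ ∑ i, inner ℝ (a i) x ^ 2 := by positivity
  change ‖x‖ ^ 2 * lam ≤ _
  linarith

/-- The inverse of an information operator. -/
def infoInv (lam : ℝ) (a : ι → V) : V →L[ℝ] V := Ring.inverse (infoOp lam a)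

theorem infoOp_infoInv {lam : ℝ} (hl : 0 < lam) (a : ι → V) (x : V) :
    infoOp lam a (infoInv lam a x) = x := by
  have := Ring.mul_inverse_cancel _ (isUnit_infoOp hl a)
  exact congrArg (fun T : V →L[ℝ] V => T x) this

theorem infoInv_infoOp {lam : ℝ} (hl : 0 < lam) (a : ι → V) (x : V) :
    infoInv lam a (infoOp lam a x) = x := by
  have := Ring.inverse_mul_cancel _ (isUnit_infoOp hl a)
  exact congrArg (fun T : V →L[ℝ] V => T x) this

theorem infoInv_symm {lam : ℝ} (hl : 0 < lam) (a : ι → V) (x y : V) :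
    inner ℝ (infoInv lam a x) y = inner ℝ x (infoInv lam a y) := by
  conv_lhs => rw [← infoOp_infoInv hl a y, ← infoOp_symm, infoOp_infoInv hl]

theorem inner_infoInv_self_nonneg {lam : ℝ} (hl : 0 < lam) (a : ι → V) (x : V) :
    0 ≤ inner ℝ x (infoInv lam a x) := by
  have := inner_infoOp_self_nonneg hl a (infoInv lam a x)
  rwa [infoOp_infoInv hl, real_inner_comm] at this

/-- Cauchy–Schwarz for the inner product of an information operator. -/
theorem inner_sq_le_infoInv {lam : ℝ} (hl : 0 < lam) (a : ι → V) (b x : V) :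
    inner ℝ b x ^ 2 ≤ inner ℝ b (infoInv lam a b) * inner ℝ x (infoOp lam a x) := by
  set y := infoInv lam a b with hy
  have hb : b = infoOp lam a y := (infoOp_infoInv hl a b).symm
  -- The quadratic s ↦ ⟨s x - y, T(s x - y)⟩ is nonnegative, so its discriminant is not positive.
  have key : ∀ s : ℝ, 0 ≤ inner ℝ x (infoOp lam a x) * (s * s) + (-(2 * inner ℝ b x)) * s +
      inner ℝ b y := by
    intro s
    have h := inner_infoOp_self_nonneg hl a (s • x - y)
    have h1 : inner ℝ x (infoOp lam a y) = inner ℝ b x := by rw [← hb, real_inner_comm]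
    have h2 : inner ℝ y (infoOp lam a x) = inner ℝ b x := by rw [← infoOp_symm, ← hb]
    have h3 : inner ℝ y (infoOp lam a y) = inner ℝ b y := by rw [← hb, real_inner_comm]
    simp only [map_sub, map_smul, inner_sub_left, inner_sub_right, real_inner_smul_left,
      real_inner_smul_right, h1, h2, h3] at h
    linarith
  have := discrim_le_zero key
  rw [discrim] at this
  linarith [this]

/-- How the determinant changes when vectors are added to an information operator. -/
theorem fredholmDet_infoOp_sumElim [DecidableEq κ] {lam : ℝ} (hl : 0 < lam) (a : ι → V)
    (b : κ → V) :
    fredholmDet (lam⁻¹ • infoOp lam (Sum.elim a b)) = fredholmDet (lam⁻¹ • infoOp lam a) *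
      (1 + Matrix.of fun i j => inner ℝ (b i) (infoInv lam a (b j))).det := by
  classical
  set R := infoInv lam a
  let f₁ : V →ₗ[ℝ] (ι → ℝ) := LinearMap.pi fun i => (innerSL ℝ (a i) : V →ₗ[ℝ] ℝ)
  let g₁ : (ι → ℝ) →ₗ[ℝ] V := Fintype.linearCombination ℝ fun i => lam⁻¹ • a i
  let f₂ : V →ₗ[ℝ] (κ → ℝ) := LinearMap.pi fun i => (innerSL ℝ (b i) : V →ₗ[ℝ] ℝ)
  let g₂ : (κ → ℝ) →ₗ[ℝ] V := Fintype.linearCombination ℝ fun i => R (b i)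
  -- `W` contains the ranges of both corrections, so the three determinants become determinants on
  -- one finite-dimensional space and can be multiplied.
  let W : Submodule ℝ V := LinearMap.range g₁ ⊔ LinearMap.range g₂
  let g₁' : (ι → ℝ) →ₗ[ℝ] W := g₁.codRestrict W fun x => Submodule.mem_sup_left ⟨x, rfl⟩
  let g₂' : (κ → ℝ) →ₗ[ℝ] W := g₂.codRestrict W fun x => Submodule.mem_sup_right ⟨x, rfl⟩
  have hS : ∀ x, (lam⁻¹ • infoOp lam a) x = x + g₁ (f₁ x) := by
    intro x
    simp only [smul_apply, infoOp_apply, smul_add, smul_smul,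
      inv_mul_cancel₀ hl.ne', one_smul, Finset.smul_sum, g₁, f₁,
      Fintype.linearCombination_apply]
    simp [mul_comm]
  have hSR : ∀ x, g₁ (f₁ (R x)) = lam⁻¹ • x - R x := by
    intro x
    have := hS (R x)
    rw [smul_apply, infoOp_infoInv hl] at this
    rw [this]; abel
  -- Because λ⁻¹ Σ R = λ⁻¹, the updated operator is the product (1 + g₁ f₁)(1 + g₂ f₂); the new
  -- vectors enter only the second factor.
  have hT : ∀ x, (lam⁻¹ • infoOp lam (Sum.elim a b)) x =
      x + g₁ (f₁ x) + g₂ (f₂ x) + g₁ (f₁ (g₂ (f₂ x))) := by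
    intro x
    have e : g₁ (f₁ (g₂ (f₂ x))) = (∑ j, (inner ℝ (b j) x) • (lam⁻¹ • b j)) - g₂ (f₂ x) := by
      have : g₂ (f₂ x) = R (∑ j, (inner ℝ (b j) x) • b j) := by
        simp [g₂, f₂, Fintype.linearCombination_apply]
      rw [this, hSR, Finset.smul_sum]
      simp only [smul_smul, mul_comm]
    rw [e, ← hS, infoOp_sumElim]
    simp only [smul_apply, add_apply, smul_add,
      sum_apply, InnerProductSpace.rankOne_apply, Finset.smul_sum, smul_smul,
      mul_comm]
    abel
  have h1 : fredholmDet (lam⁻¹ • infoOp lam a) =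
      LinearMap.det (LinearMap.id + g₁' ∘ₗ (f₁ ∘ₗ W.subtype)) := by
    rw [fredholmDet_eq_of_factor _ f₁ g₁ hS, det_id_add_comp_comm (f₁ ∘ₗ W.subtype) g₁']
    rfl
  have h2 : (1 + Matrix.of fun i j => inner ℝ (b i) (R (b j))).det =
      LinearMap.det (LinearMap.id + g₂' ∘ₗ (f₂ ∘ₗ W.subtype)) := by
    rw [det_id_add_comp_comm (f₂ ∘ₗ W.subtype) g₂', ← LinearMap.det_toMatrix', map_add, LinearMap.toMatrix'_id]
    congr 2
    ext i j
    simp [f₂, g₂, g₂', LinearMap.toMatrix'_apply, Fintype.linearCombination_apply, Pi.single_apply]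
  let F : V →ₗ[ℝ] W := g₁' ∘ₗ f₁ + g₂' ∘ₗ f₂ + g₁' ∘ₗ f₁ ∘ₗ g₂ ∘ₗ f₂
  have h3 : fredholmDet (lam⁻¹ • infoOp lam (Sum.elim a b)) =
      LinearMap.det (LinearMap.id + F ∘ₗ W.subtype) := by
    refine fredholmDet_eq_of_factor _ F W.subtype fun x => ?_
    rw [hT]
    simp [F, g₁', g₂', add_assoc]
  rw [h1, h2, h3, ← LinearMap.det_comp]
  congr 1
  ext x
  simp [F, g₁', g₂']
  abel

theorem posSemidef_infoInv {lam : ℝ} (hl : 0 < lam) (a : ι → V) (b : κ → V) :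
    (Matrix.of fun i j => inner ℝ (b i) (infoInv lam a (b j)) : Matrix κ κ ℝ).PosSemidef := by
  refine Matrix.PosSemidef.of_dotProduct_mulVec_nonneg ?_ fun x => ?_
  · ext i j
    simp only [Matrix.conjTranspose_apply, Matrix.of_apply, star_trivial]
    rw [← infoInv_symm hl, real_inner_comm]
  · have := inner_infoInv_self_nonneg hl a (∑ i, x i • b i)
    simp only [map_sum, map_smul, sum_inner, inner_sum, real_inner_smul_left,
      real_inner_smul_right] at this
    simp only [dotProduct, Matrix.mulVec, Matrix.of_apply, star_trivial, Finset.mul_sum,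
      Pi.star_apply]
    rw [Finset.sum_comm] at this
    exact this.trans_eq (Finset.sum_congr rfl fun i _ => Finset.sum_congr rfl fun j _ => by ring)

/-- The information gained by adding the vectors `b` dominates their total squared length in the
metric of the inverse information operator. -/
theorem min_one_le_log_det_sub {lam : ℝ} (hl : 0 < lam) (a : ι → V) (b : κ → V) :
    min 1 (∑ j, inner ℝ (b j) (infoInv lam a (b j))) ≤
      2 * (Real.log (fredholmDet (lam⁻¹ • infoOp lam (Sum.elim a b))) -
        Real.log (fredholmDet (lam⁻¹ • infoOp lam a))) := by
  classical
  have hG := one_add_trace_le_det_one_add (posSemidef_infoInv hl a b)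
  set D := (1 + Matrix.of fun i j => inner ℝ (b i) (infoInv lam a (b j)) : Matrix κ κ ℝ).det
  set u := ∑ j, inner ℝ (b j) (infoInv lam a (b j)) with hu
  have hu0 : 0 ≤ u := Finset.sum_nonneg fun j _ => inner_infoInv_self_nonneg hl a (b j)
  have htr : 1 + u ≤ D := by simpa [Matrix.trace, hu] using hG
  have hpos : 0 < fredholmDet (lam⁻¹ • infoOp lam a) :=
    zero_lt_one.trans_le (one_le_fredholmDet_infoOp hl a)
  rw [fredholmDet_infoOp_sumElim hl, Real.log_mul hpos.ne' (by linarith), add_sub_cancel_left]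
  -- After truncation at one the logarithm has a linear lower bound: log(1 + v) ≥ v/(1 + v) ≥ v/2 on
  -- [0, 1]. This is where the factor 2 comes from.
  have h1 : Real.log (1 + min 1 u) ≤ Real.log D :=
    Real.log_le_log (by positivity) (by linarith [min_le_right 1 u])
  refine le_trans ?_ (mul_le_mul_of_nonneg_left h1 zero_le_two)
  have hm0 : 0 ≤ min 1 u := le_min zero_le_one hu0
  have hm1 : min 1 u ≤ 1 := min_le_left _ _
  have h4 := Real.one_sub_inv_le_log_of_pos (show 0 < 1 + min 1 u by linarith)
  have h5 : min 1 u / 2 ≤ 1 - (1 + min 1 u)⁻¹ := by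
    rw [show 1 - (1 + min 1 u)⁻¹ = min 1 u / (1 + min 1 u) by field_simp; ring]
    exact div_le_div_of_nonneg_left hm0 (by linarith) (by linarith)
  linarith

end InfoOp

/-! ### Splitting product measures -/

section Split

variable {Y : Type*} [MeasurableSpace Y]

/-- An infinite product measure is determined by finite cylinders, and the index set of a cylinder
splits along `e` into two finite parts. -/
theorem infinitePi_eq_map_prod {ι α β : Type*} (μ : Measure Y) [IsProbabilityMeasure μ]
    (e : α ⊕ β ≃ ι) :
    Measure.infinitePi (fun _ : ι => μ) =
      ((Measure.infinitePi fun _ : α => μ).prod (Measure.infinitePi fun _ : β => μ)).map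
        (fun p i => Sum.elim p.1 p.2 (e.symm i)) := by
  classical
  have hm : Measurable (fun (p : (α → Y) × (β → Y)) (i : ι) => Sum.elim p.1 p.2 (e.symm i)) := by
    refine measurable_pi_lambda _ fun i => ?_
    rcases e.symm i with a | b
    · exact (measurable_pi_apply a).comp measurable_fst
    · exact (measurable_pi_apply b).comp measurable_snd
  symm
  refine Measure.eq_infinitePi _ fun s t ht => ?_
  let s' : Finset (α ⊕ β) := s.map e.symm.toEmbedding
  have hs : ∀ x, x ∈ s' ↔ e x ∈ s := by
    intro x; simp [s']
  have hpre : (fun (p : (α → Y) × (β → Y)) (i : ι) => Sum.elim p.1 p.2 (e.symm i)) ⁻¹'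
      ((s : Set ι).pi t) = ((s'.toLeft : Set α).pi fun a => t (e (Sum.inl a))) ×ˢ
        ((s'.toRight : Set β).pi fun b => t (e (Sum.inr b))) := by
    ext p
    simp only [Set.mem_preimage, Set.mem_pi, Finset.mem_coe, Set.mem_prod, Finset.mem_toLeft,
      Finset.mem_toRight, hs]
    constructor
    · intro h
      exact ⟨fun a ha => by simpa using h _ ha, fun b hb => by simpa using h _ hb⟩
    · rintro ⟨h1, h2⟩ i hi
      obtain ⟨x, rfl⟩ := e.surjective i
      rcases x with a | b
      · simpa using h1 a hi
      · simpa using h2 b hi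
  rw [Measure.map_apply hm (MeasurableSet.pi s.countable_toSet fun i _ => ht i), hpre,
    Measure.prod_prod, Measure.infinitePi_pi _ fun i _ => ht _,
    Measure.infinitePi_pi _ fun i _ => ht _]
  have : ∏ i ∈ s, μ (t i) = ∏ x ∈ s', μ (t (e x)) := by
    simp [s', Finset.prod_map]
  rw [this]
  conv_rhs => rw [← Finset.toLeft_disjSum_toRight (u := s'), Finset.prod_disjSum]

/-- Splitting the first factor off a product over `ℕ`. -/
theorem infinitePi_nat_eq_map (μ : Measure Y) [IsProbabilityMeasure μ] :
    Measure.infinitePi (fun _ : ℕ => μ) =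
      (μ.prod (Measure.infinitePi fun _ : ℕ => μ)).map
        (fun p n => Nat.casesOn (motive := fun _ => Y) n p.1 p.2) := by
  let e : Unit ⊕ ℕ ≃ ℕ :=
    { toFun := Sum.elim (fun _ => 0) Nat.succ
      invFun := fun n => Nat.casesOn n (Sum.inl ()) Sum.inr
      left_inv := by rintro (_ | _) <;> rfl
      right_inv := by rintro (_ | _) <;> rfl }
  have hU : (Measure.infinitePi fun _ : Unit => μ) = μ.map fun x _ => x := by
    symm
    refine Measure.eq_infinitePi _ fun s t ht => ?_
    rw [Measure.map_apply (f := fun (x : Y) (_ : Unit) => x)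
      (measurable_pi_lambda _ fun _ => measurable_id) (MeasurableSet.pi s.countable_toSet fun i _ => ht i)]
    rcases Finset.eq_empty_or_nonempty s with rfl | hs
    · simp
    · obtain ⟨u, hu⟩ := hs
      have : s = {()} := by ext x; cases x; cases u; simpa using hu
      subst this
      have : ∀ y : Y, (∀ i : Unit, y ∈ t i) ↔ y ∈ t () := fun y => ⟨fun h => h (), fun h _ => h⟩
      simp [Set.pi, this]
  have hid : (Measure.infinitePi fun _ : Unit => μ).prod (Measure.infinitePi fun _ : ℕ => μ) =
      (μ.prod (Measure.infinitePi fun _ : ℕ => μ)).map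
        (Prod.map (fun (x : Y) (_ : Unit) => x) id) := by
    rw [hU, ← Measure.map_prod_map (f := fun (x : Y) (_ : Unit) => x) _ _
      (measurable_pi_lambda _ fun _ => measurable_id) measurable_id, Measure.map_id]
  conv_lhs => rw [infinitePi_eq_map_prod μ e, hid]
  rw [Measure.map_map]
  · congr 1
    funext p n
    cases n <;> rfl
  · refine measurable_pi_lambda _ fun n => ?_
    rcases e.symm n with a | b
    · exact (measurable_pi_apply a).comp measurable_fst
    · exact (measurable_pi_apply b).comp measurable_snd
  · exact ((measurable_pi_lambda _ fun _ => measurable_id).comp measurable_fst).prodMk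
      measurable_snd

/-- No measurability of `f` is needed in this direction of Fubini, and upper bounds are all that the
supermartingale argument asks for. -/
theorem lintegral_infinitePi_nat_le (μ : Measure Y) [IsProbabilityMeasure μ]
    (f : (ℕ → Y) → ℝ≥0∞) :
    ∫⁻ y, f y ∂Measure.infinitePi (fun _ : ℕ => μ) ≤
      ∫⁻ x, ∫⁻ y, f (fun n => Nat.casesOn (motive := fun _ => Y) n x y)
        ∂Measure.infinitePi (fun _ : ℕ => μ) ∂μ := by
  conv_lhs => rw [infinitePi_nat_eq_map μ]
  exact (lintegral_map_le _ _).trans (lintegral_prod_le _)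

theorem lintegral_pi_fin_succ_le {n : ℕ} (μ : Measure Y) [IsProbabilityMeasure μ]
    (f : (Fin (n + 1) → Y) → ℝ≥0∞) :
    ∫⁻ y, f y ∂Measure.pi (fun _ : Fin (n + 1) => μ) ≤
      ∫⁻ x, ∫⁻ y, f (Fin.cons x y) ∂Measure.pi (fun _ : Fin n => μ) ∂μ := by
  have h := (measurePreserving_piFinSuccAbove (fun _ : Fin (n + 1) => μ) 0).symm
  rw [← h.map_eq, lintegral_map_equiv]
  refine (lintegral_prod_le _).trans_eq ?_
  simp [MeasurableEquiv.piFinSuccAbove, Fin.insertNthEquiv]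

theorem lintegral_pi_fin_succ {n : ℕ} (μ : Measure Y) [IsProbabilityMeasure μ]
    {f : (Fin (n + 1) → Y) → ℝ≥0∞} (hf : Measurable f) :
    ∫⁻ y, f y ∂Measure.pi (fun _ : Fin (n + 1) => μ) =
      ∫⁻ x, ∫⁻ y, f (Fin.cons x y) ∂Measure.pi (fun _ : Fin n => μ) ∂μ := by
  have h := (measurePreserving_piFinSuccAbove (fun _ : Fin (n + 1) => μ) 0).symm
  rw [← h.map_eq, lintegral_map_equiv]
  refine (lintegral_prod _ (hf.comp (MeasurableEquiv.measurable _)).aemeasurable).trans ?_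
  simp [MeasurableEquiv.piFinSuccAbove, Fin.insertNthEquiv]

end Split

/-! ### Gaussian noise -/

section Noise

/-- The variance `σ²` as a nonnegative real. -/
def nvar (σ : ℝ) : ℝ≥0 := ⟨σ ^ 2, sq_nonneg _⟩

theorem coe_nvar (σ : ℝ) : (nvar σ : ℝ) = σ ^ 2 := rfl

theorem nvar_ne_zero {σ : ℝ} (hσ : 0 < σ) : nvar σ ≠ 0 := fun h =>
  (pow_pos hσ 2).ne' (congrArg NNReal.toReal h)

/-- The law of `𝒩(0, σ² I)` on `ℝ^d`. -/
def gauss (σ : ℝ) (d : ℕ) : Measure (Fin d → ℝ) :=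
  Measure.pi fun _ => gaussianReal 0 (nvar σ)

instance (σ : ℝ) (d : ℕ) : IsProbabilityMeasure (gauss σ d) := by
  unfold gauss; infer_instance

/-- The law of i.i.d. noise variables `ε_{h,i} ∼ 𝒩(0, σ²)`. -/
def noise (σ : ℝ) (d : ℕ) : Measure (ℕ × Fin d → ℝ) :=
  Measure.infinitePi fun _ => gaussianReal 0 (nvar σ)

instance (σ : ℝ) (d : ℕ) : IsProbabilityMeasure (noise σ d) := by
  unfold noise; infer_instance

/-- Put `x` in front of the noise sequence `e`. -/
def consN {d : ℕ} (x : Fin d → ℝ) (e : ℕ × Fin d → ℝ) : ℕ × Fin d → ℝ :=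
  fun p => Nat.casesOn (motive := fun _ => ℝ) p.1 (x p.2) fun h => e (h, p.2)

variable {d : ℕ} {σ : ℝ}

@[simp] theorem consN_zero (x : Fin d → ℝ) (e : ℕ × Fin d → ℝ) (i : Fin d) :
    consN x e (0, i) = x i := rfl

@[simp] theorem consN_succ (x : Fin d → ℝ) (e : ℕ × Fin d → ℝ) (h : ℕ) (i : Fin d) :
    consN x e (h + 1, i) = e (h, i) := rfl

theorem measurable_consN :
    Measurable fun p : (Fin d → ℝ) × (ℕ × Fin d → ℝ) => consN p.1 p.2 := by
  refine measurable_pi_lambda _ ?_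
  rintro ⟨h, i⟩
  cases h with
  | zero => exact (measurable_pi_apply i).comp measurable_fst
  | succ h => exact (measurable_pi_apply (h, i)).comp measurable_snd

/-- The first step's noise is independent of the later noise, which again has the law `noise σ d`.
Inductions over the horizon rest on this. -/
theorem noise_eq_map (σ : ℝ) (d : ℕ) :
    noise σ d = ((gauss σ d).prod (noise σ d)).map fun p => consN p.1 p.2 := by
  let e : Fin d ⊕ (ℕ × Fin d) ≃ ℕ × Fin d :=
    { toFun := Sum.elim (fun i => (0, i)) fun p => (p.1 + 1, p.2)
      invFun := fun p => Nat.casesOn (motive := fun _ => Fin d ⊕ (ℕ × Fin d)) p.1 (Sum.inl p.2)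
        fun h => Sum.inr (h, p.2)
      left_inv := by rintro (_ | _) <;> rfl
      right_inv := by rintro ⟨_ | _, _⟩ <;> rfl }
  unfold noise gauss
  conv_lhs => rw [infinitePi_eq_map_prod _ e, Measure.infinitePi_eq_pi]
  congr 1
  funext p q
  obtain ⟨h, i⟩ := q
  cases h <;> rfl

theorem lintegral_noise_le (f : (ℕ × Fin d → ℝ) → ℝ≥0∞) :
    ∫⁻ e, f e ∂noise σ d ≤ ∫⁻ x, ∫⁻ e, f (consN x e) ∂noise σ d ∂gauss σ d := by
  conv_lhs => rw [noise_eq_map]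
  exact (lintegral_map_le _ _).trans (lintegral_prod_le _)

theorem lintegral_noise {f : (ℕ × Fin d → ℝ) → ℝ≥0∞} (hf : Measurable f) :
    ∫⁻ e, f e ∂noise σ d = ∫⁻ x, ∫⁻ e, f (consN x e) ∂noise σ d ∂gauss σ d := by
  conv_lhs => rw [noise_eq_map]
  rw [lintegral_map hf measurable_consN]
  exact lintegral_prod _ (hf.comp measurable_consN).aemeasurable

/-- Cameron–Martin in one dimension: the exponential is the ratio of the densities of 𝒩(m, v) and
𝒩(0, v). -/
theorem lintegral_gaussianReal_add {v : ℝ≥0} (hv : v ≠ 0) (m : ℝ) {f : ℝ → ℝ≥0∞}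
    (hf : Measurable f) :
    ∫⁻ x, f (m + x) ∂gaussianReal 0 v =
      ∫⁻ x, f x * ENNReal.ofReal (Real.exp ((m * x - m ^ 2 / 2) / v)) ∂gaussianReal 0 v := by
  have h1 : ∫⁻ x, f (m + x) ∂gaussianReal 0 v = ∫⁻ x, f x ∂gaussianReal m v := by
    have := gaussianReal_map_const_add (μ := 0) (v := v) m
    rw [zero_add] at this
    rw [← this, lintegral_map hf (measurable_const_add m)]
  have hv' : (v : ℝ) ≠ 0 := by exact_mod_cast hv
  rw [h1, gaussianReal_of_var_ne_zero _ hv, gaussianReal_of_var_ne_zero _ hv,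
    lintegral_withDensity_eq_lintegral_mul _ (measurable_gaussianPDF _ _) hf,
    lintegral_withDensity_eq_lintegral_mul _ (measurable_gaussianPDF _ _)
      (g := fun x => f x * ENNReal.ofReal (Real.exp ((m * x - m ^ 2 / 2) / v)))
      (hf.mul (by fun_prop))]
  refine lintegral_congr fun x => ?_
  simp only [Pi.mul_apply, gaussianPDF, gaussianPDFReal]
  rw [mul_comm (f x), ← mul_assoc, ← ENNReal.ofReal_mul (by positivity), mul_assoc (√_)⁻¹ _ (Real.exp _), ← Real.exp_add]
  congr 4
  field_simp
  ring

/-- The one-dimensional ratios multiply over independent coordinates. -/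
theorem lintegral_pi_gaussian_add {v : ℝ≥0} (hv : v ≠ 0) :
    ∀ (n : ℕ) (m : Fin n → ℝ) {f : (Fin n → ℝ) → ℝ≥0∞}, Measurable f →
    ∫⁻ x, f (m + x) ∂Measure.pi (fun _ : Fin n => gaussianReal 0 v) =
      ∫⁻ x, f x * ENNReal.ofReal (Real.exp ((∑ i, m i * x i - (∑ i, m i ^ 2) / 2) / v))
        ∂Measure.pi (fun _ : Fin n => gaussianReal 0 v)
  | 0, m, f, hf => by
    refine lintegral_congr fun x => ?_
    simp [Subsingleton.elim (m + x) x]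
  | n + 1, m, f, hf => by
    have hcons : Measurable fun p : ℝ × (Fin n → ℝ) => (Fin.cons p.1 p.2 : Fin (n + 1) → ℝ) := by
      refine measurable_pi_lambda _ fun i => ?_
      refine Fin.cases ?_ (fun j => ?_) i
      · exact measurable_fst
      · exact (measurable_pi_apply j).comp measurable_snd
    rw [lintegral_pi_fin_succ _ (f := fun x => f (m + x)) (hf.comp (measurable_const_add m)),
      lintegral_pi_fin_succ _ (f := fun x => f x * ENNReal.ofReal (Real.exp
        ((∑ i, m i * x i - (∑ i, m i ^ 2) / 2) / v))) (hf.mul (by fun_prop))]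
    have e1 : ∀ x (y : Fin n → ℝ), m + (Fin.cons x y : Fin (n + 1) → ℝ) =
        Fin.cons (m 0 + x) (Fin.tail m + y) := by
      intro x y
      funext i
      refine Fin.cases ?_ (fun j => ?_) i <;> simp [Fin.tail]
    simp only [e1]
    have e2 : ∀ x, ∫⁻ y, f (Fin.cons x (Fin.tail m + y))
          ∂Measure.pi (fun _ : Fin n => gaussianReal 0 v) =
        ∫⁻ y, f (Fin.cons x y) * ENNReal.ofReal (Real.exp
          ((∑ i, Fin.tail m i * y i - (∑ i, Fin.tail m i ^ 2) / 2) / v))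
          ∂Measure.pi (fun _ : Fin n => gaussianReal 0 v) := fun x =>
      lintegral_pi_gaussian_add hv n (Fin.tail m) (f := fun y => f (Fin.cons x y))
        (hf.comp (hcons.comp (measurable_const.prodMk measurable_id)))
    simp only [e2]
    have hmeas : Measurable fun x => ∫⁻ y, f (Fin.cons x y) * ENNReal.ofReal (Real.exp
          ((∑ i, Fin.tail m i * y i - (∑ i, Fin.tail m i ^ 2) / 2) / v))
          ∂Measure.pi (fun _ : Fin n => gaussianReal 0 v) := by
      refine Measurable.lintegral_prod_right' (f := fun p : ℝ × (Fin n → ℝ) =>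
        f (Fin.cons p.1 p.2) * ENNReal.ofReal (Real.exp
          ((∑ i, Fin.tail m i * p.2 i - (∑ i, Fin.tail m i ^ 2) / 2) / v))) ?_
      exact (hf.comp hcons).mul (by fun_prop)
    rw [lintegral_gaussianReal_add hv (m 0) hmeas]
    refine lintegral_congr fun x => ?_
    rw [← lintegral_mul_const _ ?_]
    · refine lintegral_congr fun y => ?_
      rw [mul_assoc, ← ENNReal.ofReal_mul (Real.exp_nonneg _), ← Real.exp_add]
      congr 3
      rw [Fin.sum_univ_succ, Fin.sum_univ_succ]
      simp only [Fin.tail, Fin.cons_zero, Fin.cons_succ]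
      ring
    · exact (hf.comp (hcons.comp (measurable_const.prodMk measurable_id))).mul (by fun_prop)

/-- The Gaussian density ratio of the shift by `m`. -/
def girsanov (σ : ℝ) (m x : E d) : ℝ := Real.exp ((inner ℝ m x - ‖m‖ ^ 2 / 2) / σ ^ 2)

theorem lintegral_gauss_add (hσ : 0 < σ) (m : E d) {f : E d → ℝ≥0∞} (hf : Measurable f) :
    ∫⁻ x, f (m + WithLp.toLp 2 x) ∂gauss σ d =
      ∫⁻ x, f (WithLp.toLp 2 x) * ENNReal.ofReal (girsanov σ m (WithLp.toLp 2 x)) ∂gauss σ d := by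
  have := lintegral_pi_gaussian_add (nvar_ne_zero hσ) d (WithLp.ofLp m) (f := fun x => f (WithLp.toLp 2 x))
    (hf.comp (WithLp.measurable_toLp 2 _))
  refine Eq.trans ?_ (this.trans ?_)
  · rfl
  · refine lintegral_congr fun x => ?_
    congr 4
    rw [EuclideanSpace.norm_sq_eq]
    simp [PiLp.inner_apply, mul_comm]

end Noise

/-! ### Laws of feature chains and their densities -/

section Chain

variable {d : ℕ}

/-- The pathwise Markov property: dropping the first step restarts the chain at its next state. -/
theorem chain_consN (A : E d →L[ℝ] E d) (z : E d) (x : Fin d → ℝ) (e : ℕ × Fin d → ℝ) (k : ℕ) :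
    chain A z (consN x e) (k + 1) = chain A (A z + WithLp.toLp 2 x) e k := by
  induction k with
  | zero => simp [chain]
  | succ k ih =>
    rw [chain, ih, chain]
    simp

/-- With the zero operator, the states after time zero are the noise variables themselves. This
chain is the common reference for all densities. -/
theorem chain_zero_consN (z : E d) (x : Fin d → ℝ) (e : ℕ × Fin d → ℝ) (k : ℕ) :
    chain 0 z (consN x e) (k + 1) = chain 0 (WithLp.toLp 2 x) e k := by
  rw [chain_consN]; simp

theorem continuous_chain (k : ℕ) :
    Continuous fun p : (E d →L[ℝ] E d) × E d × (ℕ × Fin d → ℝ) => chain p.1 p.2.1 p.2.2 k := by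
  induction k with
  | zero => simp only [chain]; fun_prop
  | succ k ih =>
    simp only [chain]
    refine (continuous_fst.clm_apply ih).add ?_
    refine (PiLp.continuous_toLp 2 _).comp ?_
    fun_prop

theorem measurable_chain {β : Type*} [MeasurableSpace β] {A : β → E d →L[ℝ] E d} {z : β → E d}
    {e : β → ℕ × Fin d → ℝ} (hA : Measurable A) (hz : Measurable z) (he : Measurable e) (k : ℕ) :
    Measurable fun b => chain (A b) (z b) (e b) k :=
  (continuous_chain k).measurable.comp (hA.prodMk (hz.prodMk he))

/-- The accumulated value of `q` along the reference chain `z, e_0, e_1, …`. -/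
def acc (q : E d → ℝ) (z : E d) (s : ℝ) (e : ℕ × Fin d → ℝ) (k : ℕ) : ℝ :=
  s + ∑ j ∈ Finset.range k, q (chain 0 z e j)

theorem acc_zero (q : E d → ℝ) (z : E d) (s : ℝ) (e : ℕ × Fin d → ℝ) : acc q z s e 0 = s := by
  simp [acc]

theorem acc_consN (q : E d → ℝ) (z : E d) (s : ℝ) (x : Fin d → ℝ) (e : ℕ × Fin d → ℝ) (k : ℕ) :
    acc q z s (consN x e) (k + 1) = acc q (WithLp.toLp 2 x) (s + q z) e k := by
  simp only [acc, Finset.sum_range_succ', chain_zero_consN]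
  rw [chain]
  ring

/-- The density, with respect to the reference chain, of the first `n` steps of the chain with
drift `m`; the drift may depend on the state and on the accumulated value of `q`. -/
def dens (σ : ℝ) (q : E d → ℝ) (m : E d → ℝ → E d) (n : ℕ) (z : E d) (s : ℝ)
    (e : ℕ × Fin d → ℝ) : ℝ :=
  ∏ k ∈ Finset.range n, girsanov σ (m (chain 0 z e k) (acc q z s e k)) (chain 0 z e (k + 1))

theorem girsanov_pos (σ : ℝ) (m x : E d) : 0 < girsanov σ m x := Real.exp_pos _

theorem dens_pos (σ : ℝ) (q : E d → ℝ) (m : E d → ℝ → E d) (n : ℕ) (z : E d) (s : ℝ)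
    (e : ℕ × Fin d → ℝ) : 0 < dens σ q m n z s e :=
  Finset.prod_pos fun _ _ => girsanov_pos _ _ _

theorem dens_consN (σ : ℝ) (q : E d → ℝ) (m : E d → ℝ → E d) (n : ℕ) (z : E d) (s : ℝ)
    (x : Fin d → ℝ) (e : ℕ × Fin d → ℝ) :
    dens σ q m (n + 1) z s (consN x e) =
      girsanov σ (m z s) (WithLp.toLp 2 x) * dens σ q m n (WithLp.toLp 2 x) (s + q z) e := by
  simp only [dens, Finset.prod_range_succ', chain_zero_consN, acc_consN, acc_zero]
  rw [mul_comm]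
  simp [chain]

theorem measurable_girsanov {β : Type*} [MeasurableSpace β] (σ : ℝ) {m x : β → E d}
    (hm : Measurable m) (hx : Measurable x) : Measurable fun b => girsanov σ (m b) (x b) := by
  unfold girsanov
  exact Real.measurable_exp.comp
    (((hm.inner hx).sub ((hm.norm.pow_const 2).div_const 2)).div_const _)

theorem measurable_acc {β : Type*} [MeasurableSpace β] {q : E d → ℝ} (hq : Measurable q)
    {z : β → E d} {s : β → ℝ} {e : β → ℕ × Fin d → ℝ} (hz : Measurable z) (hs : Measurable s)
    (he : Measurable e) (k : ℕ) : Measurable fun b => acc q (z b) (s b) (e b) k := by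
  unfold acc
  exact hs.add (Finset.measurable_sum _ fun j _ =>
    hq.comp (measurable_chain measurable_const hz he j))

theorem measurable_dens {β : Type*} [MeasurableSpace β] (σ : ℝ) {q : E d → ℝ} (hq : Measurable q)
    {m : E d → ℝ → E d} (hm : Measurable fun p : E d × ℝ => m p.1 p.2) (n : ℕ)
    {z : β → E d} {s : β → ℝ} {e : β → ℕ × Fin d → ℝ} (hz : Measurable z) (hs : Measurable s)
    (he : Measurable e) : Measurable fun b => dens σ q m n (z b) (s b) (e b) := by
  unfold dens
  refine Finset.measurable_prod _ fun k _ => measurable_girsanov σ ?_ ?_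
  · exact hm.comp ((measurable_chain measurable_const hz he k).prodMk
      (measurable_acc hq hz hs he k))
  · exact measurable_chain measurable_const hz he (k + 1)

variable {σ : ℝ}

theorem lintegral_girsanov (hσ : 0 < σ) (m : E d) :
    ∫⁻ x, ENNReal.ofReal (girsanov σ m (WithLp.toLp 2 x)) ∂gauss σ d = 1 := by
  have := lintegral_gauss_add hσ m (f := fun _ => 1) measurable_const
  simpa using this.symm

/-- The later steps integrate to one from every starting point, and then so does the first Girsanov
factor. The drift may use the accumulated value of `q`, which the truncated density in `hell_le`
needs. -/
theorem lintegral_dens (hσ : 0 < σ) {q : E d → ℝ} (hq : Measurable q)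
    {m : E d → ℝ → E d} (hm : Measurable fun p : E d × ℝ => m p.1 p.2) (n : ℕ) (z : E d) (s : ℝ) :
    ∫⁻ e, ENNReal.ofReal (dens σ q m n z s e) ∂noise σ d = 1 := by
  induction n generalizing z s with
  | zero => simp [dens]
  | succ n ih =>
    rw [lintegral_noise (f := fun e => ENNReal.ofReal (dens σ q m (n + 1) z s e))
      (measurable_dens σ hq hm (n + 1) measurable_const measurable_const
        measurable_id).ennreal_ofReal]
    simp only [dens_consN, ENNReal.ofReal_mul (girsanov_pos _ _ _).le]
    rw [← lintegral_girsanov hσ (m z s)]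
    refine lintegral_congr fun x => ?_
    rw [lintegral_const_mul, ih, mul_one]
    exact (measurable_dens σ hq hm n measurable_const measurable_const
      measurable_id).ennreal_ofReal

/-- The law of the first `n` steps of the chain with operator `A` has density `dens` with respect
to the reference chain. -/
theorem lintegral_chain (hσ : 0 < σ) (A : E d →L[ℝ] E d) (n : ℕ) (z : E d) (s : ℝ) {q : E d → ℝ}
    (hq : Measurable q) {F : (ℕ → E d) → ℝ≥0∞} (hF : Measurable F)
    (hdep : ∀ y y' : ℕ → E d, (∀ k ≤ n, y k = y' k) → F y = F y') :
    ∫⁻ e, F (chain A z e) ∂noise σ d =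
      ∫⁻ e, F (chain 0 z e) * ENNReal.ofReal (dens σ q (fun z _ => A z) n z s e) ∂noise σ d := by
  have hchain : ∀ (B : E d →L[ℝ] E d), Measurable fun p : E d × (ℕ × Fin d → ℝ) =>
      chain B p.1 p.2 := fun B => measurable_pi_lambda _ fun k =>
    measurable_chain measurable_const measurable_fst measurable_snd k
  have hA : Measurable fun p : E d × ℝ => A p.1 := A.continuous.measurable.comp measurable_fst
  induction n generalizing z s F with
  | zero =>
    refine lintegral_congr fun e => ?_
    simp only [dens, Finset.range_zero, Finset.prod_empty, ENNReal.ofReal_one, mul_one]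
    refine hdep _ _ fun k hk => ?_
    obtain rfl : k = 0 := by omega
    rfl
  | succ n ih =>
    -- `G` sees the path from time one on, with the starting state frozen; it depends on one
    -- coordinate fewer than `F`.
    let G : (ℕ → E d) → ℝ≥0∞ := fun y => F fun k => Nat.casesOn (motive := fun _ => E d) k z y
    have hG : Measurable G := by
      refine hF.comp (measurable_pi_lambda _ fun k => ?_)
      cases k with
      | zero => exact measurable_const
      | succ k => exact measurable_pi_apply k
    have hGdep : ∀ y y' : ℕ → E d, (∀ k ≤ n, y k = y' k) → G y = G y' := by
      intro y y' h
      refine hdep _ _ fun k hk => ?_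
      cases k with
      | zero => rfl
      | succ k => exact h k (by omega)
    have hc : ∀ (B : E d →L[ℝ] E d) x e,
        F (chain B z (consN x e)) = G (chain B (B z + WithLp.toLp 2 x) e) := by
      intro B x e
      refine congrArg F (funext fun k => ?_)
      cases k with
      | zero => rfl
      | succ k => exact chain_consN B z x e k
    have hm1 : ∀ B : E d →L[ℝ] E d, Measurable fun e => F (chain B z e) := fun B =>
      hF.comp ((hchain B).comp (measurable_const.prodMk measurable_id))
    have hd : ∀ n, Measurable fun p : E d × (ℕ × Fin d → ℝ) =>
        ENNReal.ofReal (dens σ q (fun z _ => A z) n p.1 (s + q z) p.2) := fun n =>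
      (measurable_dens σ hq (m := fun z _ => A z) hA n measurable_fst measurable_const measurable_snd).ennreal_ofReal
    rw [lintegral_noise (hm1 A), lintegral_noise (f := fun e => F (chain 0 z e) *
      ENNReal.ofReal (dens σ q (fun z _ => A z) (n + 1) z s e)) ((hm1 0).mul
      (measurable_dens σ hq (m := fun z _ => A z) hA (n + 1) measurable_const measurable_const
        measurable_id).ennreal_ofReal)]
    simp only [hc, dens_consN]
    let Φ : E d → (ℕ × Fin d → ℝ) → ℝ≥0∞ := fun y e => G (chain 0 y e) *
      ENNReal.ofReal (dens σ q (fun z _ => A z) n y (s + q z) e)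
    have hΦ : Measurable fun p : E d × (ℕ × Fin d → ℝ) => Φ p.1 p.2 :=
      (hG.comp (hchain 0)).mul (hd n)
    have h1 : ∀ x : Fin d → ℝ, ∫⁻ e, G (chain A (A z + WithLp.toLp 2 x) e) ∂noise σ d =
        (fun y => ∫⁻ e, Φ y e ∂noise σ d) (A z + WithLp.toLp 2 x) := fun x => ih _ _ hG hGdep
    simp only [h1]
    -- Only the first step is shifted here; the induction hypothesis has already replaced the later
    -- steps by reference noise and a density.
    have h2 := lintegral_gauss_add hσ (A z) (f := fun y => ∫⁻ e, Φ y e ∂noise σ d)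
      hΦ.lintegral_prod_right'
    refine h2.trans (lintegral_congr fun x => ?_)
    have h3 : Measurable fun e => Φ (WithLp.toLp 2 x) e :=
      hΦ.comp (measurable_const.prodMk measurable_id)
    refine (lintegral_mul_const _ h3).symm.trans (lintegral_congr fun e => ?_)
    simp only [Φ]
    rw [ENNReal.ofReal_mul (girsanov_pos _ _ _).le]
    simp only [zero_apply, zero_add]
    rw [mul_assoc, mul_comm (ENNReal.ofReal (dens _ _ _ _ _ _ _))]

end Chain

/-! ### Hellinger distance between the laws of two chains -/

section Hellinger

variable {d : ℕ} {σ : ℝ}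

/-- The density of the first `n` steps of the chain with operator `A`. -/
def densOf (σ : ℝ) (A : E d →L[ℝ] E d) (n : ℕ) (z : E d) (e : ℕ × Fin d → ℝ) : ℝ :=
  dens σ (fun _ => 0) (fun z _ => A z) n z 0 e

/-- The squared Hellinger distance between the laws of the first `n` steps of two chains. -/
def hell (σ : ℝ) (A B : E d →L[ℝ] E d) (n : ℕ) (z : E d) : ℝ≥0∞ :=
  ∫⁻ e, ENNReal.ofReal ((√(densOf σ A n z e) - √(densOf σ B n z e)) ^ 2) ∂noise σ d

/-- The squared drift difference along the first `n` steps of `y`, in units of the noise level. -/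
def gap (σ : ℝ) (D : E d →L[ℝ] E d) (n : ℕ) (y : ℕ → E d) : ℝ :=
  ∑ k ∈ Finset.range n, ‖D (y k)‖ ^ 2 / σ ^ 2

theorem gap_nonneg (σ : ℝ) (D : E d →L[ℝ] E d) (n : ℕ) (y : ℕ → E d) : 0 ≤ gap σ D n y := by
  unfold gap; positivity

theorem hell_comm (A B : E d →L[ℝ] E d) (n : ℕ) (z : E d) : hell σ A B n z = hell σ B A n z := by
  unfold hell
  refine lintegral_congr fun e => ?_
  congr 1; ring

theorem measurable_densOf (A : E d →L[ℝ] E d) (n : ℕ) (z : E d) :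
    Measurable (densOf σ A n z) :=
  measurable_dens σ measurable_const (A.continuous.measurable.comp measurable_fst) n
    measurable_const measurable_const measurable_id

theorem hell_triangle (A B C : E d →L[ℝ] E d) (n : ℕ) (z : E d) :
    hell σ A B n z ≤ 2 * hell σ A C n z + 2 * hell σ B C n z := by
  unfold hell
  have h1 := measurable_densOf (σ := σ) A n z
  have h2 := measurable_densOf (σ := σ) B n z
  have h3 := measurable_densOf (σ := σ) C n z
  rw [← lintegral_const_mul _ (by fun_prop), ← lintegral_const_mul _ (by fun_prop),
    ← lintegral_add_left (by fun_prop)]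
  refine lintegral_mono fun e => ?_
  have h2 : (2 : ℝ≥0∞) = ENNReal.ofReal 2 := by simp
  rw [h2, ← ENNReal.ofReal_mul zero_le_two, ← ENNReal.ofReal_mul zero_le_two,
    ← ENNReal.ofReal_add (by positivity) (by positivity)]
  refine ENNReal.ofReal_le_ofReal ?_
  nlinarith [sq_nonneg ((√(densOf σ A n z e) - √(densOf σ C n z e)) +
    (√(densOf σ B n z e) - √(densOf σ C n z e)))]

/-- Partial sums increase, so the retained terms form an initial segment, and its total is at most
one. -/
theorem sum_truncated_le (q : ℕ → ℝ) (hq : ∀ k, 0 ≤ q k) (n : ℕ) :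
    ∑ k ∈ Finset.range n, (if ∑ j ∈ Finset.range (k + 1), q j ≤ 1 then q k else 0) ≤
      min 1 (∑ k ∈ Finset.range n, q k) := by
  induction n with
  | zero => simp
  | succ n ih =>
    rw [Finset.sum_range_succ _ n, Finset.sum_range_succ q n]
    have h0 : 0 ≤ q n := hq n
    split_ifs with h
    · have := ih.trans (min_le_right _ _)
      exact le_min (by linarith) (by linarith)
    · rw [add_zero]
      exact ih.trans (min_le_min_left _ (by linarith))

/-- The parallelogram law in the exponent: the geometric mean of two Gaussian tilts is the tilt by
the midpoint, damped by the squared distance of the drifts. -/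
theorem girsanov_mul (m m' x : E d) :
    girsanov σ m x * girsanov σ m' x =
      girsanov σ ((1 / 2 : ℝ) • (m + m')) x ^ 2 * Real.exp (-(‖m - m'‖ ^ 2 / σ ^ 2) / 4) := by
  unfold girsanov
  rw [← Real.exp_add, ← Real.exp_nat_mul, ← Real.exp_add]
  congr 1
  have h1 : ‖(1 / 2 : ℝ) • (m + m')‖ ^ 2 =
      (‖m‖ ^ 2 + 2 * inner ℝ m m' + ‖m'‖ ^ 2) / 4 := by
    rw [norm_smul, mul_pow, norm_add_sq_real]; norm_num; ring
  have h2 := norm_sub_sq_real m m'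
  rw [h1, h2, real_inner_smul_left, inner_add_left]
  push_cast
  ring

/-- The total drift of the chains and of their truncation. -/
theorem hell_le (hσ : 0 < σ) (A B : E d →L[ℝ] E d) (n : ℕ) (z : E d) :
    hell σ A B n z ≤
      5 * ∫⁻ e, ENNReal.ofReal (min 1 (gap σ (A - B) n (chain A z e))) ∂noise σ d := by
  classical
  let q : E d → ℝ := fun y => ‖(A - B) y‖ ^ 2 / σ ^ 2
  have hq0 : ∀ y, 0 ≤ q y := fun y => by positivity
  have hq : Measurable q := by
    have : Continuous q := by fun_prop
    exact this.measurable
  let mA : E d → ℝ → E d := fun y _ => A y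
  -- The truncated drift follows `B` as long as the accumulated gap, the present step included, is
  -- at most one, and `A` afterwards. Thus it never differs from `A` by a total gap above one.
  let mT : E d → ℝ → E d := fun y s => if s + q y ≤ 1 then B y else A y
  -- The midpoint drift makes the affinity of `p` and `t` computable: its density has mass one.
  let mH : E d → ℝ → E d := fun y s => (1 / 2 : ℝ) • (mA y s + mT y s)
  have hA : Measurable fun p : E d × ℝ => A p.1 := A.continuous.measurable.comp measurable_fst
  have hB : Measurable fun p : E d × ℝ => B p.1 := B.continuous.measurable.comp measurable_fst
  have hT : Measurable fun p : E d × ℝ => mT p.1 p.2 :=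
    Measurable.ite (measurableSet_le (measurable_snd.add (hq.comp measurable_fst))
      measurable_const) hB hA
  have hH : Measurable fun p : E d × ℝ => mH p.1 p.2 := by
    exact (hA.add hT).const_smul (1 / 2 : ℝ)
  let p : (ℕ × Fin d → ℝ) → ℝ := densOf σ A n z
  let r : (ℕ × Fin d → ℝ) → ℝ := densOf σ B n z
  let t : (ℕ × Fin d → ℝ) → ℝ := dens σ q mT n z 0
  let u : (ℕ × Fin d → ℝ) → ℝ := dens σ q mH n z 0
  let s : (ℕ × Fin d → ℝ) → ℝ := fun e => ∑ k ∈ Finset.range n,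
    if acc q z 0 e (k + 1) ≤ 1 then q (chain 0 z e k) else 0
  let g : (ℕ × Fin d → ℝ) → ℝ := fun e => gap σ (A - B) n (chain 0 z e)
  have hacc : ∀ e k, acc q z 0 e (k + 1) = acc q z 0 e k + q (chain 0 z e k) := by
    intro e k; simp [acc, Finset.sum_range_succ]
  have hgacc : ∀ e, g e = acc q z 0 e n := by intro e; simp [g, gap, acc, q]
  have hmono : ∀ e, Monotone fun k => acc q z 0 e k := fun e =>
    monotone_nat_of_le_succ fun k => by rw [hacc]; linarith [hq0 (chain 0 z e k)]
  have hp0 : ∀ e, 0 < p e := fun e => dens_pos _ _ _ _ _ _ _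
  have hr0 : ∀ e, 0 < r e := fun e => dens_pos _ _ _ _ _ _ _
  have ht0 : ∀ e, 0 < t e := fun e => dens_pos _ _ _ _ _ _ _
  have hu0 : ∀ e, 0 < u e := fun e => dens_pos _ _ _ _ _ _ _
  have hs0 : ∀ e, 0 ≤ s e := fun e => Finset.sum_nonneg fun k _ => by
    split_ifs
    · exact hq0 _
    · exact le_rfl
  have hs1 : ∀ e, s e ≤ min 1 (g e) := by
    intro e
    have := sum_truncated_le (fun k => q (chain 0 z e k)) (fun k => hq0 _) n
    rw [hgacc]
    simpa only [s, acc, zero_add] using this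
  -- the truncated density agrees with that of `B` where the total gap is at most one
  have htr : ∀ e, g e ≤ 1 → t e = r e := by
    intro e he
    refine Finset.prod_congr rfl fun k hk => ?_
    have hk' : acc q z 0 e k + q (chain 0 z e k) ≤ 1 := by
      rw [← hacc]
      refine le_trans (hmono e (Nat.succ_le_of_lt (Finset.mem_range.1 hk))) ?_
      exact (hgacc e).symm.trans_le he
    simp only [mT, if_pos hk']
  -- The damping factors multiply to exp(-s/4), where `s` collects only the steps at which the
  -- truncated drift still differs from `A`.
  have hpt : ∀ e, p e * t e = u e ^ 2 * Real.exp (-(s e) / 4) := by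
    intro e
    simp only [p, t, u, s, densOf, dens]
    rw [← Finset.prod_mul_distrib, ← Finset.prod_pow, ← Finset.sum_neg_distrib, Finset.sum_div,
      Real.exp_sum, ← Finset.prod_mul_distrib]
    refine Finset.prod_congr rfl fun k _ => ?_
    rw [girsanov_mul]
    simp only [mH, mA, mT, hacc]
    split_ifs with h
    · rfl
    · simp
  have hsq : ∀ e, √(p e) * √(t e) = u e * Real.exp (-(s e) / 8) := by
    intro e
    rw [← Real.sqrt_mul (hp0 e).le, hpt]
    have : Real.exp (-(s e) / 4) = Real.exp (-(s e) / 8) ^ 2 := by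
      rw [← Real.exp_nat_mul]; congr 1; push_cast; ring
    rw [this, ← mul_pow, Real.sqrt_sq (mul_nonneg (hu0 e).le (Real.exp_nonneg _))]
  -- integrability
  have hcross : ∀ {m : E d → ℝ → E d}, (Measurable fun p : E d × ℝ => m p.1 p.2) →
      ∀ {q' : E d → ℝ}, Measurable q' → Integrable (dens σ q' m n z 0) (noise σ d) ∧
        ∫ e, dens σ q' m n z 0 e ∂noise σ d = 1 := by
    intro m hm q' hq'
    have hmeas := measurable_dens σ hq' hm n (measurable_const (a := z)) (measurable_const (a := 0))
      (measurable_id (α := ℕ × Fin d → ℝ))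
    have hl := lintegral_dens hσ hq' hm n z 0
    have hnn : ∀ e, 0 ≤ dens σ q' m n z 0 e := fun e => (dens_pos _ _ _ _ _ _ _).le
    refine ⟨⟨hmeas.aestronglyMeasurable, ?_⟩, ?_⟩
    · rw [hasFiniteIntegral_iff_ofReal (Filter.Eventually.of_forall hnn)]
      exact lt_of_eq_of_lt hl ENNReal.one_lt_top
    · rw [integral_eq_lintegral_of_nonneg_ae (Filter.Eventually.of_forall hnn)
        hmeas.aestronglyMeasurable]
      rw [show (∫⁻ e, ENNReal.ofReal (dens σ q' m n z 0 e) ∂noise σ d) = 1 from hl]; simp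
  obtain ⟨ip, Ip⟩ := hcross (m := fun z _ => A z) hA (measurable_const (a := (0 : ℝ)))
  obtain ⟨ir, Ir⟩ := hcross (m := fun z _ => B z) hB (measurable_const (a := (0 : ℝ)))
  obtain ⟨it, It⟩ := hcross hT hq
  obtain ⟨iu, Iu⟩ := hcross hH hq
  change Integrable p _ at ip
  change ∫ e, p e ∂_ = 1 at Ip
  change Integrable r _ at ir
  change ∫ e, r e ∂_ = 1 at Ir
  change Integrable t _ at it
  change ∫ e, t e ∂_ = 1 at It
  change Integrable u _ at iu
  change ∫ e, u e ∂_ = 1 at Iu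
  have mp : Measurable p := measurable_densOf A n z
  have mr : Measurable r := measurable_densOf B n z
  have mt : Measurable t := measurable_dens σ hq hT n measurable_const measurable_const measurable_id
  have ms : Measurable s := by
    refine Finset.measurable_sum _ fun k _ => ?_
    exact Measurable.ite (measurableSet_le
      (measurable_acc hq measurable_const measurable_const measurable_id (k + 1)) measurable_const)
      (hq.comp (measurable_chain measurable_const measurable_const measurable_id k))
      measurable_const
  have mg : Measurable g := by
    have : g = fun e => acc q z 0 e n := funext hgacc
    rw [this]
    exact measurable_acc hq measurable_const measurable_const measurable_id n
  have hg0 : ∀ e, 0 ≤ g e := fun e => gap_nonneg _ _ _ _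
  have ipg : Integrable (fun e => p e * min 1 (g e)) (noise σ d) := by
    refine ip.mono' (mp.mul (measurable_const.min mg)).aestronglyMeasurable
      (Filter.Eventually.of_forall fun e => ?_)
    rw [Real.norm_eq_abs, abs_of_nonneg (mul_nonneg (hp0 e).le (le_min zero_le_one (hg0 e)))]
    exact mul_le_of_le_one_right (hp0 e).le (min_le_left _ _)
  have ist : Integrable (fun e => √(p e) * √(t e)) (noise σ d) := by
    refine (ip.add it).mono' (mp.sqrt.mul mt.sqrt).aestronglyMeasurable
      (Filter.Eventually.of_forall fun e => ?_)
    rw [Real.norm_eq_abs, abs_of_nonneg (by positivity), Pi.add_apply]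
    nlinarith [Real.sq_sqrt (hp0 e).le, Real.sq_sqrt (ht0 e).le, sq_nonneg (√(p e) - √(t e)),
      hp0 e, ht0 e]
  have ix : Integrable (fun e => (√(p e) - √(t e)) ^ 2) (noise σ d) := by
    have : (fun e => (√(p e) - √(t e)) ^ 2) = fun e => p e + t e - 2 * (√(p e) * √(t e)) := by
      funext e
      nlinarith [Real.sq_sqrt (hp0 e).le, Real.sq_sqrt (ht0 e).le]
    rw [this]
    exact (ip.add it).sub (ist.const_mul 2)
  set a := ∫ e, p e * min 1 (g e) ∂noise σ d with ha
  set X := ∫ e, (√(p e) - √(t e)) ^ 2 ∂noise σ d with hX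
  have hX1 : X = 2 - 2 * ∫ e, √(p e) * √(t e) ∂noise σ d := by
    have : ∀ e, (√(p e) - √(t e)) ^ 2 = p e + t e - 2 * (√(p e) * √(t e)) := by
      intro e
      nlinarith [Real.sq_sqrt (hp0 e).le, Real.sq_sqrt (ht0 e).le]
    rw [hX]
    simp only [this]
    have ipt : Integrable (fun e => p e + t e) (noise σ d) := ip.add it
    rw [integral_sub ipt (ist.const_mul 2), integral_add ip it, integral_const_mul, Ip, It]
    norm_num
  -- the affinity of `p` and `t` is close to one
  have hkey : ∀ e, u e - √(p e) * √(t e) ≤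
      (1 / 7) * ((3 / 2) * (p e * min 1 (g e)) + (1 / 2) * (√(p e) - √(t e)) ^ 2) := by
    intro e
    have hse := hs0 e
    have hse1 : s e ≤ 1 := (hs1 e).trans (min_le_left _ _)
    have hu : u e = √(p e) * √(t e) * Real.exp (s e / 8) := by
      rw [hsq, mul_assoc, ← Real.exp_add]
      rw [show -(s e) / 8 + s e / 8 = 0 by ring, Real.exp_zero, mul_one]
    have hexp : Real.exp (s e / 8) - 1 ≤ s e / 7 := by
      have h1 : Real.exp (s e / 8) ≤ 1 / (1 - s e / 8) := by
        rw [le_div_iff₀ (by linarith)]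
        have h2 := Real.add_one_le_exp (-(s e / 8))
        have h3 : Real.exp (s e / 8) * Real.exp (-(s e / 8)) = 1 := by
          rw [← Real.exp_add]; simp
        nlinarith [Real.exp_pos (s e / 8)]
      have h4 : 1 / (1 - s e / 8) ≤ 1 + s e / 7 := by
        rw [div_le_iff₀ (by linarith)]
        nlinarith
      linarith
    have hP := Real.sq_sqrt (hp0 e).le
    have hPT : 0 ≤ √(p e) * √(t e) := by positivity
    have h5 : u e - √(p e) * √(t e) ≤ √(p e) * √(t e) * (s e / 7) := by
      rw [hu]; nlinarith
    -- Young's inequality trades √t for √p. The price is half the Hellinger integrand, to be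
    -- absorbed below; s ≤ 1 turns s² into s.
    have h6 : √(p e) * √(t e) * s e ≤ (3 / 2) * (p e * s e) + (1 / 2) * (√(p e) - √(t e)) ^ 2 := by
      have : √(p e) * √(t e) * s e = p e * s e + √(p e) * (√(t e) - √(p e)) * s e := by
        nlinarith
      have h7 : √(p e) * (√(t e) - √(p e)) * s e ≤
          (1 / 2) * ((√(p e) - √(t e)) ^ 2 + p e * s e ^ 2) := by
        nlinarith [sq_nonneg ((√(t e) - √(p e)) - √(p e) * s e)]
      have h8 : p e * s e ^ 2 ≤ p e * s e := by
        refine mul_le_mul_of_nonneg_left ?_ (hp0 e).le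
        nlinarith
      linarith
    have h9 : p e * s e ≤ p e * min 1 (g e) := mul_le_mul_of_nonneg_left (hs1 e) (hp0 e).le
    linarith
  -- Integrating `hkey` gives X = 2 ∫ (u - √p √t) ≤ (3 a + X)/7, and the X on the right is absorbed.
  have hX2 : X ≤ a / 2 := by
    have h := integral_mono (iu.sub ist) (((ipg.const_mul (3 / 2)).add
      (ix.const_mul (1 / 2))).const_mul (1 / 7)) hkey
    simp only [Pi.sub_apply, Pi.add_apply] at h
    rw [integral_sub iu ist, integral_const_mul, integral_add (ipg.const_mul _) (ix.const_mul _),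
      integral_const_mul, integral_const_mul, Iu, ← ha, ← hX] at h
    linarith
  -- comparison of `r` with its truncation
  have hpoint : ∀ e, (√(p e) - √(r e)) ^ 2 ≤
      3 * (√(p e) - √(t e)) ^ 2 + 3 * (p e * min 1 (g e)) + (r e - t e) := by
    intro e
    have hP := Real.sq_sqrt (hp0 e).le
    have hR := Real.sq_sqrt (hr0 e).le
    have hTt := Real.sq_sqrt (ht0 e).le
    rcases le_or_gt (g e) 1 with hle | hgt
    · rw [htr e hle]
      have : 0 ≤ p e * min 1 (g e) := mul_nonneg (hp0 e).le (le_min zero_le_one (hg0 e))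
      nlinarith [sq_nonneg (√(p e) - √(r e))]
    -- Where the gap exceeds one nothing is known about `r` versus `t`. There p alone pays, as 5p -
    -- 6√p√t + 2t ≥ 0; the remainder r - t integrates to zero.
    · rw [min_eq_left hgt.le]
      nlinarith [sq_nonneg (√(p e) - √(r e)), sq_nonneg (2 * √(p e) - √(t e)),
        mul_nonneg (Real.sqrt_nonneg (p e)) (Real.sqrt_nonneg (r e))]
  have i3 : Integrable (fun e => 3 * (√(p e) - √(t e)) ^ 2 + 3 * (p e * min 1 (g e)))
    (noise σ d) := (ix.const_mul 3).add (ipg.const_mul 3)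
  have irt : Integrable (fun e => r e - t e) (noise σ d) := ir.sub it
  have i5 : Integrable (fun e => 3 * (√(p e) - √(t e)) ^ 2 + 3 * (p e * min 1 (g e)) +
    (r e - t e)) (noise σ d) := i3.add irt
  have hfin : ∫ e, (3 * (√(p e) - √(t e)) ^ 2 + 3 * (p e * min 1 (g e)) + (r e - t e)) ∂noise σ d ≤
      5 * a := by
    have ha0 : 0 ≤ a := integral_nonneg fun e =>
      mul_nonneg (hp0 e).le (le_min zero_le_one (hg0 e))
    rw [integral_add i3 irt,
      integral_add (ix.const_mul 3) (ipg.const_mul 3), integral_sub ir it, integral_const_mul,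
      integral_const_mul, Ir, It, ← ha, ← hX]
    linarith
  have hlast : ∫⁻ e, ENNReal.ofReal (min 1 (gap σ (A - B) n (chain A z e))) ∂noise σ d =
      ENNReal.ofReal a := by
    rw [lintegral_chain hσ A n z 0 (measurable_const (a := (0 : ℝ)))
      (F := fun y => ENNReal.ofReal (min 1 (gap σ (A - B) n y)))]
    · rw [ha, ofReal_integral_eq_lintegral_ofReal ipg (Filter.Eventually.of_forall fun e =>
        mul_nonneg (hp0 e).le (le_min zero_le_one (hg0 e)))]
      refine lintegral_congr fun e => ?_
      rw [mul_comm (p e), ENNReal.ofReal_mul (le_min zero_le_one (hg0 e))]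
      rfl
    · unfold gap
      refine (measurable_const.min (Finset.measurable_sum _ fun k _ => ?_)).ennreal_ofReal
      exact hq.comp (measurable_pi_apply k)
    · intro y y' h
      unfold gap
      rw [Finset.sum_congr rfl fun k hk => by rw [h k (Finset.mem_range.1 hk).le]]
  rw [hlast]
  calc hell σ A B n z ≤ ∫⁻ e, ENNReal.ofReal
        (3 * (√(p e) - √(t e)) ^ 2 + 3 * (p e * min 1 (g e)) + (r e - t e)) ∂noise σ d :=
        lintegral_mono fun e => ENNReal.ofReal_le_ofReal (hpoint e)
    _ = ENNReal.ofReal (∫ e, (3 * (√(p e) - √(t e)) ^ 2 + 3 * (p e * min 1 (g e)) + (r e - t e))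
        ∂noise σ d) := by
        rw [ofReal_integral_eq_lintegral_ofReal i5 (Filter.Eventually.of_forall fun e =>
          (sq_nonneg _).trans (hpoint e))]
    _ ≤ ENNReal.ofReal (5 * a) := ENNReal.ofReal_le_ofReal hfin
    _ = 5 * ENNReal.ofReal a := by rw [ENNReal.ofReal_mul (by norm_num)]; simp

end Hellinger

/-! ### Expected costs of chains -/

section Cost

variable {d : ℕ} {σ : ℝ}

/-- Cauchy–Schwarz for the Lebesgue integral. -/
theorem lintegral_mul_le_sqrt {α : Type*} [MeasurableSpace α] (μ : Measure α) {f g : α → ℝ≥0∞}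
    (hf : AEMeasurable f μ) (hg : AEMeasurable g μ) :
    ∫⁻ x, f x * g x ∂μ ≤ (∫⁻ x, f x ^ 2 ∂μ) ^ (1 / 2 : ℝ) * (∫⁻ x, g x ^ 2 ∂μ) ^ (1 / 2 : ℝ) := by
  have := ENNReal.lintegral_mul_le_Lp_mul_Lq μ Real.HolderConjugate.two_two hf hg
  simpa using this

/-- The expected cumulative cost of the chain with operator `A` over `m` steps. -/
def chainCost (σ : ℝ) (A : E d →L[ℝ] E d) (z : E d) (w : E d → ℝ≥0) (m : ℕ) : ℝ≥0∞ :=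
  ∫⁻ e, ∑ k ∈ Finset.range m, (w (chain A z e k) : ℝ≥0∞) ∂noise σ d

/-- The second moment of the cumulative cost of the chain with operator `A` over `m` steps. -/
def chainSq (σ : ℝ) (A : E d →L[ℝ] E d) (z : E d) (w : E d → ℝ≥0) (m : ℕ) : ℝ≥0∞ :=
  ∫⁻ e, (∑ k ∈ Finset.range m, (w (chain A z e k) : ℝ≥0∞)) ^ 2 ∂noise σ d

/-- Where p ≥ r one has p - r = (√p - √r)(√p + √r) ≤ 2 √p (√p - √r), and Cauchy–Schwarz does the
rest. Bounding by √p and not by √p + √r is what keeps the second moment under `B` out. -/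
theorem chainCost_le (hσ : 0 < σ) (A B : E d →L[ℝ] E d) (z : E d) {w : E d → ℝ≥0}
    (hw : Measurable w) (m : ℕ) :
    chainCost σ A z w m ≤ chainCost σ B z w m +
      2 * (chainSq σ A z w m ^ (1 / 2 : ℝ) * hell σ A B m z ^ (1 / 2 : ℝ)) := by
  let F : (ℕ → E d) → ℝ≥0∞ := fun y => ∑ k ∈ Finset.range m, (w (y k) : ℝ≥0∞)
  have hF : Measurable F := Finset.measurable_sum _ fun k _ =>
    (hw.comp (measurable_pi_apply k)).coe_nnreal_ennreal
  have hdep : ∀ y y' : ℕ → E d, (∀ k ≤ m, y k = y' k) → F y = F y' := fun y y' h =>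
    Finset.sum_congr rfl fun k hk => by rw [h k (Finset.mem_range.1 hk).le]
  have hC : ∀ T : E d →L[ℝ] E d, chainCost σ T z w m =
      ∫⁻ e, F (chain 0 z e) * ENNReal.ofReal (densOf σ T m z e) ∂noise σ d := fun T =>
    lintegral_chain hσ T m z 0 (measurable_const (a := (0 : ℝ))) hF hdep
  have hS : chainSq σ A z w m =
      ∫⁻ e, F (chain 0 z e) ^ 2 * ENNReal.ofReal (densOf σ A m z e) ∂noise σ d :=
    lintegral_chain hσ A m z 0 (measurable_const (a := (0 : ℝ))) (F := fun y => F y ^ 2)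
      (hF.pow_const 2) fun y y' h => by rw [hdep y y' h]
  let p := densOf σ A m z
  let r := densOf σ B m z
  have hp0 : ∀ e, 0 < p e := fun e => dens_pos _ _ _ _ _ _ _
  have hr0 : ∀ e, 0 < r e := fun e => dens_pos _ _ _ _ _ _ _
  have mp : Measurable p := measurable_densOf A m z
  have mr : Measurable r := measurable_densOf B m z
  have mF : Measurable fun e => F (chain 0 z e) :=
    hF.comp (measurable_pi_lambda _ fun k =>
      measurable_chain measurable_const measurable_const measurable_id k)
  have h1 : ∀ e, F (chain 0 z e) * ENNReal.ofReal (p e) ≤ F (chain 0 z e) * ENNReal.ofReal (r e) +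
      2 * ((F (chain 0 z e) * ENNReal.ofReal (√(p e))) * ENNReal.ofReal |√(p e) - √(r e)|) := by
    intro e
    have : p e ≤ r e + 2 * (√(p e) * |√(p e) - √(r e)|) := by
      have hP := Real.sq_sqrt (hp0 e).le
      have hR := Real.sq_sqrt (hr0 e).le
      have h3 := Real.sqrt_nonneg (p e)
      have h4 := Real.sqrt_nonneg (r e)
      rcases le_total (√(p e)) (√(r e)) with h | h
      · have : p e ≤ r e := by nlinarith
        have : 0 ≤ √(p e) * |√(p e) - √(r e)| := by positivity
        linarith
      · rw [abs_of_nonneg (by linarith)]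
        nlinarith [mul_nonneg (sub_nonneg.2 h) (sub_nonneg.2 h)]
    calc F (chain 0 z e) * ENNReal.ofReal (p e)
        ≤ F (chain 0 z e) * ENNReal.ofReal (r e + 2 * (√(p e) * |√(p e) - √(r e)|)) := by gcongr
      _ = _ := by
        rw [ENNReal.ofReal_add (hr0 e).le (by positivity), ENNReal.ofReal_mul zero_le_two,
          ENNReal.ofReal_mul (Real.sqrt_nonneg _), mul_add]
        simp only [ENNReal.ofReal_ofNat]
        ring
  rw [hC A, hC B, hS]
  calc _ ≤ ∫⁻ e, (F (chain 0 z e) * ENNReal.ofReal (r e) + 2 * ((F (chain 0 z e) *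
        ENNReal.ofReal (√(p e))) * ENNReal.ofReal |√(p e) - √(r e)|)) ∂noise σ d :=
        lintegral_mono h1
    _ = ∫⁻ e, F (chain 0 z e) * ENNReal.ofReal (r e) ∂noise σ d + 2 * ∫⁻ e, (F (chain 0 z e) *
        ENNReal.ofReal (√(p e))) * ENNReal.ofReal |√(p e) - √(r e)| ∂noise σ d := by
        have m1 : Measurable fun e => F (chain 0 z e) * ENNReal.ofReal (r e) :=
          mF.mul mr.ennreal_ofReal
        rw [lintegral_add_left m1, lintegral_const_mul]
        exact (mF.mul mp.sqrt.ennreal_ofReal).mul (mp.sqrt.sub mr.sqrt).abs.ennreal_ofReal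
    _ ≤ _ := by
        gcongr
        refine (lintegral_mul_le_sqrt _ (mF.mul mp.sqrt.ennreal_ofReal).aemeasurable
          (mp.sqrt.sub mr.sqrt).abs.ennreal_ofReal.aemeasurable).trans_eq ?_
        congr 2
        · refine lintegral_congr fun e => ?_
          simp only [Pi.mul_apply]
          rw [mul_pow, ← ENNReal.ofReal_pow (Real.sqrt_nonneg _), Real.sq_sqrt (hp0 e).le]
        · unfold hell
          refine lintegral_congr fun e => ?_
          simp only [Pi.sub_apply]
          rw [← ENNReal.ofReal_pow (abs_nonneg _), sq_abs]

/-- The integrand of `hell_le` is bounded by one and continuous in `B`, so dominated convergence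
applies. Serves to reduce infima over parameters to countable ones. -/
theorem tendsto_hell (hσ : 0 < σ) (A : E d →L[ℝ] E d) (n : ℕ) (z : E d) :
    Filter.Tendsto (fun B => hell σ A B n z) (nhds A) (nhds 0) := by
  have h1 : Filter.Tendsto (fun B => ∫⁻ e, ENNReal.ofReal
      (min 1 (gap σ (A - B) n (chain A z e))) ∂noise σ d) (nhds A) (nhds 0) := by
    have hc : ∀ e, Continuous fun B : E d →L[ℝ] E d =>
        ENNReal.ofReal (min 1 (gap σ (A - B) n (chain A z e))) := by
      intro e
      refine ENNReal.continuous_ofReal.comp (continuous_const.min ?_)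
      unfold gap
      fun_prop
    have h0 : (0 : ℝ≥0∞) = ∫⁻ e, ENNReal.ofReal
      (min 1 (gap σ (A - A) n (chain A z e))) ∂noise σ d := by simp [gap]
    rw [h0]
    refine tendsto_lintegral_filter_of_dominated_convergence (fun _ => 1)
      (Filter.Eventually.of_forall fun B => ?_) (Filter.Eventually.of_forall fun B =>
        Filter.Eventually.of_forall fun e => ?_) (by simp)
        (Filter.Eventually.of_forall fun e => (hc e).tendsto A)
    · unfold gap
      refine (measurable_const.min (Finset.measurable_sum _ fun k _ => ?_)).ennreal_ofReal
      exact (((A - B).continuous.measurable.comp (measurable_chain measurable_const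
        measurable_const measurable_id k)).norm.pow_const 2).div_const _
    · exact ENNReal.ofReal_le_one.2 (min_le_left _ _)
  have h5 := ENNReal.Tendsto.const_mul (a := 5) h1 (Or.inr (by norm_num))
  rw [mul_zero] at h5
  exact tendsto_of_tendsto_of_tendsto_of_le_of_le tendsto_const_nhds h5 (fun _ => zero_le)
    fun B => hell_le hσ A B n z

end Cost

/-! ### Trajectories of the true system -/

section Traj

variable {Par : Type uP} {𝒳 : Type uX} [MeasurableSpace Par] [MeasurableSpace 𝒳] {d : ℕ}
  {H' : Type uH} [NormedAddCommGroup H'] [InnerProductSpace ℝ H'] [CompleteSpace H']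
  {S : Model.{uΩ} Par 𝒳 d H'}

theorem measurable_feat (hG : S.GaussianFeatures) : Measurable S.feat :=
  (WithLp.measurable_toLp 2 _).comp (measurable_pi_lambda _ fun i => hG.2.1 i)

theorem measurable_F (D : RDS.{uΩ} 𝒳) (x : 𝒳) : Measurable fun ω h => D.F h ω x :=
  measurable_pi_lambda _ fun h => (D.F_meas h).comp (measurable_id.prodMk measurable_const)

instance (D : RDS.{uΩ} 𝒳) (x : 𝒳) : IsProbabilityMeasure (D.trajLaw x) :=
  Measure.isProbabilityMeasure_map (measurable_F D x).aemeasurable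

theorem measurable_featTraj (hG : S.GaussianFeatures) :
    Measurable fun (y : ℕ → 𝒳) k => S.feat (y k) :=
  measurable_pi_lambda _ fun k => (measurable_feat hG).comp (measurable_pi_apply k)

theorem measurable_chain_seq (A : E d →L[ℝ] E d) (z : E d) :
    Measurable fun e k => chain A z e k :=
  measurable_pi_lambda _ fun k =>
    measurable_chain measurable_const measurable_const measurable_id k

/-- The features of a trajectory of the true system form a chain with Gaussian noise. -/
theorem map_feat_trajLaw (hG : S.GaussianFeatures) (hK : S.IsKoopmanRealization) (Θ : Par) (x : 𝒳) :
    ((S.sys Θ).trajLaw x).map (fun y k => S.feat (y k)) =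
      (noise S.σ d).map fun e k => chain (S.𝒦 Θ) (S.feat x) e k := by
  obtain ⟨-, ε, hε, hstep, hlaw, hind⟩ := hG.2.2 Θ
  have hmeas : ∀ p : ℕ × Fin d, Measurable fun ω => ε p.2 ((S.sys Θ).shift p.1 ω) := fun p =>
    (hε p.2).comp ((S.sys Θ).shift_mp p.1).measurable
  have hmap : (S.sys Θ).P.map (fun ω p => ε p.2 ((S.sys Θ).shift p.1 ω)) = noise S.σ d := by
    rw [hind.map_fun_eq_infinitePi_map hmeas]
    unfold noise
    congr 1
    funext p
    have := ((S.sys Θ).shift_mp p.1).map_eq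
    rw [← Function.comp_def (f := ε p.2), ← Measure.map_map (hε _)
      ((S.sys Θ).shift_mp p.1).measurable, this, hlaw]
    rfl
  have hpath : ∀ ω k, S.feat ((S.sys Θ).F k ω x) =
      chain (S.𝒦 Θ) (S.feat x) (fun p => ε p.2 ((S.sys Θ).shift p.1 ω)) k := by
    intro ω k
    induction k with
    | zero => rw [(S.sys Θ).F_zero]; rfl
    | succ k ih =>
      -- The last step is split off the cocycle, so that its noise is read at the base point shifted
      -- by `k`.
      rw [add_comm k 1, (S.sys Θ).F_add, add_comm 1 k, chain, ← ih]
      ext i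
      change S.φ i _ = _
      rw [hstep, hK]
      rfl
  rw [← hmap, Measure.map_map (measurable_chain_seq _ _) (measurable_pi_lambda _ hmeas),
    RDS.trajLaw, Measure.map_map (measurable_featTraj hG) (measurable_F _ _)]
  congr 1
  funext ω k
  exact hpath ω k

instance (Θ : Par) (x₀ : ℕ → 𝒳) : IsProbabilityMeasure (S.episodeLaw Θ x₀) := by
  unfold Model.episodeLaw; infer_instance

/-- The noise of one episode. -/
def epNoise (σ : ℝ) (d : ℕ) : Measure (ℕ → ℕ × Fin d → ℝ) :=
  Measure.infinitePi fun _ => noise σ d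

instance (σ : ℝ) (d : ℕ) : IsProbabilityMeasure (epNoise σ d) := by
  unfold epNoise; infer_instance

theorem map_feat_episodeLaw (hG : S.GaussianFeatures) (hK : S.IsKoopmanRealization) (Θ : Par)
    (x₀ : ℕ → 𝒳) :
    (S.episodeLaw Θ x₀).map (fun x n k => S.feat (x n k)) =
      (epNoise S.σ d).map fun e n k => chain (S.𝒦 Θ) (S.feat (x₀ n)) (e n) k := by
  unfold Model.episodeLaw epNoise
  rw [Measure.infinitePi_map_pi _ (f := fun _ (y : ℕ → 𝒳) k => S.feat (y k))
      fun _ => measurable_featTraj hG,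
    Measure.infinitePi_map_pi _ (f := fun n e k => chain (S.𝒦 Θ) (S.feat (x₀ n)) e k)
      fun _ => measurable_chain_seq _ _]
  congr 1
  funext n
  exact map_feat_trajLaw hG hK Θ (x₀ n)

/-- Quantities that see states only through their features can be computed on the Gaussian chain. -/
theorem lintegral_trajLaw (hG : S.GaussianFeatures) (hK : S.IsKoopmanRealization) (Θ : Par) (x : 𝒳)
    {G : (ℕ → E d) → ℝ≥0∞} (hm : Measurable G) :
    ∫⁻ ω, G (fun k => S.feat ((S.sys Θ).F k ω x)) ∂(S.sys Θ).P =
      ∫⁻ e, G (chain (S.𝒦 Θ) (S.feat x) e) ∂noise S.σ d := by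
  have h := congrArg (fun μ => ∫⁻ y, G y ∂μ) (map_feat_trajLaw hG hK Θ x)
  rw [lintegral_map hm (measurable_featTraj hG), lintegral_map hm (measurable_chain_seq _ _)] at h
  exact (lintegral_map (hm.comp (measurable_featTraj hG)) (measurable_F _ _)).symm.trans h

theorem lintegral_episodeLaw (hG : S.GaussianFeatures) (hK : S.IsKoopmanRealization) (Θ : Par)
    (x₀ : ℕ → 𝒳) {G : (ℕ → ℕ → E d) → ℝ≥0∞} (hm : Measurable G) :
    ∫⁻ x, G (fun n k => S.feat (x n k)) ∂S.episodeLaw Θ x₀ =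
      ∫⁻ e, G (fun n k => chain (S.𝒦 Θ) (S.feat (x₀ n)) (e n) k) ∂epNoise S.σ d := by
  have h := congrArg (fun μ => ∫⁻ y, G y ∂μ) (map_feat_episodeLaw hG hK Θ x₀)
  refine (lintegral_map hm (measurable_pi_lambda _ fun n =>
      (measurable_featTraj hG).comp (measurable_pi_apply n))).symm.trans (h.trans ?_)
  exact lintegral_map hm (measurable_pi_lambda _ fun n =>
      (measurable_chain_seq _ _).comp (measurable_pi_apply n))

theorem lintegral_episodeLaw_eval (hG : S.GaussianFeatures) (hK : S.IsKoopmanRealization) (Θ : Par)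
    (x₀ : ℕ → 𝒳) (n : ℕ) {G : (ℕ → E d) → ℝ≥0∞} (hm : Measurable G) :
    ∫⁻ x, G (fun k => S.feat (x n k)) ∂S.episodeLaw Θ x₀ =
      ∫⁻ e, G (chain (S.𝒦 Θ) (S.feat (x₀ n)) e) ∂noise S.σ d := by
  rw [lintegral_episodeLaw hG hK Θ x₀ (G := fun y => G (y n)) (hm.comp (measurable_pi_apply n))]
  exact (measurePreserving_eval_infinitePi (fun _ : ℕ => noise S.σ d) n).lintegral_comp
    (hm.comp (measurable_chain_seq (S.𝒦 Θ) (S.feat (x₀ n))))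

/-- The expected cumulative cost of an operator on the features. -/
def costOf (S : Model.{uΩ} Par 𝒳 d H') (A : E d →L[ℝ] E d) (X : Ctx 𝒳 d) : ℝ≥0∞ :=
  ∑ n ∈ Finset.range X.N, chainCost S.σ A (S.feat (X.x₀ n)) X.w (X.hor n)

theorem modelJ_eq (Θ : Par) (X : Ctx 𝒳 d) (M : HSOp d H') :
    S.modelJ Θ X M = costOf S (S.lift Θ M) X := rfl

theorem J_eq (hG : S.GaussianFeatures) (hK : S.IsKoopmanRealization) (Θ : Par) {X : Ctx 𝒳 d}
    (hX : S.Realizable X) (hw : Measurable X.w) : S.J Θ X = costOf S (S.𝒦 Θ) X := by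
  unfold Model.J costOf
  refine Finset.sum_congr rfl fun n _ => ?_
  have := lintegral_trajLaw hG hK Θ (X.x₀ n)
    (G := fun y => ∑ h ∈ Finset.range (X.hor n), (X.w (y h) : ℝ≥0∞))
    (Finset.measurable_sum _ fun k _ => (hw.comp (measurable_pi_apply k)).coe_nnreal_ennreal)
  simp only [← hX _] at this
  exact this

theorem sum_chainSq_le (hG : S.GaussianFeatures) (hK : S.IsKoopmanRealization) (Θ : Par)
    {X : Ctx 𝒳 d} (hX : S.Realizable X) (hw : Measurable X.w) {Vmax : ℝ}
    (hV : S.MomentBound X Vmax) :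
    ∑ n ∈ Finset.range X.N, chainSq S.σ (S.𝒦 Θ) (S.feat (X.x₀ n)) X.w (X.hor n) ≤
      ENNReal.ofReal Vmax := by
  refine le_trans (le_of_eq (Finset.sum_congr rfl fun n _ => ?_)) (hV Θ)
  have := lintegral_trajLaw hG hK Θ (X.x₀ n)
    (G := fun y => (∑ h ∈ Finset.range (X.hor n), (X.w (y h) : ℝ≥0∞)) ^ 2)
    ((Finset.measurable_sum _ fun k _ =>
      (hw.comp (measurable_pi_apply k)).coe_nnreal_ennreal).pow_const 2)
  simp only [← hX _] at this
  exact this.symm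

/-- The total squared Hellinger distance between the laws of an episode. -/
def epHell (S : Model.{uΩ} Par 𝒳 d H') (A B : E d →L[ℝ] E d) (X : Ctx 𝒳 d) : ℝ≥0∞ :=
  ∑ n ∈ Finset.range X.N, hell S.σ A B (X.hor n) (S.feat (X.x₀ n))

theorem sum_sqrt_mul_sqrt_le {ι : Type*} (s : Finset ι) (f g : ι → ℝ≥0∞) :
    ∑ i ∈ s, f i ^ (1 / 2 : ℝ) * g i ^ (1 / 2 : ℝ) ≤
      (∑ i ∈ s, f i) ^ (1 / 2 : ℝ) * (∑ i ∈ s, g i) ^ (1 / 2 : ℝ) := by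
  have := ENNReal.inner_le_Lp_mul_Lq s (fun i => f i ^ (1 / 2 : ℝ)) (fun i => g i ^ (1 / 2 : ℝ))
    Real.HolderConjugate.two_two
  have h2 : ∀ x : ℝ≥0∞, (x ^ (1 / 2 : ℝ)) ^ (2 : ℝ) = x := fun x => by
    rw [← ENNReal.rpow_mul]; norm_num
  simpa only [h2] using this

/-- A second Cauchy–Schwarz, over the initial states, combines the bounds for the single
trajectories. Only costs under `A` need second moments. -/
theorem costOf_le (hσ : 0 < S.σ) (A B : E d →L[ℝ] E d) {X : Ctx 𝒳 d} (hw : Measurable X.w)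
    {V : ℝ≥0∞}
    (hV : ∑ n ∈ Finset.range X.N, chainSq S.σ A (S.feat (X.x₀ n)) X.w (X.hor n) ≤ V) :
    costOf S A X ≤ costOf S B X + 2 * (V ^ (1 / 2 : ℝ) * epHell S A B X ^ (1 / 2 : ℝ)) := by
  unfold costOf
  calc _ ≤ ∑ n ∈ Finset.range X.N, (chainCost S.σ B (S.feat (X.x₀ n)) X.w (X.hor n) +
        2 * (chainSq S.σ A (S.feat (X.x₀ n)) X.w (X.hor n) ^ (1 / 2 : ℝ) *
          hell S.σ A B (X.hor n) (S.feat (X.x₀ n)) ^ (1 / 2 : ℝ))) :=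
        Finset.sum_le_sum fun n _ => chainCost_le hσ A B _ hw _
    _ ≤ _ := by
      rw [Finset.sum_add_distrib, ← Finset.mul_sum]
      gcongr
      refine (sum_sqrt_mul_sqrt_le _ _ _).trans ?_
      unfold epHell
      gcongr

/-- The cumulative costs are bounded. -/
theorem costOf_le_sqrt {A : E d →L[ℝ] E d} {X : Ctx 𝒳 d} (hw : Measurable X.w) {V : ℝ≥0∞}
    (hV : ∑ n ∈ Finset.range X.N, chainSq S.σ A (S.feat (X.x₀ n)) X.w (X.hor n) ≤ V) :
    costOf S A X ≤ V ^ (1 / 2 : ℝ) * (X.N : ℝ≥0∞) ^ (1 / 2 : ℝ) := by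
  unfold costOf
  have h1 : ∀ n, chainCost S.σ A (S.feat (X.x₀ n)) X.w (X.hor n) ≤
      chainSq S.σ A (S.feat (X.x₀ n)) X.w (X.hor n) ^ (1 / 2 : ℝ) * (1 : ℝ≥0∞) ^ (1 / 2 : ℝ) := by
    intro n
    have := lintegral_mul_le_sqrt (noise S.σ d)
      (f := fun e => ∑ k ∈ Finset.range (X.hor n), (X.w (chain A (S.feat (X.x₀ n)) e k) : ℝ≥0∞))
      (g := fun _ => 1) (Finset.measurable_sum _ fun k _ => (hw.comp (measurable_chain
        measurable_const measurable_const measurable_id k)).coe_nnreal_ennreal).aemeasurable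
      aemeasurable_const
    simpa [chainCost, chainSq] using this
  refine (Finset.sum_le_sum fun n _ => h1 n).trans ((sum_sqrt_mul_sqrt_le _ _ _).trans ?_)
  gcongr
  simp

/-- The gap is evaluated on trajectories that are actually observed, which is why it can be charged
to information; `B` is arbitrary. -/
theorem epHell_le (hσ : 0 < S.σ) (hG : S.GaussianFeatures) (hK : S.IsKoopmanRealization) (Θ : Par)
    (B : E d →L[ℝ] E d) (X : Ctx 𝒳 d) :
    epHell S (S.𝒦 Θ) B X ≤ 5 * ∫⁻ x, ENNReal.ofReal (∑ n ∈ Finset.range X.N,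
      min 1 (gap S.σ (S.𝒦 Θ - B) (X.hor n) fun k => S.feat (x n k))) ∂S.episodeLaw Θ X.x₀ := by
  have hm : ∀ n, Measurable fun y : ℕ → E d =>
      ENNReal.ofReal (min 1 (gap S.σ (S.𝒦 Θ - B) (X.hor n) y)) := by
    intro n
    unfold gap
    refine (measurable_const.min (Finset.measurable_sum _ fun k _ => ?_)).ennreal_ofReal
    exact (((S.𝒦 Θ - B).continuous.measurable.comp
      (measurable_pi_apply k)).norm.pow_const 2).div_const _
  have h1 : ∀ x : ℕ → ℕ → 𝒳, ENNReal.ofReal (∑ n ∈ Finset.range X.N,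
      min 1 (gap S.σ (S.𝒦 Θ - B) (X.hor n) fun k => S.feat (x n k))) =
      ∑ n ∈ Finset.range X.N, ENNReal.ofReal
        (min 1 (gap S.σ (S.𝒦 Θ - B) (X.hor n) fun k => S.feat (x n k))) := fun x =>
    ENNReal.ofReal_sum_of_nonneg fun n _ => le_min zero_le_one (gap_nonneg _ _ _ _)
  simp only [h1]
  rw [lintegral_finsetSum, Finset.mul_sum]
  · refine Finset.sum_le_sum fun n _ => ?_
    rw [lintegral_episodeLaw_eval hG hK Θ X.x₀ n (hm n)]
    exact hell_le hσ _ _ _ _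
  · intro n _
    exact (hm n).comp ((measurable_featTraj hG).comp (measurable_pi_apply n))

theorem epHell_triangle (A B C : E d →L[ℝ] E d) (X : Ctx 𝒳 d) :
    epHell S A B X ≤ 2 * epHell S A C X + 2 * epHell S B C X := by
  unfold epHell
  rw [Finset.mul_sum, Finset.mul_sum, ← Finset.sum_add_distrib]
  exact Finset.sum_le_sum fun n _ => hell_triangle _ _ _ _ _

theorem epHell_comm (A B : E d →L[ℝ] E d) (X : Ctx 𝒳 d) : epHell S A B X = epHell S B A X :=
  Finset.sum_congr rfl fun _ _ => hell_comm _ _ _ _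

theorem tendsto_epHell (hσ : 0 < S.σ) (A : E d →L[ℝ] E d) (X : Ctx 𝒳 d) :
    Filter.Tendsto (fun B => epHell S A B X) (nhds A) (nhds 0) := by
  have := tendsto_finsetSum (Finset.range X.N) fun n _ =>
    tendsto_hell hσ A (X.hor n) (S.feat (X.x₀ n))
  simpa [epHell] using this

end Traj

/-! ### Ridge regression and self-normalized sums -/

section Ridge

variable {V : Type*} [NormedAddCommGroup V] [InnerProductSpace ℝ V] [CompleteSpace V]
variable {ι κ : Type*} [Fintype ι] [Fintype κ]

/-- The ridge loss at `M` exceeds the one at the solution `M₀` of the normal equations by a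
quadratic form. -/
theorem ridge_eq {lam : ℝ} (a : ι → V) (y : ι → ℝ) {M₀ : V}
    (h₀ : infoOp lam a M₀ = ∑ i, y i • a i) (M : V) :
    ∑ i, (y i - inner ℝ (a i) M) ^ 2 + lam * ‖M‖ ^ 2 =
      ∑ i, (y i - inner ℝ (a i) M₀) ^ 2 + lam * ‖M₀‖ ^ 2 +
        inner ℝ (M - M₀) (infoOp lam a (M - M₀)) := by
  have e1 : ∀ N : V, inner ℝ N (infoOp lam a N) = lam * ‖N‖ ^ 2 + ∑ i, inner ℝ (a i) N ^ 2 :=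
    inner_infoOp_self lam a
  have e2 : ∀ N : V, inner ℝ N (infoOp lam a M₀) = ∑ i, y i * inner ℝ (a i) N := by
    intro N
    rw [h₀, inner_sum]
    refine Finset.sum_congr rfl fun i _ => ?_
    rw [real_inner_smul_right, real_inner_comm]
  have e3 : ∀ N : V, ∑ i, (y i - inner ℝ (a i) N) ^ 2 + lam * ‖N‖ ^ 2 =
      ∑ i, y i ^ 2 - 2 * inner ℝ N (infoOp lam a M₀) + inner ℝ N (infoOp lam a N) := by
    intro N
    rw [e1, e2]
    have : ∀ i, (y i - inner ℝ (a i) N) ^ 2 =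
        y i ^ 2 - 2 * (y i * inner ℝ (a i) N) + inner ℝ (a i) N ^ 2 := fun i => by ring
    simp only [this, Finset.sum_add_distrib, Finset.sum_sub_distrib, ← Finset.mul_sum]
    ring
  rw [e3 M, e3 M₀, map_sub, inner_sub_left, inner_sub_right, inner_sub_right,
    ← infoOp_symm lam a M₀ M, real_inner_comm M]
  ring

/-- With y = T⁻¹x this follows from λ‖y‖² ≤ ⟨x, y⟩ ≤ ‖x‖ ‖y‖. -/
theorem inner_infoInv_self_le {lam : ℝ} (hl : 0 < lam) (a : ι → V) (x : V) :
    inner ℝ x (infoInv lam a x) ≤ lam⁻¹ * ‖x‖ ^ 2 := by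
  set y := infoInv lam a x
  have hy : infoOp lam a y = x := infoOp_infoInv hl a x
  have h1 : lam * ‖y‖ ^ 2 ≤ inner ℝ x y := by
    have := inner_infoOp_self lam a y
    rw [hy, real_inner_comm] at this
    rw [this]
    have : 0 ≤ ∑ i, inner ℝ (a i) y ^ 2 := by positivity
    linarith
  have h2 := real_inner_le_norm x y
  have h3 : inner ℝ x y * lam ≤ ‖x‖ ^ 2 := by
    nlinarith [sq_nonneg (‖x‖ - lam * ‖y‖), norm_nonneg x, norm_nonneg y]
  rw [inv_mul_eq_div, le_div_iff₀ hl]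
  exact h3

/-- The error of ridge regression, when `y i = ⟪a i, Mstar⟫ + ε i`. -/
theorem ridge_error_le {lam : ℝ} (hl : 0 < lam) (a : ι → V) (y : ι → ℝ) {M₀ : V}
    (h₀ : infoOp lam a M₀ = ∑ i, y i • a i) (Mstar : V) :
    inner ℝ (Mstar - M₀) (infoOp lam a (Mstar - M₀)) ≤
      2 * inner ℝ (∑ i, (y i - inner ℝ (a i) Mstar) • a i)
        (infoInv lam a (∑ i, (y i - inner ℝ (a i) Mstar) • a i)) + 2 * (lam * ‖Mstar‖ ^ 2) := by
  set ξ := ∑ i, (y i - inner ℝ (a i) Mstar) • a i with hξ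
  -- The error has a bias part from the regularization and a noise part ξ.
  have h1 : infoOp lam a (Mstar - M₀) = lam • Mstar - ξ := by
    rw [map_sub, h₀, infoOp_apply, hξ]
    simp only [sub_smul, Finset.sum_sub_distrib]
    abel
  have h2 : Mstar - M₀ = infoInv lam a (lam • Mstar - ξ) := by
    rw [← h1, infoInv_infoOp hl]
  -- Nonnegativity at the sum gives ‖u - v‖² ≤ 2‖u‖² + 2‖v‖² in the metric of the inverse.
  have hp := inner_infoInv_self_nonneg hl a (lam • Mstar + ξ)
  have hle := inner_infoInv_self_le hl a (lam • Mstar)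
  rw [h1, h2, real_inner_comm]
  simp only [map_sub, map_add, inner_sub_left, inner_sub_right, inner_add_left,
    inner_add_right] at hp ⊢
  have h3 : lam⁻¹ * ‖lam • Mstar‖ ^ 2 = lam * ‖Mstar‖ ^ 2 := by
    rw [norm_smul, Real.norm_eq_abs, abs_of_pos hl]; field_simp
  linarith

theorem inner_infoOp_sub_le {lam : ℝ} (hl : 0 < lam) (a : ι → V) (x y z : V) :
    inner ℝ (x - y) (infoOp lam a (x - y)) ≤
      2 * inner ℝ (x - z) (infoOp lam a (x - z)) + 2 * inner ℝ (y - z) (infoOp lam a (y - z)) := by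
  have h := inner_infoOp_self_nonneg hl a ((x - z) + (y - z))
  have e : x - y = (x - z) - (y - z) := by abel
  rw [e]
  simp only [map_sub, map_add, inner_sub_left, inner_sub_right, inner_add_left,
    inner_add_right] at h ⊢
  linarith

/-- Information operators, up to the choice of the vectors. -/
def IsInfo (lam : ℝ) (T : V →L[ℝ] V) : Prop := ∃ (m : ℕ) (a : Fin m → V), T = infoOp lam a

theorem isInfo_infoOp (lam : ℝ) (a : ι → V) : IsInfo lam (infoOp lam a) := by
  refine ⟨Fintype.card ι, a ∘ (Fintype.equivFin ι).symm, ?_⟩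
  unfold infoOp
  congr 1
  exact ((Fintype.equivFin ι).symm.sum_comp fun i => InnerProductSpace.rankOne ℝ (a i) (a i)).symm

theorem IsInfo.add_sum {lam : ℝ} {T : V →L[ℝ] V} (hT : IsInfo lam T) (b : κ → V) :
    IsInfo lam (T + ∑ j, InnerProductSpace.rankOne ℝ (b j) (b j)) := by
  obtain ⟨m, a, rfl⟩ := hT
  rw [← infoOp_sumElim]
  exact isInfo_infoOp _ _

/-- The self-normalized exponential. -/
def selfNorm (lam σ : ℝ) (T : V →L[ℝ] V) (ξ : V) : ℝ≥0∞ :=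
  ENNReal.ofReal (Real.exp (inner ℝ ξ (Ring.inverse T ξ) / (2 * σ ^ 2)) /
    √(fredholmDet (lam⁻¹ • T)))

/-- Completing the square: the integrand times the density of 𝒩(0, σ²) is √(1 + b) times the density
of 𝒩(c, σ²(1 + b)). -/
theorem lintegral_gaussian_quadratic {σ b c : ℝ} (hσ : 0 < σ) (hb : 0 ≤ b) :
    ∫⁻ x, ENNReal.ofReal (Real.exp ((x ^ 2 * b + 2 * x * c - c ^ 2) / (2 * σ ^ 2 * (1 + b))))
      ∂gaussianReal 0 (nvar σ) = ENNReal.ofReal √(1 + b) := by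
  have hv := nvar_ne_zero hσ
  let v' : ℝ≥0 := nvar (σ * √(1 + b))
  have hv' : v' ≠ 0 := nvar_ne_zero (mul_pos hσ (Real.sqrt_pos.2 (by linarith)))
  have hv'' : (v' : ℝ) = σ ^ 2 * (1 + b) := by
    rw [coe_nvar, mul_pow, Real.sq_sqrt (by linarith)]
  rw [gaussianReal_of_var_ne_zero _ hv,
    lintegral_withDensity_eq_lintegral_mul _ (measurable_gaussianPDF _ _) (by fun_prop)]
  have h1 : ∀ x, (gaussianPDF 0 (nvar σ) * fun x => ENNReal.ofReal (Real.exp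
      ((x ^ 2 * b + 2 * x * c - c ^ 2) / (2 * σ ^ 2 * (1 + b))))) x =
      ENNReal.ofReal √(1 + b) * gaussianPDF c v' x := by
    intro x
    simp only [Pi.mul_apply, gaussianPDF, gaussianPDFReal, coe_nvar, hv'']
    rw [← ENNReal.ofReal_mul (by positivity), ← ENNReal.ofReal_mul (by positivity), mul_assoc,
      ← Real.exp_add]
    congr 1
    have hs : √(2 * Real.pi * (σ ^ 2 * (1 + b))) = √(2 * Real.pi * σ ^ 2) * √(1 + b) := by
      rw [← Real.sqrt_mul (by positivity)]; congr 1; ring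
    rw [hs, ← mul_assoc]
    have h1b : 0 < 1 + b := by linarith
    congr 1
    · field_simp
    · congr 1
      field_simp
      ring
  simp only [h1]
  rw [lintegral_const_mul _ (measurable_gaussianPDF _ _), lintegral_gaussianPDF_eq_one c hv',
    mul_one]

/-- The one-step martingale identity. Sherman–Morrison gives the new exponent as a quadratic
polynomial in the noise, whose Gaussian integral is √(1 + β); the determinant grows by exactly 1 +
β, so the two cancel. -/
theorem selfNorm_add_rankOne {lam σ : ℝ} (hl : 0 < lam) (hσ : 0 < σ) {T : V →L[ℝ] V}
    (hT : IsInfo lam T) (ξ b : V) :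
    ∫⁻ x, selfNorm lam σ (T + InnerProductSpace.rankOne ℝ b b) (ξ + x • b)
      ∂gaussianReal 0 (nvar σ) = selfNorm lam σ T ξ := by
  obtain ⟨m, a, rfl⟩ := hT
  have hT' : infoOp lam a + InnerProductSpace.rankOne ℝ b b =
      infoOp lam (Sum.elim a fun _ : Unit => b) := by
    rw [infoOp_sumElim]; simp
  set β := inner ℝ b (infoInv lam a b) with hβ
  set c := inner ℝ b (infoInv lam a ξ) with hc
  have hβ0 : 0 ≤ β := inner_infoInv_self_nonneg hl a b
  have hdet : fredholmDet (lam⁻¹ • infoOp lam (Sum.elim a fun _ : Unit => b)) =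
      fredholmDet (lam⁻¹ • infoOp lam a) * (1 + β) := by
    rw [fredholmDet_infoOp_sumElim hl]
    simp [Matrix.det_unique, hβ]
  have hpos := zero_lt_one.trans_le (one_le_fredholmDet_infoOp hl a)
  -- the inverse of the updated operator
  have hinv : ∀ x, infoInv lam (Sum.elim a fun _ : Unit => b) x =
      infoInv lam a x - (inner ℝ b (infoInv lam a x) / (1 + β)) • infoInv lam a b := by
    intro x
    have : infoOp lam (Sum.elim a fun _ : Unit => b)
        (infoInv lam a x - (inner ℝ b (infoInv lam a x) / (1 + β)) • infoInv lam a b) = x := by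
      rw [← hT', add_apply, map_sub, map_smul, infoOp_infoInv hl,
        infoOp_infoInv hl, InnerProductSpace.rankOne_apply, inner_sub_right, inner_smul_right,
        ← hβ]
      have : inner ℝ b (infoInv lam a x) - inner ℝ b (infoInv lam a x) / (1 + β) * β =
          inner ℝ b (infoInv lam a x) / (1 + β) := by
        field_simp; ring
      rw [this]; abel
    conv_lhs => rw [← this]
    rw [infoInv_infoOp hl]
  have hcc : inner ℝ ξ (infoInv lam a b) = c := by
    rw [← infoInv_symm hl, real_inner_comm]
  have hq : ∀ x : ℝ, inner ℝ (ξ + x • b) (infoInv lam (Sum.elim a fun _ : Unit => b) (ξ + x • b)) =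
      inner ℝ ξ (infoInv lam a ξ) + (x ^ 2 * β + 2 * x * c - c ^ 2) / (1 + β) := by
    intro x
    rw [hinv]
    simp only [map_add, map_smul, inner_add_left, inner_add_right, inner_sub_right,
      real_inner_smul_left, real_inner_smul_right, hcc, ← hβ, ← hc]
    field_simp
    ring
  have h1 : ∀ x : ℝ, selfNorm lam σ (infoOp lam a + InnerProductSpace.rankOne ℝ b b) (ξ + x • b) =
      selfNorm lam σ (infoOp lam a) ξ * (ENNReal.ofReal (√(1 + β))⁻¹ * ENNReal.ofReal (Real.exp
        ((x ^ 2 * β + 2 * x * c - c ^ 2) / (2 * σ ^ 2 * (1 + β))))) := by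
    intro x
    have hq' := hq x
    unfold infoInv at hq'
    unfold selfNorm
    rw [hT', hdet, hq', ← ENNReal.ofReal_mul (by positivity), ← ENNReal.ofReal_mul (by positivity),
      Real.sqrt_mul hpos.le, add_div, Real.exp_add]
    congr 1
    have : (x ^ 2 * β + 2 * x * c - c ^ 2) / (1 + β) / (2 * σ ^ 2) =
        (x ^ 2 * β + 2 * x * c - c ^ 2) / (2 * σ ^ 2 * (1 + β)) := by
      rw [div_div]; congr 1; ring
    rw [this]
    field_simp
  simp only [h1]
  rw [lintegral_const_mul _ (by fun_prop), lintegral_const_mul _ (by fun_prop),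
    lintegral_gaussian_quadratic hσ hβ0, ← ENNReal.ofReal_mul (by positivity), inv_mul_cancel₀,
    ENNReal.ofReal_one, mul_one]
  exact (Real.sqrt_pos.2 (by linarith)).ne'

/-- The coordinates of one noise vector are fed in one at a time; the inequality comes only from
Fubini without measurability. -/
theorem lintegral_selfNorm_pi_le {lam σ : ℝ} (hl : 0 < lam) (hσ : 0 < σ) (m : ℕ) :
    ∀ (b : Fin m → V) {T : V →L[ℝ] V} (_ : IsInfo lam T) (ξ : V),
    ∫⁻ x, selfNorm lam σ (T + ∑ i, InnerProductSpace.rankOne ℝ (b i) (b i)) (ξ + ∑ i, x i • b i)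
      ∂gauss σ m ≤ selfNorm lam σ T ξ := by
  induction m with
  | zero => intro b T _ ξ; simp
  | succ m ih =>
    intro b T hT ξ
    refine (lintegral_pi_fin_succ_le _ _).trans ?_
    rw [← selfNorm_add_rankOne hl hσ hT ξ (b 0)]
    refine lintegral_mono fun x => ?_
    have hT1 : IsInfo lam (T + InnerProductSpace.rankOne ℝ (b 0) (b 0)) := by
      simpa using hT.add_sum fun _ : Unit => b 0
    refine le_trans (le_of_eq ?_) (ih (fun i => b i.succ) hT1 (ξ + x • b 0))
    refine lintegral_congr fun y => ?_
    congr 1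
    · rw [Fin.sum_univ_succ, add_assoc]
    · rw [Fin.sum_univ_succ, add_assoc]
      simp

end Ridge

/-! ### The self-normalized exponential along chains and episodes -/

section SelfNorm

variable {d : ℕ} {V : Type*} [NormedAddCommGroup V] [InnerProductSpace ℝ V] [CompleteSpace V]

/-- Along a chain, the self-normalized exponential does not increase in mean. -/
theorem lintegral_selfNorm_chain_le {lam σ : ℝ} (hl : 0 < lam) (hσ : 0 < σ)
    (A : E d →L[ℝ] E d) (row : E d → Fin d → V) (m : ℕ) :
    ∀ (z : E d) {T : V →L[ℝ] V} (_ : IsInfo lam T) (ξ : V),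
    ∫⁻ e, selfNorm lam σ
      (T + ∑ k ∈ Finset.range m, ∑ i,
        InnerProductSpace.rankOne ℝ (row (chain A z e k) i) (row (chain A z e k) i))
      (ξ + ∑ k ∈ Finset.range m, ∑ i, e (k, i) • row (chain A z e k) i) ∂noise σ d ≤
      selfNorm lam σ T ξ := by
  induction m with
  | zero => intro z T _ ξ; simp
  | succ m ih =>
    intro z T hT ξ
    refine (lintegral_noise_le _).trans ?_
    refine le_trans ?_ (lintegral_selfNorm_pi_le hl hσ d (row z) hT ξ)
    refine lintegral_mono fun x => ?_
    refine le_trans (le_of_eq ?_) (ih (A z + WithLp.toLp 2 x) (hT.add_sum (row z))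
      (ξ + ∑ i, x i • row z i))
    refine lintegral_congr fun e => ?_
    congr 1
    · rw [Finset.sum_range_succ', add_assoc, add_comm (∑ i, _)]
      simp only [chain_consN]
      rfl
    · rw [Finset.sum_range_succ', add_assoc, add_comm (∑ i, x i • _)]
      simp only [chain_consN, consN_zero, consN_succ]
      rfl

/-- Trajectories of an episode are independent, so the first one is integrated last. The starting
states and horizons are quantified inside the induction because they get shifted. -/
theorem lintegral_selfNorm_episode_le {lam σ : ℝ} (hl : 0 < lam) (hσ : 0 < σ)
    (A : E d →L[ℝ] E d) (row : E d → Fin d → V) (N : ℕ) :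
    ∀ (z : ℕ → E d) (m : ℕ → ℕ) {T : V →L[ℝ] V} (_ : IsInfo lam T) (ξ : V),
    ∫⁻ e, selfNorm lam σ
      (T + ∑ n ∈ Finset.range N, ∑ k ∈ Finset.range (m n), ∑ i,
        InnerProductSpace.rankOne ℝ (row (chain A (z n) (e n) k) i) (row (chain A (z n) (e n) k) i))
      (ξ + ∑ n ∈ Finset.range N, ∑ k ∈ Finset.range (m n), ∑ i,
        e n (k, i) • row (chain A (z n) (e n) k) i) ∂epNoise σ d ≤
      selfNorm lam σ T ξ := by
  induction N with
  | zero => intro z m T _ ξ; simp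
  | succ N ih =>
    intro z m T hT ξ
    refine (lintegral_infinitePi_nat_le _ _).trans ?_
    refine le_trans ?_ (lintegral_selfNorm_chain_le hl hσ A row (m 0) (z 0) hT ξ)
    refine lintegral_mono fun x => ?_
    have hT' : IsInfo lam (T + ∑ k ∈ Finset.range (m 0), ∑ i,
        InnerProductSpace.rankOne ℝ (row (chain A (z 0) x k) i) (row (chain A (z 0) x k) i)) := by
      have := hT.add_sum (κ := Fin (m 0) × Fin d) fun p => row (chain A (z 0) x p.1) p.2
      rw [Fintype.sum_prod_type] at this
      rwa [Finset.sum_range]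
    refine le_trans (le_of_eq ?_) (ih (fun n => z (n + 1)) (fun n => m (n + 1)) hT'
      (ξ + ∑ k ∈ Finset.range (m 0), ∑ i, x (k, i) • row (chain A (z 0) x k) i))
    refine lintegral_congr fun e => ?_
    congr 1
    · rw [Finset.sum_range_succ', add_assoc, add_comm (∑ k ∈ Finset.range (m 0), _)]
      rfl
    · rw [Finset.sum_range_succ', add_assoc, add_comm (∑ k ∈ Finset.range (m 0), _)]
      rfl

end SelfNorm

/-! ### The information operators of a history -/

/-- Turns the matrix-valued observations into scalar ones, so that everything proved for `infoOp`
applies to Σ_𝒜 and Σ_ℬ. -/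
theorem adjoint_comp_self_eq_sum {V F ι : Type*} [NormedAddCommGroup V] [InnerProductSpace ℝ V]
    [CompleteSpace V] [NormedAddCommGroup F] [InnerProductSpace ℝ F] [CompleteSpace F] [Fintype ι]
    (T : V →L[ℝ] F) (b : OrthonormalBasis ι ℝ F) :
    ContinuousLinearMap.adjoint T ∘L T = ∑ i, InnerProductSpace.rankOne ℝ
      (ContinuousLinearMap.adjoint T (b i)) (ContinuousLinearMap.adjoint T (b i)) := by
  ext1 x
  simp only [sum_apply, InnerProductSpace.rankOne_apply, ContinuousLinearMap.adjoint_inner_left,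
    ContinuousLinearMap.comp_apply]
  conv_lhs => rw [← b.sum_repr' (T x)]
  simp

theorem sum_inner_adjoint_sq {V F ι : Type*} [NormedAddCommGroup V] [InnerProductSpace ℝ V]
    [CompleteSpace V] [NormedAddCommGroup F] [InnerProductSpace ℝ F] [CompleteSpace F] [Fintype ι]
    (T : V →L[ℝ] F) (b : OrthonormalBasis ι ℝ F) (x : V) :
    ∑ i, inner ℝ (ContinuousLinearMap.adjoint T (b i)) x ^ 2 = ‖T x‖ ^ 2 := by
  simp only [ContinuousLinearMap.adjoint_inner_left]
  rw [← b.sum_sq_norm_inner_right (T x)]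
  simp

/-- A double sum over a triangular range, as a sum over a product of finite types. -/
theorem sum_pad {M ι : Type*} [AddCommMonoid M] [Fintype ι] {N Q : ℕ} {hor : ℕ → ℕ} (hN : N ≤ Q)
    (hh : ∀ n < N, hor n ≤ Q) (f : ℕ → ℕ → ι → M) :
    ∑ p : Fin Q × Fin Q × ι, (if (p.1 : ℕ) < N ∧ (p.2.1 : ℕ) < hor p.1 then f p.1 p.2.1 p.2.2
      else 0) = ∑ n ∈ Finset.range N, ∑ k ∈ Finset.range (hor n), ∑ i, f n k i := by
  rw [Fintype.sum_prod_type]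
  simp only [Fintype.sum_prod_type]
  have h1 : ∀ n, ∑ k : Fin Q, ∑ i, (if n < N ∧ (k : ℕ) < hor n then f n k i else 0) =
      if n < N then ∑ k ∈ Finset.range (hor n), ∑ i, f n k i else 0 := by
    intro n
    by_cases hn : n < N
    · simp only [hn, true_and, if_true]
      rw [← Finset.sum_range (f := fun k => ∑ i, if k < hor n then f n k i else 0),
        ← Finset.sum_range_add_sum_Ico _ (hh n hn)]
      rw [Finset.sum_eq_zero (s := Finset.Ico _ _), add_zero]
      · refine Finset.sum_congr rfl fun k hk => ?_
        simp [Finset.mem_range.1 hk]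
      · intro k hk
        simp [not_lt.2 (Finset.mem_Ico.1 hk).1]
    · simp [hn]
  simp only [h1]
  rw [← Finset.sum_range (f := fun n => if n < N then ∑ k ∈ Finset.range (hor n), ∑ i, f n k i
    else 0), ← Finset.sum_range_add_sum_Ico _ hN]
  rw [Finset.sum_eq_zero (s := Finset.Ico _ _), add_zero]
  · refine Finset.sum_congr rfl fun k hk => ?_
    simp [Finset.mem_range.1 hk]
  · intro k hk
    simp [not_lt.2 (Finset.mem_Ico.1 hk).1]

section Before

variable {Par 𝒳 : Type*} {t : ℕ}

/-- The history `h` followed by one more episode. -/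
def Hist.extend (h : Hist Par 𝒳 t) (e : Ep Par 𝒳) : Hist Par 𝒳 (t + 1) :=
  Fin.snoc (α := fun _ => Ep Par 𝒳) h e

@[simp] theorem Hist.extend_castSucc (h : Hist Par 𝒳 t) (e : Ep Par 𝒳) (τ : Fin t) :
    h.extend e τ.castSucc = h τ := by simp [Hist.extend]

@[simp] theorem Hist.extend_last (h : Hist Par 𝒳 t) (e : Ep Par 𝒳) :
    h.extend e (Fin.last t) = e := by simp [Hist.extend]

@[simp] theorem Hist.before_extend_castSucc (h : Hist Par 𝒳 t) (e : Ep Par 𝒳) (τ : Fin t) :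
    (h.extend e).before τ.castSucc = h.before τ := by
  funext i
  exact h.extend_castSucc e ⟨i, i.2.trans τ.2⟩

@[simp] theorem Hist.before_extend_last (h : Hist Par 𝒳 t) (e : Ep Par 𝒳) :
    (h.extend e).before (Fin.last t) = h := by
  funext i
  exact h.extend_castSucc e i

end Before

/-- The episode has at most `Q` initial states, with horizons at most `Q`. -/
def Ctx.Fits {𝒳 : Type*} {d : ℕ} (X : Ctx 𝒳 d) (Q : ℕ) : Prop :=
  X.N ≤ Q ∧ ∀ n < X.N, X.hor n ≤ Q

/-! ### Histories as families of scalar observations with a fixed index type -/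

section Vec

variable {Par : Type uP} {𝒳 : Type uX} [MeasurableSpace Par] [MeasurableSpace 𝒳] {d : ℕ}
  {H' : Type uH} [NormedAddCommGroup H'] [InnerProductSpace ℝ H'] [CompleteSpace H']
  {S : Model.{uΩ} Par 𝒳 d H'}

/-- Horizons are at least one, so their sum bounds the number of initial states as well as each
horizon. The bound `H` then serves as padding size. -/
theorem Model.Excites.fits {X : Ctx 𝒳 d} {C : ℝ} {H : ℕ} (h : S.Excites X C H) : X.Fits H := by
  obtain ⟨-, h1, -, h2⟩ := h
  refine ⟨?_, fun n hn => ?_⟩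
  · have := Finset.card_nsmul_le_sum (Finset.range X.N) X.hor 1 fun n hn =>
      h1 n (Finset.mem_range.1 hn)
    simp only [Finset.card_range, smul_eq_mul, mul_one] at this
    exact this.trans h2
  · exact (Finset.single_le_sum (f := X.hor) (fun _ _ => Nat.zero_le _)
      (Finset.mem_range.2 hn)).trans h2

variable (S)

/-- The vectors that represent the coordinates of `M ↦ Ψ(Θ)† M z`. -/
def rowA (Θ : Par) (z : E d) (i : Fin d) : HSOp d H' :=
  ContinuousLinearMap.adjoint (evalOp (ContinuousLinearMap.adjoint (S.Ψ Θ)) z)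
    (EuclideanSpace.basisFun (Fin d) ℝ i)

/-- The vectors that represent the coordinates of `M ↦ Ψ(Θ)† ∘ M`. -/
def rowB (Θ : Par) (i : Fin (Module.finrank ℝ (HSOp d (E d)))) : HSOp d H' :=
  ContinuousLinearMap.adjoint (S.opB Θ) (stdOrthonormalBasis ℝ (HSOp d (E d)) i)

variable {S}

theorem inner_rowA (Θ : Par) (z : E d) (i : Fin d) (M : HSOp d H') :
    inner ℝ (rowA S Θ z i) M = S.lift Θ M z i := by
  rw [rowA, ContinuousLinearMap.adjoint_inner_left, evalOp_apply]
  rw [EuclideanSpace.basisFun_apply, EuclideanSpace.inner_single_left]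
  simp [Model.lift]

theorem sum_inner_rowA_sq (Θ : Par) (z : E d) (M : HSOp d H') :
    ∑ i, inner ℝ (rowA S Θ z i) M ^ 2 = ‖S.lift Θ M z‖ ^ 2 := by
  simp only [rowA]
  rw [sum_inner_adjoint_sq, evalOp_apply]
  rfl

theorem adjoint_opA_comp (Θ : Par) (x : 𝒳) :
    ContinuousLinearMap.adjoint (S.opA Θ x) ∘L S.opA Θ x =
      ∑ i, InnerProductSpace.rankOne ℝ (rowA S Θ (S.feat x) i) (rowA S Θ (S.feat x) i) :=
  adjoint_comp_self_eq_sum _ _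

theorem adjoint_opB_comp (Θ : Par) :
    ContinuousLinearMap.adjoint (S.opB Θ) ∘L S.opB Θ =
      ∑ i, InnerProductSpace.rankOne ℝ (rowB S Θ i) (rowB S Θ i) :=
  adjoint_comp_self_eq_sum _ _

theorem lift_sub (Θ : Par) (M M' : HSOp d H') : S.lift Θ (M - M') = S.lift Θ M - S.lift Θ M' := by
  ext1 z
  simp [Model.lift]

/-- The squared Hilbert–Schmidt norm, through the rows. -/
theorem norm_opB_sq (Θ : Par) (M : HSOp d H') :
    ‖S.opB Θ M‖ ^ 2 = ∑ i, ‖ContinuousLinearMap.adjoint (S.lift Θ M)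
      (EuclideanSpace.basisFun (Fin d) ℝ i)‖ ^ 2 := by
  have h1 : ‖S.opB Θ M‖ ^ 2 = ∑ j, ‖S.lift Θ M (EuclideanSpace.basisFun (Fin d) ℝ j)‖ ^ 2 := by
    rw [PiLp.norm_sq_eq_of_L2]
    refine Finset.sum_congr rfl fun j _ => ?_
    have : (S.opB Θ M) j = HSOp.op (S.opB Θ M) (EuclideanSpace.basisFun (Fin d) ℝ j) := by
      simp [HSOp.op_apply]
    rw [this, Model.opB, op_compOp]
    rfl
  rw [h1]
  have h2 : ∀ x : E d, ‖x‖ ^ 2 = ∑ i, inner ℝ (EuclideanSpace.basisFun (Fin d) ℝ i) x ^ 2 := by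
    intro x
    rw [← (EuclideanSpace.basisFun (Fin d) ℝ).sum_sq_norm_inner_right x]
    simp
  simp only [h2 (S.lift Θ M _), h2 (ContinuousLinearMap.adjoint (S.lift Θ M) _)]
  rw [Finset.sum_comm]
  refine Finset.sum_congr rfl fun i _ => Finset.sum_congr rfl fun j _ => ?_
  rw [ContinuousLinearMap.adjoint_inner_right, real_inner_comm]

/-- The operator norm is at most the Hilbert–Schmidt norm. -/
theorem norm_lift_sq_le (Θ : Par) (M : HSOp d H') : ‖S.lift Θ M‖ ^ 2 ≤ ‖S.opB Θ M‖ ^ 2 := by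
  have h : ‖S.lift Θ M‖ ≤ ‖S.opB Θ M‖ := by
    refine ContinuousLinearMap.opNorm_le_bound _ (norm_nonneg _) fun z => ?_
    refine le_of_sq_le_sq ?_ (by positivity)
    rw [mul_pow, norm_opB_sq, ← (EuclideanSpace.basisFun (Fin d) ℝ).sum_sq_norm_inner_right
      (S.lift Θ M z), Finset.sum_mul]
    refine Finset.sum_le_sum fun i _ => ?_
    rw [← ContinuousLinearMap.adjoint_inner_left, ← mul_pow]
    gcongr
    exact norm_inner_le_norm _ _
  gcongr

variable (S) in
/-- The vectors of one episode, indexed by a fixed finite type. -/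
def epVec (X : Ctx 𝒳 d) (Q : ℕ) (Θ : Par) (x : ℕ → ℕ → 𝒳) (p : Fin Q × Fin Q × Fin d) :
    HSOp d H' :=
  if (p.1 : ℕ) < X.N ∧ (p.2.1 : ℕ) < X.hor p.1 then rowA S Θ (S.feat (x p.1 p.2.1)) p.2.2 else 0

variable (S) in
/-- The observations of one episode. -/
def epObs (X : Ctx 𝒳 d) (Q : ℕ) (x : ℕ → ℕ → 𝒳) (p : Fin Q × Fin Q × Fin d) : ℝ :=
  if (p.1 : ℕ) < X.N ∧ (p.2.1 : ℕ) < X.hor p.1 then S.feat (x p.1 (p.2.1 + 1)) p.2.2 else 0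

variable (S) in
/-- The vectors of a history. -/
def histVec (adv : Adversary Par 𝒳 d) (Q : ℕ) {t : ℕ} (h : Hist Par 𝒳 t)
    (p : Fin t × Fin Q × Fin Q × Fin d) : HSOp d H' :=
  epVec S (adv p.1 (h.before p.1)) Q (h p.1).1 (h p.1).2 p.2

variable (S) in
/-- The observations of a history. -/
def histObs (adv : Adversary Par 𝒳 d) (Q : ℕ) {t : ℕ} (h : Hist Par 𝒳 t)
    (p : Fin t × Fin Q × Fin Q × Fin d) : ℝ :=
  epObs S (adv p.1 (h.before p.1)) Q (h p.1).2 p.2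

variable (S) in
/-- The noise-weighted sum of the vectors of one episode. -/
def epNoiseVec (Mstar : HSOp d H') (X : Ctx 𝒳 d) (Q : ℕ) (Θ : Par) (x : ℕ → ℕ → 𝒳) : HSOp d H' :=
  ∑ p, (epObs S X Q x p - inner ℝ (epVec S X Q Θ x p) Mstar) • epVec S X Q Θ x p

variable (S) in
/-- The noise-weighted sum of the vectors of a history. -/
def noiseVec (Mstar : HSOp d H') (adv : Adversary Par 𝒳 d) (Q : ℕ) {t : ℕ} (h : Hist Par 𝒳 t) :
    HSOp d H' :=
  ∑ p, (histObs S adv Q h p - inner ℝ (histVec S adv Q h p) Mstar) • histVec S adv Q h p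

variable (S) in
/-- The vectors of a history that make up the second information operator. -/
def histVecB {t : ℕ} (h : Hist Par 𝒳 t) (p : Fin t × Fin (Module.finrank ℝ (HSOp d (E d)))) :
    HSOp d H' :=
  rowB S (h p.1).1 p.2

/-- The number of observations depends on the history. Padding with zero vectors fixes the index
type without changing sums of terms that vanish at zero. -/
theorem sum_epVec {M : Type*} [AddCommMonoid M] {X : Ctx 𝒳 d} {Q : ℕ} (hX : X.Fits Q) (Θ : Par)
    (x : ℕ → ℕ → 𝒳) (f : HSOp d H' → M) (hf : f 0 = 0) :
    ∑ p, f (epVec S X Q Θ x p) = ∑ n ∈ Finset.range X.N, ∑ k ∈ Finset.range (X.hor n), ∑ i,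
      f (rowA S Θ (S.feat (x n k)) i) := by
  rw [← sum_pad hX.1 hX.2]
  refine Finset.sum_congr rfl fun p _ => ?_
  rw [epVec, apply_ite f, hf]

theorem epNoiseVec_eq (Mstar : HSOp d H') {X : Ctx 𝒳 d} {Q : ℕ} (hX : X.Fits Q) (Θ : Par)
    (x : ℕ → ℕ → 𝒳) :
    epNoiseVec S Mstar X Q Θ x = ∑ n ∈ Finset.range X.N, ∑ k ∈ Finset.range (X.hor n), ∑ i,
      (S.feat (x n (k + 1)) - S.lift Θ Mstar (S.feat (x n k))) i •
        rowA S Θ (S.feat (x n k)) i := by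
  rw [← sum_pad hX.1 hX.2]
  refine Finset.sum_congr rfl fun p _ => ?_
  unfold epVec epObs
  split_ifs with h
  · rw [inner_rowA]; rfl
  · simp

variable {adv : Adversary Par 𝒳 d} {Q : ℕ}

theorem sigmaA_eq (lam : ℝ) (hQ : ∀ t h, (adv t h).Fits Q) {t : ℕ} (h : Hist Par 𝒳 t) :
    S.sigmaA lam adv h = infoOp lam (histVec S adv Q h) := by
  unfold Model.sigmaA infoOp
  congr 1
  rw [Fintype.sum_prod_type]
  refine Finset.sum_congr rfl fun τ _ => ?_
  simp only [adjoint_opA_comp]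
  exact (sum_epVec (hQ _ _) _ _ (fun v => InnerProductSpace.rankOne ℝ v v) (by simp)).symm

theorem sigmaB_eq (lam : ℝ) {t : ℕ} (h : Hist Par 𝒳 t) :
    S.sigmaB lam h = infoOp lam (histVecB S h) := by
  unfold Model.sigmaB infoOp
  congr 1
  rw [Fintype.sum_prod_type]
  refine Finset.sum_congr rfl fun τ _ => ?_
  simp only [adjoint_opB_comp]
  rfl

theorem sigmaA_extend (lam : ℝ) (hQ : ∀ t h, (adv t h).Fits Q) {t : ℕ} (h : Hist Par 𝒳 t)
    (e : Ep Par 𝒳) :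
    S.sigmaA lam adv (h.extend e) =
      infoOp lam (Sum.elim (histVec S adv Q h) (epVec S (adv t h) Q e.1 e.2)) := by
  rw [sigmaA_eq lam hQ, infoOp_sumElim]
  unfold infoOp
  rw [add_assoc]
  congr 1
  rw [Fintype.sum_prod_type, Fintype.sum_prod_type, Fin.sum_univ_castSucc]
  congr 1
  · refine Finset.sum_congr rfl fun τ _ => Finset.sum_congr rfl fun p _ => ?_
    simp only [histVec, Hist.before_extend_castSucc, Hist.extend_castSucc, Fin.val_castSucc]
  · refine Finset.sum_congr rfl fun p _ => ?_
    simp only [histVec, Hist.before_extend_last, Hist.extend_last, Fin.val_last]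

theorem sigmaB_extend (lam : ℝ) {t : ℕ} (h : Hist Par 𝒳 t) (e : Ep Par 𝒳) :
    S.sigmaB lam (h.extend e) = infoOp lam (Sum.elim (histVecB S h) (rowB S e.1)) := by
  rw [sigmaB_eq lam, infoOp_sumElim]
  unfold infoOp
  rw [add_assoc]
  congr 1
  rw [Fintype.sum_prod_type, Fintype.sum_prod_type, Fin.sum_univ_castSucc]
  simp [histVecB]

theorem noiseVec_extend (Mstar : HSOp d H') {t : ℕ} (h : Hist Par 𝒳 t) (e : Ep Par 𝒳) :
    noiseVec S Mstar adv Q (h.extend e) =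
      noiseVec S Mstar adv Q h + epNoiseVec S Mstar (adv t h) Q e.1 e.2 := by
  unfold noiseVec
  rw [Fintype.sum_prod_type, Fintype.sum_prod_type, Fin.sum_univ_castSucc]
  congr 1
  · refine Finset.sum_congr rfl fun τ _ => Finset.sum_congr rfl fun p _ => ?_
    simp only [histVec, histObs, Hist.before_extend_castSucc, Hist.extend_castSucc,
      Fin.val_castSucc]
  · refine Finset.sum_congr rfl fun p _ => ?_
    simp only [histVec, histObs, Hist.before_extend_last, Hist.extend_last, Fin.val_last]

theorem ridgeLoss_eq (lam : ℝ) (hQ : ∀ t h, (adv t h).Fits Q) {t : ℕ} (h : Hist Par 𝒳 t)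
    (M : HSOp d H') :
    S.ridgeLoss lam adv h M =
      ∑ p, (histObs S adv Q h p - inner ℝ (histVec S adv Q h p) M) ^ 2 + lam * ‖M‖ ^ 2 := by
  unfold Model.ridgeLoss
  congr 1
  rw [Fintype.sum_prod_type]
  refine Finset.sum_congr rfl fun τ _ => ?_
  have h1 : ∀ n k, ‖S.feat ((h τ).2 n (k + 1)) - S.opA (h τ).1 ((h τ).2 n k) M‖ ^ 2 =
      ∑ i, (S.feat ((h τ).2 n (k + 1)) i -
        inner ℝ (rowA S (h τ).1 (S.feat ((h τ).2 n k)) i) M) ^ 2 := by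
    intro n k
    rw [EuclideanSpace.norm_sq_eq]
    refine Finset.sum_congr rfl fun i _ => ?_
    rw [inner_rowA, Model.opA, evalOp_apply, Real.norm_eq_abs, sq_abs]
    rfl
  simp only [h1]
  rw [← sum_pad (hQ τ (h.before τ)).1 (hQ τ (h.before τ)).2]
  refine Finset.sum_congr rfl fun p _ => ?_
  unfold histVec histObs epVec epObs
  split_ifs with h
  · rfl
  · simp

end Vec

/-! ### Measurability of determinants and quadratic forms -/

section Meas

variable {Ω ι V : Type*} [MeasurableSpace Ω] [Fintype ι] [NormedAddCommGroup V]
  [InnerProductSpace ℝ V] [CompleteSpace V]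

/-- The determinant is a polynomial in the inner products of the vectors. -/
theorem measurable_fredholmDet_infoOp {lam : ℝ} (hl : 0 < lam) {a : Ω → ι → V}
    (ha : ∀ i, StronglyMeasurable fun ω => a ω i) :
    Measurable fun ω => fredholmDet (lam⁻¹ • infoOp lam (a ω)) := by
  classical
  simp only [fredholmDet_infoOp hl, Matrix.det_apply]
  refine Finset.measurable_sum _ fun s _ => Measurable.const_smul
    (Finset.measurable_prod _ fun i _ => ?_) _
  simp only [Matrix.add_apply, Matrix.smul_apply, Matrix.gram_apply, smul_eq_mul]
  exact measurable_const.add (((ha (s i)).inner (ha i)).measurable.const_mul _)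

/-- The quadratic form of the inverse is a ratio of determinants, so its measurability follows
without studying the operator inverse. -/
theorem inner_infoInv_self_eq {lam : ℝ} (hl : 0 < lam) (a : ι → V) (ξ : V) :
    inner ℝ ξ (infoInv lam a ξ) =
      fredholmDet (lam⁻¹ • infoOp lam (Sum.elim a fun _ : Unit => ξ)) /
        fredholmDet (lam⁻¹ • infoOp lam a) - 1 := by
  have hpos := zero_lt_one.trans_le (one_le_fredholmDet_infoOp hl a)
  rw [fredholmDet_infoOp_sumElim hl, mul_div_cancel_left₀ _ hpos.ne']
  simp [Matrix.det_unique]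

theorem measurable_inner_infoInv {lam : ℝ} (hl : 0 < lam) {a : Ω → ι → V}
    (ha : ∀ i, StronglyMeasurable fun ω => a ω i) {ξ : Ω → V} (hξ : StronglyMeasurable ξ) :
    Measurable fun ω => inner ℝ (ξ ω) (infoInv lam (a ω) (ξ ω)) := by
  simp only [inner_infoInv_self_eq hl]
  refine ((measurable_fredholmDet_infoOp hl ?_).div
    (measurable_fredholmDet_infoOp hl ha)).sub_const 1
  rintro (i | i)
  · exact ha i
  · exact hξ

theorem measurable_selfNorm {lam : ℝ} (hl : 0 < lam) (σ : ℝ) {a : Ω → ι → V}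
    (ha : ∀ i, StronglyMeasurable fun ω => a ω i) {ξ : Ω → V} (hξ : StronglyMeasurable ξ) :
    Measurable fun ω => selfNorm lam σ (infoOp lam (a ω)) (ξ ω) :=
  (((measurable_inner_infoInv hl ha hξ).div_const _).exp.div
    (measurable_fredholmDet_infoOp hl ha).sqrt).ennreal_ofReal

end Meas

/-- If u ≤ 1 the untruncated bound Y u is used, and otherwise the number of terms. This exchanges
truncation per trajectory for truncation of the whole episode, the form the log-determinant
controls. -/
theorem sum_min_one_le {N H : ℕ} (hN : N ≤ H) {g : ℕ → ℝ} {Y u : ℝ} (hY : 0 ≤ Y) (hu : 0 ≤ u)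
    (hsum : ∑ n ∈ Finset.range N, g n ≤ Y * u) :
    ∑ n ∈ Finset.range N, min 1 (g n) ≤ (Y + H) * min 1 u := by
  rcases le_total u 1 with h | h
  · rw [min_eq_right h]
    refine (Finset.sum_le_sum fun n _ => min_le_right _ _).trans (hsum.trans ?_)
    gcongr
    simp
  · rw [min_eq_left h, mul_one]
    refine (Finset.sum_le_sum fun n _ => min_le_left _ _).trans ?_
    have : (N : ℝ) ≤ H := by exact_mod_cast hN
    simp only [Finset.sum_const, Finset.card_range, nsmul_eq_mul, mul_one]
    linarith

/-! ### Bounds at a fixed history -/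

section Pointwise

variable {Par : Type uP} {𝒳 : Type uX} [MeasurableSpace Par] [MeasurableSpace 𝒳] {d : ℕ}
  {H' : Type uH} [NormedAddCommGroup H'] [InnerProductSpace ℝ H'] [CompleteSpace H']
  {S : Model.{uΩ} Par 𝒳 d H'} {adv : Adversary Par 𝒳 d} {Q : ℕ} {lam : ℝ} {t : ℕ}

/-! ### Information gain of one episode -/

variable (S) in
/-- The information that the next episode adds, to first order. -/
def stepA (lam : ℝ) (adv : Adversary Par 𝒳 d) (Q : ℕ) {t : ℕ} (h : Hist Par 𝒳 t) (Θ : Par)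
    (x : ℕ → ℕ → 𝒳) : ℝ :=
  ∑ p, inner ℝ (epVec S (adv t h) Q Θ x p)
    (infoInv lam (histVec S adv Q h) (epVec S (adv t h) Q Θ x p))

variable (S) in
/-- The information on the spectrum that playing `Θ` adds, to first order. -/
def stepB (lam : ℝ) {t : ℕ} (h : Hist Par 𝒳 t) (Θ : Par) : ℝ :=
  ∑ i, inner ℝ (rowB S Θ i) (infoInv lam (histVecB S h) (rowB S Θ i))

theorem stepA_nonneg (hl : 0 < lam) (h : Hist Par 𝒳 t) (Θ : Par) (x : ℕ → ℕ → 𝒳) :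
    0 ≤ stepA S lam adv Q h Θ x :=
  Finset.sum_nonneg fun _ _ => inner_infoInv_self_nonneg hl _ _

theorem stepB_nonneg (hl : 0 < lam) (h : Hist Par 𝒳 t) (Θ : Par) : 0 ≤ stepB S lam h Θ :=
  Finset.sum_nonneg fun _ _ => inner_infoInv_self_nonneg hl _ _

theorem one_le_detRatioA (hl : 0 < lam) (hQ : ∀ t h, (adv t h).Fits Q) (h : Hist Par 𝒳 t) :
    1 ≤ S.detRatioA lam adv h := by
  rw [Model.detRatioA, sigmaA_eq lam hQ]
  exact one_le_fredholmDet_infoOp hl _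

theorem one_le_detRatioB (hl : 0 < lam) (h : Hist Par 𝒳 t) : 1 ≤ S.detRatioB lam h := by
  rw [Model.detRatioB, sigmaB_eq lam]
  exact one_le_fredholmDet_infoOp hl _

theorem min_one_stepA_le (hl : 0 < lam) (hQ : ∀ t h, (adv t h).Fits Q) (h : Hist Par 𝒳 t)
    (e : Ep Par 𝒳) :
    min 1 (stepA S lam adv Q h e.1 e.2) ≤
      2 * (Real.log (S.detRatioA lam adv (h.extend e)) - Real.log (S.detRatioA lam adv h)) := by
  rw [Model.detRatioA, Model.detRatioA, sigmaA_extend lam hQ, sigmaA_eq lam hQ]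
  exact min_one_le_log_det_sub hl _ _

theorem min_one_stepB_le (hl : 0 < lam) (h : Hist Par 𝒳 t) (e : Ep Par 𝒳) :
    min 1 (stepB S lam h e.1) ≤
      2 * (Real.log (S.detRatioB lam (h.extend e)) - Real.log (S.detRatioB lam h)) := by
  rw [Model.detRatioB, Model.detRatioB, sigmaB_extend lam, sigmaB_eq lam]
  exact min_one_le_log_det_sub hl _ _

theorem log_detRatioA_le_extend (hl : 0 < lam) (hQ : ∀ t h, (adv t h).Fits Q) (h : Hist Par 𝒳 t)
    (e : Ep Par 𝒳) :
    Real.log (S.detRatioA lam adv h) ≤ Real.log (S.detRatioA lam adv (h.extend e)) := by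
  have h1 := min_one_stepA_le (S := S) hl hQ h e
  have h2 : 0 ≤ min 1 (stepA S lam adv Q h e.1 e.2) := le_min zero_le_one (stepA_nonneg hl _ _ _)
  linarith

/-- The information gain controls the size of the vectors of the last episode. -/
theorem min_one_sum_norm_epVec_le (hl : 0 < lam) (hQ : ∀ t h, (adv t h).Fits Q) (h : Hist Par 𝒳 t)
    (e : Ep Par 𝒳) :
    min 1 (lam⁻¹ * ∑ p, ‖epVec S (adv t h) Q e.1 e.2 p‖ ^ 2) ≤
      2 * Real.log (S.detRatioA lam adv (h.extend e)) := by
  set c := Sum.elim (histVec S adv Q h) (epVec S (adv t h) Q e.1 e.2) with hc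
  -- The whole history is regarded as an addition to the empty family, whose operator is λ I with
  -- inverse λ⁻¹ I.
  have h0 := min_one_le_log_det_sub hl (fun i : Fin 0 => i.elim0 : Fin 0 → HSOp d H') c
  have e0 : infoOp lam (fun i : Fin 0 => i.elim0 : Fin 0 → HSOp d H') = lam • 1 := by
    simp [infoOp]
  have e1 : infoOp lam (Sum.elim (fun i : Fin 0 => i.elim0 : Fin 0 → HSOp d H') c) =
      infoOp lam c := by
    rw [infoOp_sumElim, e0]; rfl
  have e2 : ∀ v : HSOp d H', infoInv lam (fun i : Fin 0 => i.elim0 : Fin 0 → HSOp d H') v =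
      lam⁻¹ • v := by
    intro v
    have h1 := infoOp_infoInv hl (fun i : Fin 0 => i.elim0 : Fin 0 → HSOp d H') v
    rw [e0] at h1
    have h2 : lam • (infoInv lam (fun i : Fin 0 => i.elim0 : Fin 0 → HSOp d H') v) = v := h1
    conv_rhs => rw [← h2]
    rw [inv_smul_smul₀ hl.ne']
  have e3 := Real.log_nonneg (one_le_fredholmDet_infoOp hl
    (fun i : Fin 0 => i.elim0 : Fin 0 → HSOp d H'))
  rw [Model.detRatioA, sigmaA_extend lam hQ, ← hc]
  rw [e1] at h0
  refine le_trans (min_le_min_left _ ?_) (h0.trans (by linarith))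
  simp only [e2, real_inner_smul_right, real_inner_self_eq_norm_sq, ← Finset.mul_sum]
  gcongr
  rw [Fintype.sum_sum_type, hc]
  simp only [Sum.elim_inr, Sum.elim_inl]
  have : 0 ≤ ∑ p, ‖histVec S adv Q h p‖ ^ 2 := by positivity
  linarith

theorem sum_gap_eq {X : Ctx 𝒳 d} (hX : X.Fits Q) (Θ : Par) (x : ℕ → ℕ → 𝒳) (σ : ℝ)
    (M : HSOp d H') :
    ∑ n ∈ Finset.range X.N, gap σ (S.lift Θ M) (X.hor n) (fun k => S.feat (x n k)) =
      (∑ p, inner ℝ (epVec S X Q Θ x p) M ^ 2) / σ ^ 2 := by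
  rw [sum_epVec hX Θ x (fun v => inner ℝ v M ^ 2) (by simp)]
  simp only [sum_inner_rowA_sq, gap, Finset.sum_div]

/-- The expected deviation of the model `M` is controlled by the information gain. -/
theorem sum_min_gap_le (hl : 0 < lam) (hQ : ∀ t h, (adv t h).Fits Q) (hσ : 0 < S.σ)
    (h : Hist Par 𝒳 t) (e : Ep Par 𝒳) (M : HSOp d H') {y : ℝ}
    (hy : inner ℝ M (S.sigmaA lam adv h M) ≤ y) :
    ∑ n ∈ Finset.range (adv t h).N, min 1 (gap S.σ (S.lift e.1 M) ((adv t h).hor n)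
        (fun k => S.feat (e.2 n k))) ≤
      (y / S.σ ^ 2 + Q) * (2 * (Real.log (S.detRatioA lam adv (h.extend e)) -
        Real.log (S.detRatioA lam adv h))) := by
  have hy0 : 0 ≤ y := by
    refine le_trans ?_ hy
    rw [sigmaA_eq lam hQ]
    exact inner_infoOp_self_nonneg hl _ _
  refine (sum_min_one_le (hQ t h).1 (Y := y / S.σ ^ 2) (u := stepA S lam adv Q h e.1 e.2)
    (by positivity) (stepA_nonneg hl _ _ _) ?_).trans ?_
  · rw [sum_gap_eq (hQ t h), div_mul_eq_mul_div]
    gcongr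
    rw [stepA, Finset.mul_sum]
    refine Finset.sum_le_sum fun p _ => ?_
    -- Cauchy–Schwarz in the metric of Σ_𝒜 separates the error of `M` from the information of each
    -- new vector.
    refine (inner_sq_le_infoInv hl (histVec S adv Q h) _ M).trans ?_
    rw [mul_comm y, ← sigmaA_eq lam hQ]
    exact mul_le_mul_of_nonneg_left hy (inner_infoInv_self_nonneg hl _ _)
  · exact mul_le_mul_of_nonneg_left (min_one_stepA_le hl hQ h e) (by positivity)

/-- Each of the `d` columns has norm at most the operator norm. Hence the regularization bias
contributes the `d` in the radius. -/
theorem lam_mul_norm_sq_le {σ : ℝ} {Mstar : HSOp d H'} (hM : Mstar ≠ 0)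
    (hlam : lam = σ ^ 2 / ‖HSOp.op Mstar‖ ^ 2) : lam * ‖Mstar‖ ^ 2 ≤ σ ^ 2 * d := by
  have h0 : 0 < ‖HSOp.op Mstar‖ := by
    rw [norm_pos_iff]
    exact fun h => hM (HSOp.op.map_eq_zero_iff.1 h)
  have h1 : ‖Mstar‖ ^ 2 ≤ d * ‖HSOp.op Mstar‖ ^ 2 := by
    rw [PiLp.norm_sq_eq_of_L2]
    refine (Finset.sum_le_card_nsmul _ _ (‖HSOp.op Mstar‖ ^ 2) fun j _ => ?_).trans_eq (by simp)
    have h2 : Mstar j = HSOp.op Mstar (EuclideanSpace.basisFun (Fin d) ℝ j) := by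
      simp [HSOp.op_apply]
    have h3 := (HSOp.op Mstar).le_opNorm (EuclideanSpace.basisFun (Fin d) ℝ j)
    rw [(EuclideanSpace.basisFun (Fin d) ℝ).norm_eq_one, mul_one] at h3
    rw [h2]
    gcongr
  rw [hlam, div_mul_eq_mul_div, div_le_iff₀ (by positivity)]
  nlinarith [sq_nonneg σ]

theorem lam_pos {σ : ℝ} (hσ : 0 < σ) {Mstar : HSOp d H'} (hM : Mstar ≠ 0)
    (hlam : lam = σ ^ 2 / ‖HSOp.op Mstar‖ ^ 2) : 0 < lam := by
  have h0 : 0 < ‖HSOp.op Mstar‖ := by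
    rw [norm_pos_iff]
    exact fun h => hM (HSOp.op.map_eq_zero_iff.1 h)
  rw [hlam]
  positivity

/-- The deviation from the zero operator, used when the confidence set fails. -/
theorem sum_min_gap_zero_le (hl : 0 < lam) (hQ : ∀ t h, (adv t h).Fits Q) (hσ : 0 < S.σ)
    {Mstar : HSOp d H'} (hM : lam * ‖Mstar‖ ^ 2 ≤ S.σ ^ 2 * d) (h : Hist Par 𝒳 t)
    (e : Ep Par 𝒳) :
    ∑ n ∈ Finset.range (adv t h).N, min 1 (gap S.σ (S.lift e.1 Mstar) ((adv t h).hor n)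
        (fun k => S.feat (e.2 n k))) ≤
      (d + Q) * (2 * Real.log (S.detRatioA lam adv (h.extend e))) := by
  refine (sum_min_one_le (hQ t h).1 (Y := d)
    (u := lam⁻¹ * ∑ p, ‖epVec S (adv t h) Q e.1 e.2 p‖ ^ 2) (by positivity) (by positivity)
    ?_).trans ?_
  · rw [sum_gap_eq (hQ t h), div_le_iff₀ (by positivity), Finset.mul_sum, Finset.mul_sum,
      Finset.sum_mul]
    refine Finset.sum_le_sum fun p _ => ?_
    set v := epVec S (adv t h) Q e.1 e.2 p
    have h1 : inner ℝ v Mstar ^ 2 ≤ ‖v‖ ^ 2 * ‖Mstar‖ ^ 2 := by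
      rw [← mul_pow, ← sq_abs]
      gcongr
      exact abs_real_inner_le_norm _ _
    refine h1.trans ?_
    have h2 : ‖Mstar‖ ^ 2 ≤ lam⁻¹ * (S.σ ^ 2 * d) := by
      rw [inv_mul_eq_div, le_div_iff₀ hl]; linarith
    calc ‖v‖ ^ 2 * ‖Mstar‖ ^ 2 ≤ ‖v‖ ^ 2 * (lam⁻¹ * (S.σ ^ 2 * d)) := by gcongr
      _ = _ := by ring
  · exact mul_le_mul_of_nonneg_left (min_one_sum_norm_epVec_le hl hQ h e) (by positivity)

/-! ### Confidence sets -/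

/-- The loss is a constant plus the strictly positive form of Σ_𝒜 around the solution of the normal
equations, so that solution is the only minimizer. -/
theorem exists_ridge_solution (hl : 0 < lam) (hQ : ∀ t h, (adv t h).Fits Q) (h : Hist Par 𝒳 t) :
    ∃ M₀ : HSOp d H', infoOp lam (histVec S adv Q h) M₀ =
        ∑ p, histObs S adv Q h p • histVec S adv Q h p ∧
      ∀ Mbar, IsMinOn (S.ridgeLoss lam adv h) Set.univ Mbar ↔ Mbar = M₀ := by
  refine ⟨infoInv lam (histVec S adv Q h) (∑ p, histObs S adv Q h p • histVec S adv Q h p),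
    infoOp_infoInv hl _ _, fun Mbar => ?_⟩
  set M₀ := infoInv lam (histVec S adv Q h) (∑ p, histObs S adv Q h p • histVec S adv Q h p)
  have h0 : ∀ M, S.ridgeLoss lam adv h M = S.ridgeLoss lam adv h M₀ +
      inner ℝ (M - M₀) (infoOp lam (histVec S adv Q h) (M - M₀)) := by
    intro M
    rw [ridgeLoss_eq lam hQ, ridgeLoss_eq lam hQ]
    exact ridge_eq _ _ (infoOp_infoInv hl _ _) M
  constructor
  · intro hmin
    have h1 : S.ridgeLoss lam adv h Mbar ≤ S.ridgeLoss lam adv h M₀ := hmin (Set.mem_univ M₀)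
    rw [h0, inner_infoOp_self] at h1
    have h2 : 0 ≤ ∑ i, inner ℝ (histVec S adv Q h i) (Mbar - M₀) ^ 2 := by positivity
    have h3 : ‖Mbar - M₀‖ ^ 2 ≤ 0 := by
      by_contra hc
      have := mul_pos hl (not_le.1 hc)
      linarith
    have h4 : ‖Mbar - M₀‖ = 0 := by
      have := le_antisymm h3 (sq_nonneg _)
      exact pow_eq_zero_iff (two_ne_zero) |>.1 this
    exact sub_eq_zero.1 (norm_eq_zero.1 h4)
  · rintro rfl M _
    change S.ridgeLoss lam adv h M₀ ≤ S.ridgeLoss lam adv h M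
    rw [h0 M]
    linarith [inner_infoOp_self_nonneg hl (histVec S adv Q h) (M - M₀)]

variable (S) in
/-- The self-normalized exponential of a history. -/
def histSelfNorm (lam : ℝ) (Mstar : HSOp d H') (adv : Adversary Par 𝒳 d) (Q : ℕ) {t : ℕ}
    (h : Hist Par 𝒳 t) : ℝ≥0∞ :=
  selfNorm lam S.σ (S.sigmaA lam adv h) (noiseVec S Mstar adv Q h)

theorem beta_eq (hl : 0 < lam) (hQ : ∀ t h, (adv t h).Fits Q) (ht : t ≠ 0) (h : Hist Par 𝒳 t) :
    S.beta lam adv h = 20 * S.σ ^ 2 * (d + Real.log t + Real.log (S.detRatioA lam adv h)) := by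
  have h1 := zero_lt_one.trans_le (one_le_detRatioA (S := S) hl hQ h)
  rw [Model.beta, Real.log_mul (by exact_mod_cast ht) h1.ne', add_assoc]

/-- On the event that the self-normalized exponential is at most `t`, the confidence set contains
`Mstar`, and all its elements are close to it. -/
theorem mem_ball_of_histSelfNorm_le (hl : 0 < lam) (hQ : ∀ t h, (adv t h).Fits Q) (hσ : 0 < S.σ)
    {Mstar : HSOp d H'} (hM : lam * ‖Mstar‖ ^ 2 ≤ S.σ ^ 2 * d) (hB : Mstar ∈ S.Ball₀)
    (ht : t ≠ 0) (h : Hist Par 𝒳 t) (hW : histSelfNorm S lam Mstar adv Q h ≤ t) :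
    Mstar ∈ S.ball lam adv h ∧ ∀ M ∈ S.ball lam adv h,
      inner ℝ (M - Mstar) (S.sigmaA lam adv h (M - Mstar)) ≤ 4 * S.beta lam adv h := by
  obtain ⟨M₀, hM₀, hmin⟩ := exists_ridge_solution (S := S) hl hQ h
  have hD := one_le_detRatioA (S := S) hl hQ h
  have ht0 : (0 : ℝ) < t := by exact_mod_cast Nat.pos_of_ne_zero ht
  have ht1 : (1 : ℝ) ≤ t := by exact_mod_cast Nat.one_le_iff_ne_zero.2 ht
  set q := inner ℝ (noiseVec S Mstar adv Q h)
    (infoInv lam (histVec S adv Q h) (noiseVec S Mstar adv Q h)) with hq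
  have hq1 : q ≤ S.σ ^ 2 * (2 * Real.log t + Real.log (S.detRatioA lam adv h)) := by
    -- Taking logarithms turns the event into q/(2σ²) ≤ log t + (1/2) log det.
    have h1 : Real.exp (q / (2 * S.σ ^ 2)) / √(S.detRatioA lam adv h) ≤ t := by
      have h2 : histSelfNorm S lam Mstar adv Q h =
          ENNReal.ofReal (Real.exp (q / (2 * S.σ ^ 2)) / √(S.detRatioA lam adv h)) := by
        rw [histSelfNorm, selfNorm, hq, infoInv, ← sigmaA_eq lam hQ]; rfl
      rw [h2, ← ENNReal.ofReal_natCast] at hW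
      exact (ENNReal.ofReal_le_ofReal_iff ht0.le).1 hW
    rw [div_le_iff₀ (Real.sqrt_pos.2 (by linarith)), ← Real.le_log_iff_exp_le (by positivity),
      Real.log_mul ht0.ne' (Real.sqrt_pos.2 (by linarith)).ne', Real.log_sqrt (by linarith),
      div_le_iff₀ (by positivity)] at h1
    linarith
  have hb := beta_eq (S := S) hl hQ ht h
  have hs : 0 ≤ S.σ ^ 2 := sq_nonneg _
  have e1 : inner ℝ (Mstar - M₀) (S.sigmaA lam adv h (Mstar - M₀)) ≤ S.beta lam adv h := by
    have := ridge_error_le hl (histVec S adv Q h) (histObs S adv Q h) hM₀ Mstar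
    change _ ≤ 2 * q + _ at this
    rw [sigmaA_eq lam hQ, hb]
    -- The error is at most σ²(4 log t + 2 log det + 2d), well within the factor 20 of the radius.
    have h1 : 0 ≤ S.σ ^ 2 * Real.log t := mul_nonneg hs (Real.log_nonneg ht1)
    have h2 : 0 ≤ S.σ ^ 2 * Real.log (S.detRatioA lam adv h) := mul_nonneg hs (Real.log_nonneg hD)
    have h3 : 0 ≤ S.σ ^ 2 * (d : ℝ) := by positivity
    nlinarith
  refine ⟨⟨hB, fun _ => ⟨M₀, (hmin M₀).2 rfl, e1⟩⟩, ?_⟩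
  rintro M ⟨-, hM'⟩
  obtain ⟨Mbar, h1, h2⟩ := hM' ht
  rw [(hmin Mbar).1 h1] at h2
  rw [sigmaA_eq lam hQ] at h2 e1 ⊢
  -- Both M and M⋆ lie within the radius of the ridge solution, which gives 2 β + 2 β.
  linarith [inner_infoOp_sub_le hl (histVec S adv Q h) M Mstar M₀]

theorem sum_inner_rowB_sq (Θ : Par) (M : HSOp d H') :
    ∑ i, inner ℝ (rowB S Θ i) M ^ 2 = ‖S.opB Θ M‖ ^ 2 :=
  sum_inner_adjoint_sq (S.opB Θ) (stdOrthonormalBasis ℝ (HSOp d (E d))) M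

/-- The squared Hilbert–Schmidt norm of A is the sum of ‖A† e_i‖². Excitation applied to each v = A†
e_i bounds it by C⁻¹ ∑ ‖A 𝛟‖² over the initial states, which are the step-zero terms of the
right-hand side. -/
theorem sum_inner_rowB_sq_le {C : ℝ} {H : ℕ} (hC : 0 < C) {X : Ctx 𝒳 d} (hX : S.Excites X C H)
    (Θ : Par) (x : ℕ → ℕ → 𝒳) (h0 : ∀ n, S.feat (x n 0) = S.feat (X.x₀ n)) (M : HSOp d H') :
    ∑ i, inner ℝ (rowB S Θ i) M ^ 2 ≤ C⁻¹ * ∑ p, inner ℝ (epVec S X H Θ x p) M ^ 2 := by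
  have e2 : ∑ p, inner ℝ (epVec S X H Θ x p) M ^ 2 =
      ∑ n ∈ Finset.range X.N, ∑ k ∈ Finset.range (X.hor n),
        ‖S.lift Θ M (S.feat (x n k))‖ ^ 2 := by
    simp only [← sum_inner_rowA_sq]
    exact sum_epVec hX.fits Θ x (fun v => inner ℝ v M ^ 2) (by simp)
  rw [sum_inner_rowB_sq, e2, inv_mul_eq_div, le_div_iff₀ hC, norm_opB_sq, Finset.sum_mul]
  obtain ⟨-, hpos, hex, -⟩ := hX
  calc _ ≤ ∑ i, ∑ n ∈ Finset.range X.N, inner ℝ (S.feat (X.x₀ n))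
          (ContinuousLinearMap.adjoint (S.lift Θ M)
            (EuclideanSpace.basisFun (Fin d) ℝ i)) ^ 2 := by
        refine Finset.sum_le_sum fun i _ => ?_
        rw [mul_comm]
        exact hex _
    _ = ∑ n ∈ Finset.range X.N, ‖S.lift Θ M (S.feat (x n 0))‖ ^ 2 := by
        rw [Finset.sum_comm]
        refine Finset.sum_congr rfl fun n _ => ?_
        rw [h0, ← sum_inner_adjoint_sq _ (EuclideanSpace.basisFun (Fin d) ℝ)]
        exact Finset.sum_congr rfl fun i _ => by rw [real_inner_comm]
    _ ≤ _ := by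
        refine Finset.sum_le_sum fun n hn => ?_
        exact Finset.single_le_sum (f := fun k => ‖S.lift Θ M (S.feat (x n k))‖ ^ 2)
          (fun _ _ => sq_nonneg _) (Finset.mem_range.2 (hpos n (Finset.mem_range.1 hn)))

/-- The first information operator dominates the second one, since the initial states are
exciting. -/
theorem inner_sigmaB_le (hl : 0 < lam) {C : ℝ} {H : ℕ} (hC : 0 < C)
    (hexc : ∀ t h, S.Excites (adv t h) C H) (h : Hist Par 𝒳 t)
    (h0 : ∀ (τ : Fin t) (n : ℕ), S.feat ((h τ).2 n 0) = S.feat ((adv τ (h.before τ)).x₀ n))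
    (M : HSOp d H') :
    inner ℝ M (S.sigmaB lam h M) ≤ (1 + C⁻¹) * inner ℝ M (S.sigmaA lam adv h M) := by
  have hQ : ∀ t h, (adv t h).Fits H := fun t h => (hexc t h).fits
  have eB : inner ℝ M (S.sigmaB lam h M) =
      lam * ‖M‖ ^ 2 + ∑ τ, ∑ i, inner ℝ (rowB S (h τ).1 i) M ^ 2 := by
    rw [sigmaB_eq, inner_infoOp_self, Fintype.sum_prod_type]
    rfl
  have eA : inner ℝ M (S.sigmaA lam adv h M) = lam * ‖M‖ ^ 2 + ∑ τ : Fin t, ∑ p,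
      inner ℝ (epVec S (adv τ (h.before τ)) H (h τ).1 (h τ).2 p) M ^ 2 := by
    rw [sigmaA_eq lam hQ, inner_infoOp_self, Fintype.sum_prod_type]
    rfl
  have h2 := Finset.sum_le_sum fun (τ : Fin t) (_ : τ ∈ Finset.univ) =>
    sum_inner_rowB_sq_le hC (hexc τ (h.before τ)) (h τ).1 (h τ).2 (h0 τ) M
  rw [← Finset.mul_sum] at h2
  have h3 : 0 ≤ ∑ τ : Fin t, ∑ p,
      inner ℝ (epVec S (adv τ (h.before τ)) H (h τ).1 (h τ).2 p) M ^ 2 := by positivity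
  -- The observations need only the factor C⁻¹; the 1 in 1 + C⁻¹ is for the common term λ‖M‖².
  have h4 : 0 ≤ C⁻¹ * (lam * ‖M‖ ^ 2) := by positivity
  rw [eA, eB]
  linarith

/-- The deviation of the operator of the model `M` is controlled by the information gain. -/
theorem norm_lift_sub_sq_le (hl : 0 < lam) (h : Hist Par 𝒳 t) (Θ : Par) (M : HSOp d H') {y : ℝ}
    (hy : inner ℝ M (S.sigmaB lam h M) ≤ y) :
    ‖S.lift Θ M‖ ^ 2 ≤ stepB S lam h Θ * y := by
  refine (norm_lift_sq_le Θ M).trans ?_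
  rw [← sum_inner_rowB_sq, stepB, Finset.sum_mul]
  refine Finset.sum_le_sum fun i _ => ?_
  refine (inner_sq_le_infoInv hl (histVecB S h) _ M).trans ?_
  rw [← sigmaB_eq]
  exact mul_le_mul_of_nonneg_left hy (inner_infoInv_self_nonneg hl _ _)

end Pointwise

/-! ### Measurable dependence on the history -/

/-- It suffices to test on square cylinders, whose measures are finite products. -/
theorem measurable_infinitePi {α ι : Type*} {X : ι → Type*} [MeasurableSpace α]
    [∀ i, MeasurableSpace (X i)] {μ : α → (i : ι) → Measure (X i)}
    [∀ a i, IsProbabilityMeasure (μ a i)] (hμ : ∀ i, Measurable fun a => μ a i) :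
    Measurable fun a => Measure.infinitePi (μ a) := by
  refine Measurable.measure_of_isPiSystem_of_isProbabilityMeasure
    (generateFrom_squareCylinders (α := X)).symm
    (isPiSystem_squareCylinders (fun _ => MeasurableSpace.isPiSystem_measurableSet) (by simp)) ?_
  rintro _ ⟨s, t, ht, rfl⟩
  have ht' : ∀ i, MeasurableSet (t i) := fun i => ht i (Set.mem_univ i)
  simp only [Measure.infinitePi_pi _ fun i _ => ht' i]
  exact Finset.measurable_prod _ fun i _ => (Measure.measurable_coe (ht' i)).comp (hμ i)

theorem measurable_sum_range {Ω : Type*} [MeasurableSpace Ω] {M : Type*} [AddCommMonoid M]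
    [MeasurableSpace M] [MeasurableAdd₂ M] {N : Ω → ℕ} (hN : Measurable N) {f : ℕ → Ω → M}
    (hf : ∀ n, Measurable (f n)) : Measurable fun ω => ∑ n ∈ Finset.range (N ω), f n ω := by
  have : Measurable fun p : ℕ × Ω => ∑ n ∈ Finset.range p.1, f n p.2 :=
    measurable_from_prod_countable_right fun m =>
      (Finset.measurable_sum (Finset.range m) fun n _ => hf n :)
  exact this.comp (hN.prodMk measurable_id)

section HistMeas

variable {Par : Type uP} {𝒳 : Type uX} [MeasurableSpace Par] [MeasurableSpace 𝒳] {d : ℕ}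
  {H' : Type uH} [NormedAddCommGroup H'] [InnerProductSpace ℝ H'] [CompleteSpace H']
  {S : Model.{uΩ} Par 𝒳 d H'} {adv : Adversary Par 𝒳 d} {Q : ℕ} {lam : ℝ} {t : ℕ}

theorem measurable_before (τ : Fin t) : Measurable fun h : Hist Par 𝒳 t => h.before τ :=
  measurable_pi_lambda _ fun _ => measurable_pi_apply _

theorem measurable_extend {Ω : Type*} [MeasurableSpace Ω] {h : Ω → Hist Par 𝒳 t}
    (hh : Measurable h) {e : Ω → Ep Par 𝒳} (he : Measurable e) :
    Measurable fun ω => (h ω).extend (e ω) := by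
  refine measurable_pi_lambda _ fun i => ?_
  induction i using Fin.lastCases with
  | last => simpa using he
  | cast i =>
    simp only [Hist.extend_castSucc]
    exact (measurable_pi_apply i).comp hh

theorem continuous_adjoint_evalOp (v : E d) : Continuous fun q : (E d →L[ℝ] H') × E d =>
    ContinuousLinearMap.adjoint (evalOp (ContinuousLinearMap.adjoint q.1) q.2) v := by
  have h1 : Continuous fun q : (E d →L[ℝ] H') × E d =>
      evalOp (ContinuousLinearMap.adjoint q.1) q.2 := by
    unfold evalOp
    refine Continuous.clm_comp
      ((ContinuousLinearMap.adjoint (𝕜 := ℝ) (E := E d) (F := H')).continuous.comp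
        continuous_fst) (continuous_finsetSum _ fun i _ => ?_)
    have : Continuous fun q : (E d →L[ℝ] H') × E d => q.2 i := by fun_prop
    exact this.smul continuous_const
  exact ((ContinuousLinearMap.adjoint (𝕜 := ℝ) (E := HSOp d H') (F := E d)).continuous.comp
    h1).clm_apply continuous_const

theorem stronglyMeasurable_rowA {Ω : Type*} [MeasurableSpace Ω] (hM : S.MeasurableModel)
    {Θ : Ω → Par} (hΘ : Measurable Θ) {z : Ω → E d} (hz : Measurable z) (i : Fin d) :
    StronglyMeasurable fun ω => rowA S (Θ ω) (z ω) i := by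
  have h1 : StronglyMeasurable fun ω => (S.Ψ (Θ ω), z ω) :=
    (hM.1.comp_measurable hΘ).prodMk hz.stronglyMeasurable
  have h2 := (continuous_adjoint_evalOp (EuclideanSpace.basisFun (Fin d) ℝ i)).comp_stronglyMeasurable
    h1
  exact h2

/-- Writes these vectors through `evalOp`, so that continuity of the adjoint gives measurability as
it does for `rowA`. -/
theorem rowB_eq (Θ : Par) (i : Fin (Module.finrank ℝ (HSOp d (E d)))) :
    rowB S Θ i = ∑ j, ContinuousLinearMap.adjoint
      (evalOp (ContinuousLinearMap.adjoint (S.Ψ Θ)) (EuclideanSpace.basisFun (Fin d) ℝ j))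
      (stdOrthonormalBasis ℝ (HSOp d (E d)) i j) := by
  refine ext_inner_right ℝ fun M => ?_
  rw [rowB, ContinuousLinearMap.adjoint_inner_left, sum_inner, PiLp.inner_apply]
  refine Finset.sum_congr rfl fun j _ => ?_
  rw [ContinuousLinearMap.adjoint_inner_left]
  congr 1
  have : (S.opB Θ M) j = HSOp.op (S.opB Θ M) (EuclideanSpace.basisFun (Fin d) ℝ j) := by
    simp [HSOp.op_apply]
  rw [this, Model.opB, op_compOp, evalOp_apply]
  rfl

theorem stronglyMeasurable_rowB {Ω : Type*} [MeasurableSpace Ω] (hM : S.MeasurableModel)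
    {Θ : Ω → Par} (hΘ : Measurable Θ) (i : Fin (Module.finrank ℝ (HSOp d (E d)))) :
    StronglyMeasurable fun ω => rowB S (Θ ω) i := by
  simp only [rowB_eq]
  refine Finset.stronglyMeasurable_fun_sum _ fun j _ => ?_
  have h1 : StronglyMeasurable fun ω =>
      (S.Ψ (Θ ω), EuclideanSpace.basisFun (Fin d) ℝ j) :=
    (hM.1.comp_measurable hΘ).prodMk stronglyMeasurable_const
  have h2 := (continuous_adjoint_evalOp
    (stdOrthonormalBasis ℝ (HSOp d (E d)) i j)).comp_stronglyMeasurable h1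
  exact h2

theorem measurableSet_inRange {Ω : Type*} [MeasurableSpace Ω] {N : Ω → ℕ} (hN : Measurable N)
    {hor : Ω → ℕ} (hh : Measurable hor) (n k : ℕ) :
    MeasurableSet {ω | n < N ω ∧ k < hor ω} :=
  (hN (measurableSet_Ioi (a := n))).inter (hh (measurableSet_Ioi (a := k)))

theorem stronglyMeasurable_histVec (hM : S.MeasurableModel) (hA : MeasurableAdversary adv)
    (hG : S.GaussianFeatures) (p : Fin t × Fin Q × Fin Q × Fin d) :
    StronglyMeasurable fun h : Hist Par 𝒳 t => histVec S adv Q h p := by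
  unfold histVec epVec
  refine StronglyMeasurable.ite (measurableSet_inRange
    ((hA p.1).1.comp (measurable_before p.1)) (((hA p.1).2.1 _).comp (measurable_before p.1)) _ _)
    (stronglyMeasurable_rowA hM ?_ ?_ _) stronglyMeasurable_const
  · exact measurable_fst.comp (measurable_pi_apply p.1)
  · exact (measurable_feat hG).comp ((measurable_pi_apply _).comp ((measurable_pi_apply _).comp
      (measurable_snd.comp (measurable_pi_apply p.1))))

theorem measurable_histObs (hA : MeasurableAdversary adv)
    (hG : S.GaussianFeatures) (p : Fin t × Fin Q × Fin Q × Fin d) :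
    Measurable fun h : Hist Par 𝒳 t => histObs S adv Q h p := by
  unfold histObs epObs
  refine Measurable.ite (measurableSet_inRange
    ((hA p.1).1.comp (measurable_before p.1)) (((hA p.1).2.1 _).comp (measurable_before p.1)) _ _)
    ?_ measurable_const
  have h1 : Measurable fun x : 𝒳 => S.feat x p.2.2.2 := hG.2.1 _
  exact h1.comp ((measurable_pi_apply _).comp ((measurable_pi_apply _).comp
      (measurable_snd.comp (measurable_pi_apply p.1))))

theorem stronglyMeasurable_noiseVec (hM : S.MeasurableModel) (hA : MeasurableAdversary adv)
    (hG : S.GaussianFeatures) (Mstar : HSOp d H') :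
    StronglyMeasurable fun h : Hist Par 𝒳 t => noiseVec S Mstar adv Q h := by
  unfold noiseVec
  refine Finset.stronglyMeasurable_fun_sum _ fun p _ => ?_
  exact ((measurable_histObs hA hG p).stronglyMeasurable.sub
    ((stronglyMeasurable_histVec hM hA hG p).inner stronglyMeasurable_const)).smul
    (stronglyMeasurable_histVec hM hA hG p)

theorem measurable_detRatioA (hl : 0 < lam) (hQ : ∀ t h, (adv t h).Fits Q)
    (hM : S.MeasurableModel) (hA : MeasurableAdversary adv) (hG : S.GaussianFeatures) :
    Measurable fun h : Hist Par 𝒳 t => S.detRatioA lam adv h := by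
  unfold Model.detRatioA
  simp only [sigmaA_eq lam hQ]
  exact measurable_fredholmDet_infoOp hl fun p => stronglyMeasurable_histVec hM hA hG p

theorem measurable_detRatioB (hl : 0 < lam) (hM : S.MeasurableModel) :
    Measurable fun h : Hist Par 𝒳 t => S.detRatioB lam h := by
  unfold Model.detRatioB
  simp only [sigmaB_eq lam]
  exact measurable_fredholmDet_infoOp hl fun p => stronglyMeasurable_rowB hM
    (measurable_fst.comp (measurable_pi_apply p.1)) _

theorem measurable_histSelfNorm (hl : 0 < lam) (hQ : ∀ t h, (adv t h).Fits Q)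
    (hM : S.MeasurableModel) (hA : MeasurableAdversary adv) (hG : S.GaussianFeatures)
    (Mstar : HSOp d H') :
    Measurable fun h : Hist Par 𝒳 t => histSelfNorm S lam Mstar adv Q h := by
  unfold histSelfNorm
  simp only [sigmaA_eq lam hQ]
  exact measurable_selfNorm hl _ (fun p => stronglyMeasurable_histVec hM hA hG p)
    (stronglyMeasurable_noiseVec hM hA hG Mstar)

theorem measurable_stepB (hl : 0 < lam) (hM : S.MeasurableModel) {θ : Hist Par 𝒳 t → Par}
    (hθ : Measurable θ) : Measurable fun h : Hist Par 𝒳 t => stepB S lam h (θ h) := by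
  unfold stepB
  exact Finset.measurable_sum _ fun i _ => measurable_inner_infoInv hl (fun p =>
    stronglyMeasurable_rowB hM (measurable_fst.comp (measurable_pi_apply p.1)) _)
    (stronglyMeasurable_rowB hM hθ i)

/-! ### The law of the history -/

theorem measurable_episodeLaw (hM : S.MeasurableModel) :
    Measurable fun p : Par × (ℕ → 𝒳) => S.episodeLaw p.1 p.2 := by
  unfold Model.episodeLaw
  exact measurable_infinitePi fun n => hM.2.comp
    (measurable_fst.prodMk ((measurable_pi_apply n).comp measurable_snd))

theorem measurable_x₀ (hA : MeasurableAdversary adv) :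
    Measurable fun h : Hist Par 𝒳 t => (adv t h).x₀ :=
  measurable_pi_lambda _ fun n => (hA t).2.2.1 n

theorem measurable_episodeLaw_hist (hM : S.MeasurableModel) (hA : MeasurableAdversary adv)
    {θ : Hist Par 𝒳 t → Par} (hθ : Measurable θ) :
    Measurable fun h => S.episodeLaw (θ h) (adv t h).x₀ :=
  (measurable_episodeLaw hM).comp (hθ.prodMk (measurable_x₀ hA))

theorem measurable_lintegral_episode (hM : S.MeasurableModel) (hA : MeasurableAdversary adv)
    {θ : Hist Par 𝒳 t → Par} (hθ : Measurable θ) {f : Hist Par 𝒳 t × (ℕ → ℕ → 𝒳) → ℝ≥0∞}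
    (hf : Measurable f) :
    Measurable fun h => ∫⁻ x, f (h, x) ∂S.episodeLaw (θ h) (adv t h).x₀ := by
  let κ : Kernel (Hist Par 𝒳 t) (ℕ → ℕ → 𝒳) := ⟨_, measurable_episodeLaw_hist (S := S) hM hA hθ⟩
  have : IsMarkovKernel κ := ⟨fun h => by
    change IsProbabilityMeasure (S.episodeLaw _ _); infer_instance⟩
  exact Measurable.lintegral_kernel_prod_right (κ := κ) (f := fun h x => f (h, x)) hf

theorem measurable_extendLaw (hM : S.MeasurableModel) (hA : MeasurableAdversary adv)
    {θ : Hist Par 𝒳 t → Par} (hθ : Measurable θ) :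
    Measurable fun h => (S.episodeLaw (θ h) (adv t h).x₀).map fun x => h.extend (θ h, x) := by
  refine Measure.measurable_of_measurable_coe _ fun s hs => ?_
  have h1 : ∀ h : Hist Par 𝒳 t, Measurable fun x => h.extend (θ h, x) := fun h =>
    measurable_extend measurable_const (measurable_const.prodMk measurable_id)
  have h2 : Measurable fun p : Hist Par 𝒳 t × (ℕ → ℕ → 𝒳) => p.1.extend (θ p.1, p.2) :=
    measurable_extend measurable_fst ((hθ.comp measurable_fst).prodMk measurable_snd)
  have h3 : ∀ h : Hist Par 𝒳 t, ((S.episodeLaw (θ h) (adv t h).x₀).map fun x =>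
      h.extend (θ h, x)) s = ∫⁻ x, s.indicator 1 (h.extend (θ h, x))
        ∂S.episodeLaw (θ h) (adv t h).x₀ := by
    intro h
    rw [← lintegral_indicator_one hs, lintegral_map (measurable_one.indicator hs) (h1 h)]
  simp only [h3]
  exact measurable_lintegral_episode hM hA hθ
    (f := fun p => s.indicator 1 (p.1.extend (θ p.1, p.2))) ((measurable_one.indicator hs).comp h2)

theorem histLaw_succ (pol : Policy Par 𝒳) (t : ℕ) :
    S.histLaw adv pol (t + 1) = (S.histLaw adv pol t).bind fun h =>
      (S.episodeLaw (pol t h) (adv t h).x₀).map fun x => h.extend (pol t h, x) := rfl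

theorem lintegral_histLaw_succ (hM : S.MeasurableModel) (hA : MeasurableAdversary adv)
    {pol : Policy Par 𝒳} (hpol : ∀ t, Measurable (pol t)) {f : Hist Par 𝒳 (t + 1) → ℝ≥0∞}
    (hf : Measurable f) :
    ∫⁻ h, f h ∂S.histLaw adv pol (t + 1) =
      ∫⁻ h, ∫⁻ x, f (h.extend (pol t h, x)) ∂S.episodeLaw (pol t h) (adv t h).x₀
        ∂S.histLaw adv pol t := by
  rw [histLaw_succ, Measure.lintegral_bind (measurable_extendLaw hM hA (hpol t)).aemeasurable
    hf.aemeasurable]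
  refine lintegral_congr fun h => ?_
  have h1 : Measurable fun x => h.extend (pol t h, x) :=
    measurable_extend measurable_const (measurable_const.prodMk measurable_id)
  rw [lintegral_map hf h1]

theorem isProbabilityMeasure_histLaw (hM : S.MeasurableModel) (hA : MeasurableAdversary adv)
    {pol : Policy Par 𝒳} (hpol : ∀ t, Measurable (pol t)) (t : ℕ) :
    IsProbabilityMeasure (S.histLaw adv pol t) := by
  induction t with
  | zero => unfold Model.histLaw; infer_instance
  | succ t ih =>
    constructor
    have := lintegral_histLaw_succ (t := t) hM hA hpol (f := fun _ => 1) measurable_const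
    simpa using this

/-- The law of the history depends only on the policy up to then. -/
theorem histLaw_congr {pol pol' : Policy Par 𝒳} (t : ℕ) (h : ∀ s < t, pol s = pol' s) :
    S.histLaw adv pol t = S.histLaw adv pol' t := by
  induction t with
  | zero => rfl
  | succ t ih =>
    rw [histLaw_succ, histLaw_succ, ih fun s hs => h s (hs.trans (Nat.lt_succ_self t)),
      h t (Nat.lt_succ_self t)]

theorem ae_histLaw_succ (hM : S.MeasurableModel) (hA : MeasurableAdversary adv)
    {pol : Policy Par 𝒳} (hpol : ∀ t, Measurable (pol t)) {s : Set (Hist Par 𝒳 (t + 1))}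
    (hs : MeasurableSet s)
    (h : ∀ᵐ h ∂S.histLaw adv pol t, ∀ᵐ x ∂S.episodeLaw (pol t h) (adv t h).x₀,
      h.extend (pol t h, x) ∈ s) :
    ∀ᵐ h ∂S.histLaw adv pol (t + 1), h ∈ s := by
  have h1 := lintegral_histLaw_succ (S := S) hM hA hpol (f := sᶜ.indicator 1)
    (measurable_one.indicator hs.compl)
  rw [lintegral_indicator_one hs.compl] at h1
  rw [ae_iff]
  refine h1.trans ?_
  rw [lintegral_eq_zero_of_ae_eq_zero]
  filter_upwards [h] with h hh
  rw [Pi.zero_apply]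
  refine lintegral_eq_zero_of_ae_eq_zero ?_
  filter_upwards [hh] with x hx
  simp [hx]

/-- Trajectories start at the states that the adversary picked, as far as the features can tell. -/
theorem ae_feat_initial (hM : S.MeasurableModel) (hA : MeasurableAdversary adv)
    (hG : S.GaussianFeatures) {pol : Policy Par 𝒳} (hpol : ∀ t, Measurable (pol t)) (t : ℕ) :
    ∀ᵐ h ∂S.histLaw adv pol t, ∀ (τ : Fin t) (n : ℕ),
      S.feat ((h τ).2 n 0) = S.feat ((adv τ (h.before τ)).x₀ n) := by
  induction t with
  | zero => exact Filter.Eventually.of_forall fun h τ => τ.elim0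
  | succ t ih =>
    refine ae_histLaw_succ hM hA hpol (s := {h | ∀ (τ : Fin (t + 1)) (n : ℕ),
      S.feat ((h τ).2 n 0) = S.feat ((adv τ (h.before τ)).x₀ n)}) ?_ ?_
    · have : {h : Hist Par 𝒳 (t + 1) | ∀ (τ : Fin (t + 1)) (n : ℕ),
          S.feat ((h τ).2 n 0) = S.feat ((adv τ (h.before τ)).x₀ n)} =
          ⋂ (τ : Fin (t + 1)) (n : ℕ), {h | S.feat ((h τ).2 n 0) =
            S.feat ((adv τ (h.before τ)).x₀ n)} := by ext; simp
      rw [this]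
      refine MeasurableSet.iInter fun τ => MeasurableSet.iInter fun n => measurableSet_eq_fun ?_ ?_
      · exact (measurable_feat hG).comp ((measurable_pi_apply _).comp ((measurable_pi_apply _).comp
          (measurable_snd.comp (measurable_pi_apply τ))))
      · exact (measurable_feat hG).comp (((hA τ).2.2.1 n).comp (measurable_before τ))
    · filter_upwards [ih] with h hh
      have h1 : ∀ n, ∀ᵐ x ∂S.episodeLaw (pol t h) (adv t h).x₀,
          S.feat (x n 0) = S.feat ((adv t h).x₀ n) := by
        intro n
        have h2 : ∀ᵐ y ∂(S.sys (pol t h)).trajLaw ((adv t h).x₀ n),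
            S.feat (y 0) = S.feat ((adv t h).x₀ n) := by
          rw [RDS.trajLaw, ae_map_iff (measurable_F _ _).aemeasurable]
          · exact Filter.Eventually.of_forall fun ω =>
              congrArg S.feat ((S.sys (pol t h)).F_zero ω _)
          · exact measurableSet_eq_fun ((measurable_feat hG).comp (measurable_pi_apply 0))
              measurable_const
        exact (measurePreserving_eval_infinitePi
          (fun n => (S.sys (pol t h)).trajLaw ((adv t h).x₀ n)) n).quasiMeasurePreserving.ae h2
      filter_upwards [ae_all_iff.2 h1] with x hx τ n
      induction τ using Fin.lastCases with
      | last =>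
        simp only [Hist.extend_last, Hist.before_extend_last]
        exact hx n
      | cast τ =>
        simp only [Hist.extend_castSucc, Hist.before_extend_castSucc]
        exact hh τ n

/-- The self-normalized exponential is a supermartingale. -/
theorem lintegral_histSelfNorm_extend_le (hl : 0 < lam) (hQ : ∀ t h, (adv t h).Fits Q)
    (hM : S.MeasurableModel) (hσ : 0 < S.σ) (hG : S.GaussianFeatures)
    (hK : S.IsKoopmanRealization) {Mstar : HSOp d H'} (hR : S.Represents Mstar)
    (h : Hist Par 𝒳 t) (Θ : Par) :
    ∫⁻ x, histSelfNorm S lam Mstar adv Q (h.extend (Θ, x)) ∂S.episodeLaw Θ (adv t h).x₀ ≤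
      histSelfNorm S lam Mstar adv Q h := by
  set X := adv t h with hX
  set T := S.sigmaA lam adv h with hT
  set ξ := noiseVec S Mstar adv Q h with hξ
  let G : (ℕ → ℕ → E d) → ℝ≥0∞ := fun y => selfNorm lam S.σ
    (T + ∑ n ∈ Finset.range X.N, ∑ k ∈ Finset.range (X.hor n), ∑ i,
        InnerProductSpace.rankOne ℝ (rowA S Θ (y n k) i) (rowA S Θ (y n k) i))
    (ξ + ∑ n ∈ Finset.range X.N, ∑ k ∈ Finset.range (X.hor n), ∑ i,
        (y n (k + 1) - S.lift Θ Mstar (y n k)) i • rowA S Θ (y n k) i)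
  have hrow : ∀ n k i, StronglyMeasurable fun y : ℕ → ℕ → E d => rowA S Θ (y n k) i := fun n k i =>
    stronglyMeasurable_rowA hM measurable_const
      ((measurable_pi_apply k).comp (measurable_pi_apply n)) i
  have hG1 : Measurable G := by
    -- The padded form of the operator exists to make `G` measurable; the estimate itself uses the
    -- unpadded sums.
    have h1 : ∀ y : ℕ → ℕ → E d, T + ∑ n ∈ Finset.range X.N, ∑ k ∈ Finset.range (X.hor n), ∑ i,
        InnerProductSpace.rankOne ℝ (rowA S Θ (y n k) i) (rowA S Θ (y n k) i) =
        infoOp lam (Sum.elim (histVec S adv Q h) fun p : Fin Q × Fin Q × Fin d =>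
          if (p.1 : ℕ) < X.N ∧ (p.2.1 : ℕ) < X.hor p.1 then rowA S Θ (y p.1 p.2.1) p.2.2 else 0) := by
      intro y
      rw [infoOp_sumElim, hT, sigmaA_eq lam hQ]
      congr 1
      rw [← sum_pad (hQ t h).1 (hQ t h).2]
      refine Finset.sum_congr rfl fun p _ => ?_
      split_ifs <;> simp
    simp only [G, h1]
    refine measurable_selfNorm hl _ ?_ ?_
    · rintro (p | p)
      · exact stronglyMeasurable_const
      · simp only [Sum.elim_inr]
        split_ifs
        · exact hrow _ _ _
        · exact stronglyMeasurable_const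
    · refine stronglyMeasurable_const.add (Finset.stronglyMeasurable_fun_sum _ fun n _ =>
        Finset.stronglyMeasurable_fun_sum _ fun k _ => Finset.stronglyMeasurable_fun_sum _ fun i _ =>
          ?_)
      have : Continuous fun y : ℕ → ℕ → E d => (y n (k + 1) - S.lift Θ Mstar (y n k)) i := by
        fun_prop
      exact this.measurable.stronglyMeasurable.smul (hrow n k i)
  have h2 : ∀ x, histSelfNorm S lam Mstar adv Q (h.extend (Θ, x)) =
      G fun n k => S.feat (x n k) := by
    intro x
    have e1 : S.sigmaA lam adv (h.extend (Θ, x)) = T + ∑ n ∈ Finset.range X.N,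
        ∑ k ∈ Finset.range (X.hor n), ∑ i, InnerProductSpace.rankOne ℝ
          (rowA S Θ (S.feat (x n k)) i) (rowA S Θ (S.feat (x n k)) i) := by
      rw [sigmaA_extend lam hQ, infoOp_sumElim, ← sigmaA_eq lam hQ]
      congr 1
      exact sum_epVec (hQ t h) Θ x (fun v => InnerProductSpace.rankOne ℝ v v) (by simp)
    simp only [histSelfNorm, G]
    rw [e1, noiseVec_extend, epNoiseVec_eq Mstar (hQ t h)]
  simp only [h2]
  rw [lintegral_episodeLaw hG hK Θ X.x₀ hG1]
  refine le_trans (le_of_eq (lintegral_congr fun e => ?_)) (lintegral_selfNorm_episode_le hl hσ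
    (S.𝒦 Θ) (rowA S Θ) X.N (fun n => S.feat (X.x₀ n)) X.hor (T := T) ?_ ξ)
  · simp only [G]
    congr 2
    refine Finset.sum_congr rfl fun n _ => Finset.sum_congr rfl fun k _ =>
      Finset.sum_congr rfl fun i _ => ?_
    congr 1
    -- On the true chain the residual with respect to M⋆ is exactly the noise.
    rw [← hR Θ]
    simp [chain]
  · rw [hT, sigmaA_eq lam hQ]
    exact isInfo_infoOp _ _

/-- For the empty history the noise vector is zero and the determinant is at least one; afterwards
the mean does not increase. -/
theorem lintegral_histSelfNorm_le_one (hl : 0 < lam) (hQ : ∀ t h, (adv t h).Fits Q)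
    (hM : S.MeasurableModel) (hA : MeasurableAdversary adv) (hσ : 0 < S.σ)
    (hG : S.GaussianFeatures)
    (hK : S.IsKoopmanRealization) {Mstar : HSOp d H'} (hR : S.Represents Mstar)
    {pol : Policy Par 𝒳} (hpol : ∀ t, Measurable (pol t)) (t : ℕ) :
    ∫⁻ h, histSelfNorm S lam Mstar adv Q h ∂S.histLaw adv pol t ≤ 1 := by
  induction t with
  | zero =>
    unfold Model.histLaw
    rw [lintegral_dirac' _ (measurable_histSelfNorm hl hQ hM hA hG Mstar)]
    rw [histSelfNorm, selfNorm]
    have h1 : noiseVec S Mstar adv Q (Fin.elim0 : Hist Par 𝒳 0) = 0 := by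
      unfold noiseVec
      rw [Fintype.sum_prod_type]
      simp
    rw [h1, inner_zero_left, zero_div, Real.exp_zero]
    refine ENNReal.ofReal_le_one.2 ?_
    rw [div_le_one₀]
    · exact Real.one_le_sqrt.2 (one_le_detRatioA (S := S) hl hQ _)
    · exact Real.sqrt_pos.2 (zero_lt_one.trans_le (one_le_detRatioA (S := S) hl hQ _))
  | succ t ih =>
    rw [lintegral_histLaw_succ hM hA hpol (measurable_histSelfNorm hl hQ hM hA hG Mstar)]
    exact (lintegral_mono fun h =>
      lintegral_histSelfNorm_extend_le hl hQ hM hσ hG hK hR h (pol t h)).trans ih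

/-- The confidence sets fail with probability at most `1 / t`. -/
theorem histLaw_lt_histSelfNorm_le (hl : 0 < lam) (hQ : ∀ t h, (adv t h).Fits Q)
    (hM : S.MeasurableModel) (hA : MeasurableAdversary adv) (hσ : 0 < S.σ)
    (hG : S.GaussianFeatures)
    (hK : S.IsKoopmanRealization) {Mstar : HSOp d H'} (hR : S.Represents Mstar)
    {pol : Policy Par 𝒳} (hpol : ∀ t, Measurable (pol t)) (t : ℕ) :
    S.histLaw adv pol t {h | (t : ℝ≥0∞) < histSelfNorm S lam Mstar adv Q h} ≤ (t : ℝ≥0∞)⁻¹ := by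
  -- For t = 0 the bound is `⊤`.
  rcases eq_or_ne t 0 with rfl | ht
  · simp
  have h1 := mul_meas_ge_le_lintegral (μ := S.histLaw adv pol t)
    (measurable_histSelfNorm (t := t) hl hQ hM hA hG Mstar) (t : ℝ≥0∞)
  have h2 := h1.trans (lintegral_histSelfNorm_le_one hl hQ hM hA hσ hG hK hR hpol t)
  rw [← one_div, ENNReal.le_div_iff_mul_le (Or.inl (by exact_mod_cast ht)) (Or.inl (by simp)),
    mul_comm]
  refine le_trans ?_ h2
  refine mul_le_mul_right (measure_mono fun h (hh : (t : ℝ≥0∞) < _) => ?_) _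
  exact hh.le

end HistMeas

/-! ### Values of parameters -/

section Value

variable {Par : Type uP} {𝒳 : Type uX} [MeasurableSpace Par] [MeasurableSpace 𝒳] {d : ℕ}
  {H' : Type uH} [NormedAddCommGroup H'] [InnerProductSpace ℝ H'] [CompleteSpace H']

/-- The standing assumptions. -/
structure Setting (S : Model.{uΩ} Par 𝒳 d H') (adv : Adversary Par 𝒳 d) (Mstar : HSOp d H')
    (L α Λmax C Vmax lam : ℝ) (H : ℕ) : Prop where
  model : S.MeasurableModel
  adversary : MeasurableAdversary adv
  σ_pos : 0 < S.σ
  gauss : S.GaussianFeatures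
  koopman : S.IsKoopmanRealization
  represents : S.Represents Mstar
  mem_ball : Mstar ∈ S.Ball₀
  realizable : ∀ t h, S.Realizable (adv t h)
  L_nonneg : 0 ≤ L
  α_pos : 0 < α
  α_le : α ≤ 1
  Λmax_nonneg : 0 ≤ Λmax
  holder : S.HolderCost L α Λmax
  C_pos : 0 < C
  H_pos : 0 < H
  excites : ∀ t h, S.Excites (adv t h) C H
  V_pos : 0 < Vmax
  moment : ∀ t h, S.MomentBound (adv t h) Vmax
  lam_pos : 0 < lam
  lam_le : lam * ‖Mstar‖ ^ 2 ≤ S.σ ^ 2 * d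

variable {S : Model.{uΩ} Par 𝒳 d H'} {adv : Adversary Par 𝒳 d} {Mstar : HSOp d H'}
  {L α Λmax C Vmax lam : ℝ} {H : ℕ} {t : ℕ}

variable (S) in
/-- The cost `Λ[𝒦(Θ)] + J^Θ`, through the features. -/
def value (Θ : Par) (X : Ctx 𝒳 d) : ℝ≥0∞ := (S.Λ (S.𝒦 Θ) : ℝ≥0∞) + costOf S (S.𝒦 Θ) X

namespace Setting

variable (hS : Setting S adv Mstar L α Λmax C Vmax lam H)
include hS

theorem fits (t : ℕ) (h : Hist Par 𝒳 t) : (adv t h).Fits H := (hS.excites t h).fits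

theorem measurable_w (h : Hist Par 𝒳 t) : Measurable (adv t h).w :=
  (hS.adversary t).2.2.2.comp (measurable_const.prodMk measurable_id)

theorem optValue_eq (h : Hist Par 𝒳 t) : S.optValue (adv t h) = ⨅ Θ, value S Θ (adv t h) := by
  unfold Model.optValue value
  simp only [J_eq hS.gauss hS.koopman _ (hS.realizable t h) (hS.measurable_w h)]

theorem chainSq_le (Θ : Par) (h : Hist Par 𝒳 t) :
    ∑ n ∈ Finset.range (adv t h).N, chainSq S.σ (S.𝒦 Θ) (S.feat ((adv t h).x₀ n)) (adv t h).w
      ((adv t h).hor n) ≤ ENNReal.ofReal Vmax :=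
  sum_chainSq_le hS.gauss hS.koopman Θ (hS.realizable t h) (hS.measurable_w h) (hS.moment t h)

theorem costOf_le_add (Θ : Par) (B : E d →L[ℝ] E d) (h : Hist Par 𝒳 t) :
    costOf S (S.𝒦 Θ) (adv t h) ≤ costOf S B (adv t h) + 2 * (ENNReal.ofReal Vmax ^ (1 / 2 : ℝ) *
      epHell S (S.𝒦 Θ) B (adv t h) ^ (1 / 2 : ℝ)) :=
  costOf_le hS.σ_pos _ _ (hS.measurable_w h) (hS.chainSq_le Θ h)

theorem Λ_le (Θ : Par) : (S.Λ (S.𝒦 Θ) : ℝ) ≤ Λmax := by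
  have := hS.holder.2 Θ Mstar hS.mem_ball
  rw [← hS.represents Θ] at this
  exact (le_abs_self _).trans this

theorem coe_Λ_le (Θ : Par) : (S.Λ (S.𝒦 Θ) : ℝ≥0∞) ≤ ENNReal.ofReal Λmax := by
  rw [← ENNReal.ofReal_coe_nnreal]
  exact ENNReal.ofReal_le_ofReal (hS.Λ_le Θ)

/-- A bound uniform in parameter and history, from the second moments by Cauchy–Schwarz. It makes
all expectations below finite. -/
theorem value_le (Θ : Par) (h : Hist Par 𝒳 t) : value S Θ (adv t h) ≤
    ENNReal.ofReal Λmax + ENNReal.ofReal Vmax ^ (1 / 2 : ℝ) * (H : ℝ≥0∞) ^ (1 / 2 : ℝ) := by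
  refine add_le_add (hS.coe_Λ_le Θ) ((costOf_le_sqrt (hS.measurable_w h)
    (hS.chainSq_le Θ h)).trans ?_)
  gcongr
  exact (hS.fits t h).1

theorem value_bound_ne_top : ENNReal.ofReal Λmax +
    ENNReal.ofReal Vmax ^ (1 / 2 : ℝ) * (H : ℝ≥0∞) ^ (1 / 2 : ℝ) ≠ ⊤ := by
  refine ENNReal.add_ne_top.2 ⟨ENNReal.ofReal_ne_top, ENNReal.mul_ne_top ?_ ?_⟩
  · exact ENNReal.rpow_ne_top_of_nonneg (by norm_num) ENNReal.ofReal_ne_top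
  · exact ENNReal.rpow_ne_top_of_nonneg (by norm_num) (ENNReal.natCast_ne_top H)

/-! #### Measurability of the optimal value -/

theorem stronglyMeasurable_𝒦 : StronglyMeasurable S.𝒦 := by
  have h1 : S.𝒦 = fun Θ => ContinuousLinearMap.adjoint (S.Ψ Θ) ∘L HSOp.op Mstar :=
    funext hS.represents
  have h2 : Continuous fun q : E d →L[ℝ] H' =>
      ContinuousLinearMap.adjoint q ∘L HSOp.op Mstar :=
    (ContinuousLinearMap.adjoint (𝕜 := ℝ) (E := E d) (F := H')).continuous.clm_comp
      continuous_const
  rw [h1]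
  exact h2.comp_stronglyMeasurable hS.model.1

theorem tendsto_holder (A : E d →L[ℝ] E d) : Filter.Tendsto
    (fun B : E d →L[ℝ] E d => L * max (‖B - A‖ ^ 2) (‖B - A‖ ^ α)) (nhds A) (nhds 0) := by
  have h1 : Continuous fun B : E d →L[ℝ] E d => L * max (‖B - A‖ ^ 2) (‖B - A‖ ^ α) := by
    refine continuous_const.mul (Continuous.max (by fun_prop) ?_)
    exact Continuous.rpow_const (by fun_prop) fun _ => Or.inr hS.α_pos.le
  have h2 := h1.tendsto A
  simpa [Real.zero_rpow hS.α_pos.ne'] using h2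

/-- The Hölder condition gives continuity of Λ only at the operators 𝒦(Θ), so Λ is restricted to
their range before composing. -/
theorem measurable_Λ : Measurable fun Θ => S.Λ (S.𝒦 Θ) := by
  have h1 : Continuous fun B : Set.range S.𝒦 => S.Λ B := by
    rw [continuous_iff_continuousAt]
    rintro ⟨_, Θ, rfl⟩
    rw [ContinuousAt, tendsto_iff_dist_tendsto_zero]
    have h2 := (hS.tendsto_holder (S.𝒦 Θ)).comp
      (continuous_subtype_val.tendsto (⟨S.𝒦 Θ, Θ, rfl⟩ : Set.range S.𝒦))
    refine squeeze_zero (fun _ => dist_nonneg) (fun B => ?_) h2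
    rw [NNReal.dist_eq]
    exact hS.holder.1 B Θ
  have h3 : Measurable fun Θ => (⟨S.𝒦 Θ, Θ, rfl⟩ : Set.range S.𝒦) :=
    hS.stronglyMeasurable_𝒦.measurable.subtype_mk
  exact h1.measurable.comp h3

theorem measurable_stepCost : Measurable fun p : Hist Par 𝒳 t × (ℕ → ℕ → 𝒳) =>
    ∑ n ∈ Finset.range (adv t p.1).N, ∑ k ∈ Finset.range ((adv t p.1).hor n),
      ((adv t p.1).c (p.2 n k) : ℝ≥0∞) := by
  refine measurable_sum_range ((hS.adversary t).1.comp measurable_fst) fun n =>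
    measurable_sum_range (((hS.adversary t).2.1 n).comp measurable_fst) fun k => ?_
  simp only [hS.realizable t _ _]
  refine ((hS.adversary t).2.2.2.comp (measurable_fst.prodMk ?_)).coe_nnreal_ennreal
  exact (measurable_feat hS.gauss).comp ((measurable_pi_apply k).comp
    ((measurable_pi_apply n).comp measurable_snd))

theorem lintegral_stepCost (Θ : Par) (h : Hist Par 𝒳 t) :
    ∫⁻ x, ∑ n ∈ Finset.range (adv t h).N, ∑ k ∈ Finset.range ((adv t h).hor n),
      ((adv t h).c (x n k) : ℝ≥0∞) ∂S.episodeLaw Θ (adv t h).x₀ = costOf S (S.𝒦 Θ) (adv t h) := by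
  have hm : ∀ n, Measurable fun y : ℕ → E d =>
      ∑ k ∈ Finset.range ((adv t h).hor n), ((adv t h).w (y k) : ℝ≥0∞) := fun n =>
    Finset.measurable_sum _ fun k _ =>
      ((hS.measurable_w h).comp (measurable_pi_apply k)).coe_nnreal_ennreal
  simp only [hS.realizable t h _]
  rw [lintegral_finsetSum]
  · refine Finset.sum_congr rfl fun n _ => ?_
    exact lintegral_episodeLaw_eval hS.gauss hS.koopman Θ (adv t h).x₀ n (hm n)
  · intro n _
    exact (hm n).comp ((measurable_featTraj hS.gauss).comp (measurable_pi_apply n))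

theorem measurable_value {θ : Hist Par 𝒳 t → Par} (hθ : Measurable θ) :
    Measurable fun h => value S (θ h) (adv t h) := by
  unfold value
  simp only [← hS.lintegral_stepCost]
  exact (hS.measurable_Λ.comp hθ).coe_nnreal_ennreal.add
    (measurable_lintegral_episode hS.model hS.adversary hθ hS.measurable_stepCost)

/-- The range of 𝒦 is separable, and parameters whose operators approach 𝒦(Θ) have values with upper
limit at most that of Θ. Hence the infimum is countable and `optValue` is measurable. -/
theorem exists_dense_seq [Nonempty Par] : ∃ u : ℕ → Par, ∀ (t : ℕ) (h : Hist Par 𝒳 t),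
    S.optValue (adv t h) = ⨅ i, value S (u i) (adv t h) := by
  have : Nonempty (Set.range S.𝒦) := ⟨⟨_, Classical.arbitrary Par, rfl⟩⟩
  choose u hu using fun i => (TopologicalSpace.denseSeq (Set.range S.𝒦) i).2
  refine ⟨u, fun t h => ?_⟩
  rw [hS.optValue_eq]
  refine le_antisymm (le_iInf fun i => iInf_le _ (u i)) (le_iInf fun Θ => ?_)
  let Y := Set.range S.𝒦
  let A : Y := ⟨S.𝒦 Θ, Θ, rfl⟩
  -- `g` bounds from above the value of any parameter with operator `B`, and tends to the value of Θ
  -- as `B` tends to 𝒦(Θ).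
  let g : Y → ℝ≥0∞ := fun B =>
    (S.Λ (S.𝒦 Θ) : ℝ≥0∞) + ENNReal.ofReal (L * max (‖(B : E d →L[ℝ] E d) - S.𝒦 Θ‖ ^ 2)
      (‖(B : E d →L[ℝ] E d) - S.𝒦 Θ‖ ^ α)) + (costOf S (S.𝒦 Θ) (adv t h) +
      2 * (ENNReal.ofReal Vmax ^ (1 / 2 : ℝ) * epHell S (S.𝒦 Θ) B (adv t h) ^ (1 / 2 : ℝ)))
  have hval : Filter.Tendsto (fun B : Y => (B : E d →L[ℝ] E d)) (nhds A) (nhds (S.𝒦 Θ)) :=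
    continuous_subtype_val.tendsto A
  have hg : Filter.Tendsto g (nhds A) (nhds (value S Θ (adv t h))) := by
    have h1 := ENNReal.tendsto_ofReal ((hS.tendsto_holder (S.𝒦 Θ)).comp hval)
    have h2 := ((ENNReal.continuous_rpow_const (y := 1 / 2)).tendsto _).comp
      ((tendsto_epHell hS.σ_pos (S.𝒦 Θ) (adv t h)).comp hval)
    have h3 := ENNReal.Tendsto.const_mul (a := 2) (ENNReal.Tendsto.const_mul
      (a := ENNReal.ofReal Vmax ^ (1 / 2 : ℝ)) h2 (Or.inr (ENNReal.rpow_ne_top_of_nonneg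
        (by norm_num) ENNReal.ofReal_ne_top))) (Or.inr (by norm_num))
    have h4 := (tendsto_const_nhds (x := (S.Λ (S.𝒦 Θ) : ℝ≥0∞))).add h1 |>.add
      ((tendsto_const_nhds (x := costOf S (S.𝒦 Θ) (adv t h))).add h3)
    rw [ENNReal.zero_rpow_of_pos (by norm_num), mul_zero, mul_zero, ENNReal.ofReal_zero, add_zero,
      add_zero] at h4
    exact h4
  have hd : (nhdsWithin A (Set.range (TopologicalSpace.denseSeq Y))).NeBot :=
    mem_closure_iff_nhdsWithin_neBot.1 (TopologicalSpace.denseRange_denseSeq Y A)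
  have hg' : Filter.Tendsto g (nhdsWithin A (Set.range (TopologicalSpace.denseSeq Y)))
      (nhds (value S Θ (adv t h))) := hg.mono_left nhdsWithin_le_nhds
  refine ge_of_tendsto hg' (Filter.eventually_of_mem
    self_mem_nhdsWithin ?_)
  rintro B ⟨i, rfl⟩
  refine (iInf_le _ i).trans ?_
  have hB : ((TopologicalSpace.denseSeq Y i : Y) : E d →L[ℝ] E d) = S.𝒦 (u i) := (hu i).symm
  simp only [g, hB, value]
  refine add_le_add ?_ ?_
  · have h1 := (le_abs_self _).trans (hS.holder.1 (S.𝒦 (u i)) Θ)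
    rw [← ENNReal.ofReal_coe_nnreal, ← ENNReal.ofReal_coe_nnreal, ← ENNReal.ofReal_add]
    · exact ENNReal.ofReal_le_ofReal (by linarith)
    · exact NNReal.coe_nonneg _
    · exact mul_nonneg hS.L_nonneg (le_max_of_le_left (sq_nonneg _))
  -- The second moment is taken at the approximating parameter, where it has the same bound.
  · rw [epHell_comm]
    exact hS.costOf_le_add (u i) _ h

theorem measurable_optValue [Nonempty Par] :
    Measurable fun h : Hist Par 𝒳 t => S.optValue (adv t h) := by
  obtain ⟨u, hu⟩ := hS.exists_dense_seq
  simp only [hu]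
  exact Measurable.iInf fun i => hS.measurable_value measurable_const

theorem optValue_le (Θ : Par) (h : Hist Par 𝒳 t) :
    S.optValue (adv t h) ≤ value S Θ (adv t h) := by
  rw [hS.optValue_eq]
  exact iInf_le _ Θ

/-- Near-optimal parameters can be picked measurably. -/
theorem exists_selection [Nonempty Par] {ε : ℝ≥0∞} (hε : ε ≠ 0) (t : ℕ) :
    ∃ sel : Hist Par 𝒳 t → Par, Measurable sel ∧
      ∀ h, value S (sel h) (adv t h) ≤ S.optValue (adv t h) + ε := by
  classical
  obtain ⟨u, hu⟩ := hS.exists_dense_seq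
  have h1 : ∀ h : Hist Par 𝒳 t, ∃ i, value S (u i) (adv t h) ≤ S.optValue (adv t h) + ε := by
    intro h
    have h2 : S.optValue (adv t h) < S.optValue (adv t h) + ε := by
      refine ENNReal.lt_add_right ?_ hε
      exact ((hS.optValue_le (Classical.arbitrary Par) h).trans
        (hS.value_le _ h)).trans_lt hS.value_bound_ne_top.lt_top |>.ne
    conv at h2 => lhs; rw [hu]
    obtain ⟨i, hi⟩ := iInf_lt_iff.1 h2
    exact ⟨i, hi.le⟩
  refine ⟨fun h => u (Nat.find (h1 h)), ?_, fun h => Nat.find_spec (h1 h)⟩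
  exact (measurable_from_top (f := u)).comp (measurable_find h1 fun k =>
    measurableSet_le (hS.measurable_value measurable_const)
      (hS.measurable_optValue.add_const ε))

/-! #### The expected regret -/

/-- Given the history, the realized cost of an episode has mean `value`, so the tower property
replaces realized costs by conditional means. -/
theorem integral_regret (pol : Policy Par 𝒳) (hpol : ∀ t, Measurable (pol t)) (T : ℕ) :
    Integrable (S.regret adv (T := T)) (S.histLaw adv pol T) ∧
      ∫ h, S.regret adv h ∂S.histLaw adv pol T =
        ∑ t ∈ Finset.range T, (∫⁻ h, value S (pol t h) (adv t h) ∂S.histLaw adv pol t).toReal -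
        ∑ t ∈ Finset.range T, (∫⁻ h, S.optValue (adv t h) ∂S.histLaw adv pol t).toReal := by
  have : Nonempty Par := ⟨pol 0 Fin.elim0⟩
  have hprob := isProbabilityMeasure_histLaw hS.model hS.adversary hpol
  let f : (τ : ℕ) → Hist Par 𝒳 τ × Ep Par 𝒳 → ℝ≥0∞ := fun τ p =>
    (S.Λ (S.𝒦 p.2.1) : ℝ≥0∞) + ∑ n ∈ Finset.range (adv τ p.1).N,
      ∑ k ∈ Finset.range ((adv τ p.1).hor n), ((adv τ p.1).c (p.2.2 n k) : ℝ≥0∞)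
  have hf : ∀ τ, Measurable (f τ) := fun τ =>
    (hS.measurable_Λ.comp (measurable_fst.comp measurable_snd)).coe_nnreal_ennreal.add
      (hS.measurable_stepCost.comp (measurable_fst.prodMk (measurable_snd.comp measurable_snd)))
  have hf' : ∀ T, Measurable fun h : Hist Par 𝒳 T => ∑ τ : Fin T, f τ (h.before τ, h τ) :=
    fun T => Finset.measurable_sum _ fun τ _ =>
      (hf τ).comp ((measurable_before τ).prodMk (measurable_pi_apply τ))
  have hg' : ∀ T, Measurable fun h : Hist Par 𝒳 T => ∑ τ : Fin T, S.optValue (adv τ (h.before τ)) :=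
    fun T => Finset.measurable_sum _ fun τ _ =>
      (hS.measurable_optValue (t := τ)).comp (measurable_before τ)
  have hfe : ∀ τ (h : Hist Par 𝒳 τ), ∫⁻ x, f τ (h, (pol τ h, x))
      ∂S.episodeLaw (pol τ h) (adv τ h).x₀ = value S (pol τ h) (adv τ h) := by
    intro τ h
    simp only [f]
    rw [lintegral_add_left measurable_const, hS.lintegral_stepCost, lintegral_const, measure_univ,
      mul_one]
    rfl
  have e1 : ∀ T, ∫⁻ h, ∑ τ : Fin T, f τ (h.before τ, h τ) ∂S.histLaw adv pol T =
      ∑ t ∈ Finset.range T, ∫⁻ h, value S (pol t h) (adv t h) ∂S.histLaw adv pol t := by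
    intro T
    induction T with
    | zero => simp
    | succ T ih =>
      rw [lintegral_histLaw_succ hS.model hS.adversary hpol (hf' _), Finset.sum_range_succ, ← ih,
        ← lintegral_add_left (hf' T)]
      refine lintegral_congr fun h => ?_
      simp only [Fin.sum_univ_castSucc, Hist.extend_castSucc, Hist.extend_last,
        Hist.before_extend_castSucc, Hist.before_extend_last, Fin.val_castSucc, Fin.val_last]
      rw [lintegral_add_left measurable_const, hfe, lintegral_const, measure_univ, mul_one]
  have e2 : ∀ T, ∫⁻ h, ∑ τ : Fin T, S.optValue (adv τ (h.before τ)) ∂S.histLaw adv pol T =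
      ∑ t ∈ Finset.range T, ∫⁻ h, S.optValue (adv t h) ∂S.histLaw adv pol t := by
    intro T
    induction T with
    | zero => simp
    | succ T ih =>
      rw [lintegral_histLaw_succ hS.model hS.adversary hpol (hg' _), Finset.sum_range_succ, ← ih,
        ← lintegral_add_left (hg' T)]
      refine lintegral_congr fun h => ?_
      simp only [Fin.sum_univ_castSucc,
        Hist.before_extend_castSucc, Hist.before_extend_last, Fin.val_castSucc, Fin.val_last]
      rw [lintegral_const, measure_univ, mul_one]
  have b1 : ∀ t, ∫⁻ h, value S (pol t h) (adv t h) ∂S.histLaw adv pol t ≠ ⊤ := by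
    intro t
    have := hprob t
    refine ((lintegral_mono fun h => hS.value_le (pol t h) h).trans_lt ?_).ne
    simpa using hS.value_bound_ne_top.lt_top
  have hle : ∀ (t : ℕ) (h : Hist Par 𝒳 t), S.optValue (adv t h) ≤ value S (pol t h) (adv t h) :=
    fun t h => hS.optValue_le _ h
  have b2 : ∀ t, ∫⁻ h, S.optValue (adv t h) ∂S.histLaw adv pol t ≠ ⊤ := fun t =>
    ((lintegral_mono fun h => hle t h).trans_lt (b1 t).lt_top).ne
  have f1 : ∫⁻ h, ∑ τ : Fin T, f τ (h.before τ, h τ) ∂S.histLaw adv pol T ≠ ⊤ := by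
    rw [e1]
    exact ENNReal.sum_ne_top.2 fun t _ => b1 t
  have f2 : ∫⁻ h, ∑ τ : Fin T, S.optValue (adv τ (h.before τ)) ∂S.histLaw adv pol T ≠ ⊤ := by
    rw [e2]
    exact ENNReal.sum_ne_top.2 fun t _ => b2 t
  have hreg : S.regret adv (T := T) = fun h => (∑ τ : Fin T, f τ (h.before τ, h τ)).toReal -
      (∑ τ : Fin T, S.optValue (adv τ (h.before τ))).toReal := by
    funext h
    unfold Model.regret
    rw [ENNReal.toReal_sum, ENNReal.toReal_sum]
    · congr 1
      refine Finset.sum_congr rfl fun τ _ => ?_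
      have : f τ (h.before τ, h τ) = (((S.Λ (S.𝒦 (h τ).1)) +
        ∑ n ∈ Finset.range (adv τ (h.before τ)).N,
          ∑ k ∈ Finset.range ((adv τ (h.before τ)).hor n),
            (adv τ (h.before τ)).c ((h τ).2 n k) : ℝ≥0) : ℝ≥0∞) := by
        simp only [f]
        push_cast
        rfl
      rw [this, ENNReal.coe_toReal]
      push_cast
      rfl
    · intro τ _
      exact ((hS.optValue_le (Classical.arbitrary Par) _).trans
        (hS.value_le _ _)).trans_lt hS.value_bound_ne_top.lt_top |>.ne
    · intro τ _
      simp only [f]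
      refine ENNReal.add_ne_top.2 ⟨ENNReal.coe_ne_top, ?_⟩
      exact ENNReal.sum_ne_top.2 fun n _ => ENNReal.sum_ne_top.2 fun k _ => ENNReal.coe_ne_top
  have i1 := integrable_toReal_of_lintegral_ne_top (hf' T).aemeasurable f1
  have i2 := integrable_toReal_of_lintegral_ne_top (hg' T).aemeasurable f2
  rw [hreg]
  refine ⟨i1.sub i2, ?_⟩
  rw [integral_sub i1 i2, integral_toReal (hf' T).aemeasurable
    (ae_lt_top (hf' T) f1), integral_toReal (hg' T).aemeasurable (ae_lt_top (hg' T) f2), e1, e2,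
    ENNReal.toReal_sum fun t _ => b1 t, ENNReal.toReal_sum fun t _ => b2 t]

end Setting

end Value

/-! ### Regret of one episode -/

/-- For v ≤ 1 both δ² and δ^α are at most v^(α/2)(1 + y), since v ≤ v^(α/2). For v ≥ 1 the trivial
bound Λmax is used. The outcome is a power of min(1, v), which can be summed over episodes. -/
theorem holder_gap_le {L α Λmax δ v y r : ℝ} (hL : 0 ≤ L) (hα : 0 < α) (hα1 : α ≤ 1)
    (hΛ : 0 ≤ Λmax) (hδ : 0 ≤ δ) (hv : 0 ≤ v) (hy : 0 ≤ y) (hδv : δ ^ 2 ≤ v * y)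
    (h1 : r ≤ L * max (δ ^ 2) (δ ^ α)) (h2 : r ≤ Λmax) :
    r ≤ (Λmax + L * (1 + y)) * min 1 v ^ (α / 2) := by
  rcases le_total v 1 with hv1 | hv1
  · rw [min_eq_right hv1]
    have hp : 0 ≤ v ^ (α / 2) := Real.rpow_nonneg hv _
    have e1 : v ≤ v ^ (α / 2) := by
      have := Real.rpow_le_rpow_of_exponent_ge' hv hv1 (by linarith : 0 ≤ α / 2)
        (by linarith : α / 2 ≤ 1)
      rwa [Real.rpow_one] at this
    have e2 : δ ^ 2 ≤ v ^ (α / 2) * (1 + y) := by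
      refine hδv.trans ?_
      gcongr
      linarith
    have e3 : δ ^ α ≤ v ^ (α / 2) * (1 + y) := by
      have e4 : δ ^ α = (δ ^ 2) ^ (α / 2) := by
        rw [← Real.rpow_natCast, ← Real.rpow_mul hδ]
        congr 1
        push_cast
        ring
      rw [e4]
      calc (δ ^ 2) ^ (α / 2) ≤ (v * y) ^ (α / 2) :=
            Real.rpow_le_rpow (sq_nonneg _) hδv (by linarith)
        _ = v ^ (α / 2) * y ^ (α / 2) := Real.mul_rpow hv hy
        _ ≤ _ := by
          gcongr
          calc y ^ (α / 2) ≤ (1 + y) ^ (α / 2) :=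
                Real.rpow_le_rpow hy (by linarith) (by linarith)
            _ ≤ (1 + y) ^ (1 : ℝ) :=
                Real.rpow_le_rpow_of_exponent_le (by linarith) (by linarith)
            _ = 1 + y := Real.rpow_one _
    have e5 : max (δ ^ 2) (δ ^ α) ≤ v ^ (α / 2) * (1 + y) := max_le e2 e3
    calc r ≤ L * (v ^ (α / 2) * (1 + y)) := h1.trans (by gcongr)
      _ ≤ _ := by nlinarith [mul_nonneg hΛ hp]
  · rw [min_eq_left hv1, Real.one_rpow, mul_one]
    have : 0 ≤ L * (1 + y) := by positivity
    linarith

section Episode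

variable {Par : Type uP} {𝒳 : Type uX} [MeasurableSpace Par] [MeasurableSpace 𝒳] {d : ℕ}
  {H' : Type uH} [NormedAddCommGroup H'] [InnerProductSpace ℝ H'] [CompleteSpace H']
  {S : Model.{uΩ} Par 𝒳 d H'} {adv : Adversary Par 𝒳 d} {Mstar : HSOp d H'}
  {L α Λmax C Vmax lam : ℝ} {H : ℕ} {t : ℕ}

variable (S) in
/-- The expected increase of the information when `Θ` is played next. -/
def infoStep (lam : ℝ) (adv : Adversary Par 𝒳 d) (h : Hist Par 𝒳 t) (Θ : Par) : ℝ≥0∞ :=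
  ∫⁻ x, ENNReal.ofReal (2 * (Real.log (S.detRatioA lam adv (h.extend (Θ, x))) -
    Real.log (S.detRatioA lam adv h))) ∂S.episodeLaw Θ (adv t h).x₀

variable (S) in
/-- The expected information after `Θ` is played next. -/
def infoNext (lam : ℝ) (adv : Adversary Par 𝒳 d) (h : Hist Par 𝒳 t) (Θ : Par) : ℝ≥0∞ :=
  ∫⁻ x, ENNReal.ofReal (2 * Real.log (S.detRatioA lam adv (h.extend (Θ, x))))
    ∂S.episodeLaw Θ (adv t h).x₀

namespace Setting

variable (hS : Setting S adv Mstar L α Λmax C Vmax lam H)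
include hS

theorem log_detRatioA_nonneg (h : Hist Par 𝒳 t) : 0 ≤ Real.log (S.detRatioA lam adv h) :=
  Real.log_nonneg (one_le_detRatioA hS.lam_pos hS.fits h)

theorem log_detRatioB_nonneg (h : Hist Par 𝒳 t) : 0 ≤ Real.log (S.detRatioB lam h) :=
  Real.log_nonneg (one_le_detRatioB hS.lam_pos h)

/-- The Hellinger distance between the true and the modelled episode is paid for by the information
that this very episode brings. -/
theorem epHell_le_infoStep (h : Hist Par 𝒳 t) (Θ : Par) (M : HSOp d H') {y : ℝ}
    (hy : inner ℝ (M - Mstar) (S.sigmaA lam adv h (M - Mstar)) ≤ S.σ ^ 2 * y) :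
    epHell S (S.𝒦 Θ) (S.lift Θ M) (adv t h) ≤
      5 * (ENNReal.ofReal (y + H) * infoStep S lam adv h Θ) := by
  refine (epHell_le hS.σ_pos hS.gauss hS.koopman Θ (S.lift Θ M) (adv t h)).trans ?_
  gcongr 5 * ?_
  have hσ2 : 0 < S.σ ^ 2 := pow_pos hS.σ_pos 2
  have hy0 : 0 ≤ y := by
    have h1 : 0 ≤ S.σ ^ 2 * y := by
      refine le_trans ?_ hy
      rw [sigmaA_eq lam hS.fits]
      exact inner_infoOp_self_nonneg hS.lam_pos _ _
    exact nonneg_of_mul_nonneg_right h1 hσ2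
  rw [infoStep, ← lintegral_const_mul' _ _ ENNReal.ofReal_ne_top]
  refine lintegral_mono fun x => ?_
  rw [← ENNReal.ofReal_mul (by positivity)]
  refine ENNReal.ofReal_le_ofReal ?_
  have e1 : inner ℝ (Mstar - M) (S.sigmaA lam adv h (Mstar - M)) ≤ S.σ ^ 2 * y := by
    have : Mstar - M = -(M - Mstar) := by abel
    rwa [this, map_neg, inner_neg_neg]
  have e2 := sum_min_gap_le (S := S) hS.lam_pos hS.fits hS.σ_pos h (Θ, x) (Mstar - M) e1
  rw [mul_div_cancel_left₀ _ hσ2.ne', lift_sub, ← hS.represents Θ] at e2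
  exact e2

/-- Needs no confidence set: the bound λ‖M⋆‖² ≤ σ² d replaces closeness of the model. -/
theorem epHell_zero_le (h : Hist Par 𝒳 t) (Θ : Par) :
    epHell S (S.𝒦 Θ) 0 (adv t h) ≤ 5 * (ENNReal.ofReal (d + H) * infoNext S lam adv h Θ) := by
  refine (epHell_le hS.σ_pos hS.gauss hS.koopman Θ 0 (adv t h)).trans ?_
  gcongr 5 * ?_
  rw [infoNext, ← lintegral_const_mul' _ _ ENNReal.ofReal_ne_top]
  refine lintegral_mono fun x => ?_
  rw [← ENNReal.ofReal_mul (by positivity)]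
  refine ENNReal.ofReal_le_ofReal ?_
  have e2 := sum_min_gap_zero_le (S := S) hS.lam_pos hS.fits hS.σ_pos hS.lam_le h (Θ, x)
  rw [← hS.represents Θ] at e2
  rw [sub_zero]
  exact e2

/-- The regret of an episode when the confidence set fails. -/
theorem value_le_of_bad (h : Hist Par 𝒳 t) (Θ Θ' : Par) {ε : ℝ≥0∞}
    (hΘ' : value S Θ' (adv t h) ≤ S.optValue (adv t h) + ε) :
    value S Θ (adv t h) ≤ S.optValue (adv t h) + (ε + ENNReal.ofReal Λmax +
      2 * (ENNReal.ofReal Vmax ^ (1 / 2 : ℝ) * (10 * (ENNReal.ofReal (d + H) *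
        (infoNext S lam adv h Θ + infoNext S lam adv h Θ'))) ^ (1 / 2 : ℝ))) := by
  have h1 := hS.costOf_le_add Θ (S.𝒦 Θ') h
  have h2 : epHell S (S.𝒦 Θ) (S.𝒦 Θ') (adv t h) ≤ 10 * (ENNReal.ofReal (d + H) *
      (infoNext S lam adv h Θ + infoNext S lam adv h Θ')) := by
    -- The two parameters need not be close, so each is compared with pure noise.
    refine (epHell_triangle _ _ 0 _).trans ?_
    calc _ ≤ 2 * (5 * (ENNReal.ofReal (d + H) * infoNext S lam adv h Θ)) +
          2 * (5 * (ENNReal.ofReal (d + H) * infoNext S lam adv h Θ')) := by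
          gcongr
          · exact hS.epHell_zero_le h Θ
          · exact hS.epHell_zero_le h Θ'
      _ = _ := by ring
  calc value S Θ (adv t h) ≤ ENNReal.ofReal Λmax + (costOf S (S.𝒦 Θ') (adv t h) +
        2 * (ENNReal.ofReal Vmax ^ (1 / 2 : ℝ) * (10 * (ENNReal.ofReal (d + H) *
        (infoNext S lam adv h Θ + infoNext S lam adv h Θ'))) ^ (1 / 2 : ℝ))) := by
        refine add_le_add (hS.coe_Λ_le Θ) (h1.trans ?_)
        gcongr
    _ ≤ ENNReal.ofReal Λmax + ((S.optValue (adv t h) + ε) +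
        2 * (ENNReal.ofReal Vmax ^ (1 / 2 : ℝ) * (10 * (ENNReal.ofReal (d + H) *
        (infoNext S lam adv h Θ + infoNext S lam adv h Θ'))) ^ (1 / 2 : ℝ))) := by
        gcongr
        exact le_add_self.trans hΘ'
    _ = _ := by ring

/-- The regret of an episode in which the confidence set contains `Mstar`. -/
theorem value_le_of_good {T : ℕ} (ht : t ≠ 0) (htT : t ≤ T) (h : Hist Par 𝒳 t)
    (hW : histSelfNorm S lam Mstar adv H h ≤ t)
    (h0 : ∀ (τ : Fin t) (n : ℕ), S.feat ((h τ).2 n 0) = S.feat ((adv τ (h.before τ)).x₀ n))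
    {Θ : Par} {M : HSOp d H'} (hM : M ∈ S.ball lam adv h)
    (hopt : ∀ Θ', ∀ M' ∈ S.ball lam adv h,
      (S.Λ (S.lift Θ M) : ℝ≥0∞) + S.modelJ Θ (adv t h) M ≤
        (S.Λ (S.lift Θ' M') : ℝ≥0∞) + S.modelJ Θ' (adv t h) M') :
    value S Θ (adv t h) ≤ S.optValue (adv t h) + (ENNReal.ofReal
      ((Λmax + L * (1 + 80 * (1 + C⁻¹) * S.σ ^ 2 *
        (d + Real.log T + Real.log (S.detRatioA lam adv h)))) *
          min 1 (stepB S lam h Θ) ^ (α / 2)) +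
      2 * (ENNReal.ofReal Vmax ^ (1 / 2 : ℝ) * (5 * (ENNReal.ofReal
        (80 * (d + Real.log T + Real.log (S.detRatioA lam adv h)) + H) *
          infoStep S lam adv h Θ)) ^ (1 / 2 : ℝ))) := by
  obtain ⟨hm, hb⟩ := mem_ball_of_histSelfNorm_le hS.lam_pos hS.fits hS.σ_pos hS.lam_le hS.mem_ball
    ht h hW
  set Z := (d : ℝ) + Real.log T + Real.log (S.detRatioA lam adv h) with hZ
  have hlog : Real.log t ≤ Real.log T :=
    Real.log_le_log (by exact_mod_cast Nat.pos_of_ne_zero ht) (by exact_mod_cast htT)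
  have hlogt : 0 ≤ Real.log t := Real.log_natCast_nonneg t
  have hZ0 : 0 ≤ Z := by
    have := hS.log_detRatioA_nonneg h
    have : (0 : ℝ) ≤ d := Nat.cast_nonneg d
    rw [hZ]; linarith
  have hσ2 : 0 ≤ S.σ ^ 2 := sq_nonneg _
  -- The constant 80 is 4 times the 20 in the radius.
  have hy : inner ℝ (M - Mstar) (S.sigmaA lam adv h (M - Mstar)) ≤ S.σ ^ 2 * (80 * Z) := by
    refine (hb M hM).trans ?_
    rw [beta_eq hS.lam_pos hS.fits ht]
    have : S.σ ^ 2 * Real.log t ≤ S.σ ^ 2 * Real.log T := by gcongr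
    rw [hZ]
    linarith
  have hcost := hS.costOf_le_add Θ (S.lift Θ M) h
  have hell := hS.epHell_le_infoStep h Θ M hy
  -- Optimism: with M⋆ in the confidence set, every parameter with its true operator is among the
  -- competitors of the oracle.
  have hopt' : (S.Λ (S.lift Θ M) : ℝ≥0∞) + costOf S (S.lift Θ M) (adv t h) ≤
      S.optValue (adv t h) := by
    rw [hS.optValue_eq]
    refine le_iInf fun Θ' => (hopt Θ' Mstar hm).trans_eq ?_
    rw [modelJ_eq, ← hS.represents Θ']
    rfl
  have hC : 0 ≤ C⁻¹ := inv_nonneg.2 hS.C_pos.le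
  have hsp : (S.Λ (S.𝒦 Θ) : ℝ) - S.Λ (S.lift Θ M) ≤
      (Λmax + L * (1 + 80 * (1 + C⁻¹) * S.σ ^ 2 * Z)) * min 1 (stepB S lam h Θ) ^ (α / 2) := by
    refine holder_gap_le hS.L_nonneg hS.α_pos hS.α_le hS.Λmax_nonneg
      (norm_nonneg (S.lift Θ M - S.𝒦 Θ)) (stepB_nonneg hS.lam_pos h Θ) (by positivity) ?_ ?_ ?_
    · have e1 : S.lift Θ M - S.𝒦 Θ = S.lift Θ (M - Mstar) := by
        rw [lift_sub, ← hS.represents Θ]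
      rw [e1]
      refine norm_lift_sub_sq_le hS.lam_pos h Θ _ ?_
      refine (inner_sigmaB_le hS.lam_pos hS.C_pos hS.excites h h0 _).trans ?_
      calc _ ≤ (1 + C⁻¹) * (S.σ ^ 2 * (80 * Z)) := by gcongr
        _ = _ := by ring
    · refine le_trans ?_ (hS.holder.1 (S.lift Θ M) Θ)
      rw [abs_sub_comm]
      exact le_abs_self _
    · have := hS.Λ_le Θ
      have h2 : (0 : ℝ) ≤ S.Λ (S.lift Θ M) := NNReal.coe_nonneg _
      linarith
  have hnn : 0 ≤ (Λmax + L * (1 + 80 * (1 + C⁻¹) * S.σ ^ 2 * Z)) *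
      min 1 (stepB S lam h Θ) ^ (α / 2) := by
    have h1 := hS.L_nonneg
    have h2 := hS.Λmax_nonneg
    have h3 := stepB_nonneg (S := S) hS.lam_pos h Θ
    positivity
  have hsp' : (S.Λ (S.𝒦 Θ) : ℝ≥0∞) ≤ (S.Λ (S.lift Θ M) : ℝ≥0∞) + ENNReal.ofReal
      ((Λmax + L * (1 + 80 * (1 + C⁻¹) * S.σ ^ 2 * Z)) * min 1 (stepB S lam h Θ) ^ (α / 2)) := by
    rw [← ENNReal.ofReal_coe_nnreal, ← ENNReal.ofReal_coe_nnreal,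
      ← ENNReal.ofReal_add (NNReal.coe_nonneg _) hnn]
    exact ENNReal.ofReal_le_ofReal (by linarith)
  calc value S Θ (adv t h) ≤ _ + (_ + 2 * (ENNReal.ofReal Vmax ^ (1 / 2 : ℝ) *
        (5 * (ENNReal.ofReal (80 * Z + H) * infoStep S lam adv h Θ)) ^ (1 / 2 : ℝ))) :=
        add_le_add hsp' (hcost.trans (by gcongr))
    _ = ((S.Λ (S.lift Θ M) : ℝ≥0∞) + costOf S (S.lift Θ M) (adv t h)) + _ := by
        rw [add_add_add_comm]
    _ ≤ _ := by gcongr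

end Setting

end Episode

/-! ### Expected regret of one episode -/

theorem ofReal_rpow_half {x : ℝ} (hx : 0 ≤ x) :
    ENNReal.ofReal x ^ (1 / 2 : ℝ) = ENNReal.ofReal √x := by
  rw [ENNReal.ofReal_rpow_of_nonneg hx (by norm_num), Real.sqrt_eq_rpow]

theorem rpow_half_sq (x : ℝ≥0∞) : (x ^ (1 / 2 : ℝ)) ^ 2 = x := by
  rw [← ENNReal.rpow_natCast, ← ENNReal.rpow_mul]
  norm_num

/-- An affine bound for the concave power; it plays the part of Jensen's inequality, with η chosen
only after summing over episodes. -/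
theorem rpow_le_add_mul {α η w : ℝ} (hα : 0 < α) (hα1 : α ≤ 1) (hη : 0 < η) (hw : 0 ≤ w) :
    w ^ α ≤ η ^ α + η ^ (α - 1) * w := by
  have h1 : 0 ≤ η ^ α := Real.rpow_nonneg hη.le _
  have h2 : 0 ≤ η ^ (α - 1) := Real.rpow_nonneg hη.le _
  rcases le_total w η with h | h
  · have := Real.rpow_le_rpow hw h hα.le
    nlinarith
  · have hw' : 0 < w := hη.trans_le h
    have h3 : w ^ (α - 1) ≤ η ^ (α - 1) := Real.rpow_le_rpow_of_nonpos hη h (by linarith)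
    have h4 : w ^ α = w ^ (α - 1) * w := by
      rw [← Real.rpow_add_one hw'.ne', sub_add_cancel]
    rw [h4]
    nlinarith

section Expect

variable {Par : Type uP} {𝒳 : Type uX} [MeasurableSpace Par] [MeasurableSpace 𝒳] {d : ℕ}
  {H' : Type uH} [NormedAddCommGroup H'] [InnerProductSpace ℝ H'] [CompleteSpace H']
  {S : Model.{uΩ} Par 𝒳 d H'} {adv : Adversary Par 𝒳 d} {Mstar : HSOp d H'}
  {L α Λmax C Vmax lam : ℝ} {H : ℕ} {t T : ℕ}

/-- Processes that increase along histories increase in mean. -/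
theorem monotone_lintegral_histLaw (hM : S.MeasurableModel) (hA : MeasurableAdversary adv)
    {pol : Policy Par 𝒳} (hpol : ∀ t, Measurable (pol t)) {F : (t : ℕ) → Hist Par 𝒳 t → ℝ≥0∞}
    (hF : ∀ t, Measurable (F t)) (hmono : ∀ t h e, F t h ≤ F (t + 1) (h.extend e)) :
    Monotone fun t => ∫⁻ h, F t h ∂S.histLaw adv pol t := by
  refine monotone_nat_of_le_succ fun t => ?_
  rw [lintegral_histLaw_succ hM hA hpol (hF (t + 1))]
  refine lintegral_mono fun h => ?_
  calc F t h = ∫⁻ _, F t h ∂S.episodeLaw (pol t h) (adv t h).x₀ := by simp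
    _ ≤ _ := lintegral_mono fun x => hmono t h _

/-- The mean increments of a process add up to at most its final mean. -/
theorem sum_lintegral_histLaw_le (hM : S.MeasurableModel) (hA : MeasurableAdversary adv)
    {pol : Policy Par 𝒳} (hpol : ∀ t, Measurable (pol t)) {F D : (t : ℕ) → Hist Par 𝒳 t → ℝ≥0∞}
    (hF : ∀ t, Measurable (F t))
    (hD : ∀ t h, D t h + F t h ≤ ∫⁻ x, F (t + 1) (h.extend (pol t h, x))
      ∂S.episodeLaw (pol t h) (adv t h).x₀) (T : ℕ) :
    ∑ t ∈ Finset.range T, ∫⁻ h, D t h ∂S.histLaw adv pol t ≤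
      ∫⁻ h, F T h ∂S.histLaw adv pol T := by
  induction T with
  | zero => simp
  | succ T ih =>
    rw [Finset.sum_range_succ, lintegral_histLaw_succ hM hA hpol (hF (T + 1)), add_comm]
    refine (add_le_add le_rfl ih).trans ?_
    rw [← lintegral_add_right _ (hF T)]
    exact lintegral_mono fun h => hD T h

namespace Setting

variable (hS : Setting S adv Mstar L α Λmax C Vmax lam H)
include hS

theorem measurable_logA : Measurable fun h : Hist Par 𝒳 t => Real.log (S.detRatioA lam adv h) :=
  (measurable_detRatioA hS.lam_pos hS.fits hS.model hS.adversary hS.gauss).log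

theorem measurable_logB : Measurable fun h : Hist Par 𝒳 t => Real.log (S.detRatioB lam h) :=
  (measurable_detRatioB hS.lam_pos hS.model).log

theorem measurable_logA_extend {θ : Hist Par 𝒳 t → Par} (hθ : Measurable θ) :
    Measurable fun p : Hist Par 𝒳 t × (ℕ → ℕ → 𝒳) =>
      Real.log (S.detRatioA lam adv (p.1.extend (θ p.1, p.2))) :=
  hS.measurable_logA.comp
    (measurable_extend measurable_fst ((hθ.comp measurable_fst).prodMk measurable_snd))

theorem measurable_infoStep {θ : Hist Par 𝒳 t → Par} (hθ : Measurable θ) :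
    Measurable fun h => infoStep S lam adv h (θ h) :=
  measurable_lintegral_episode hS.model hS.adversary hθ
    (f := fun p => ENNReal.ofReal (2 * (Real.log (S.detRatioA lam adv (p.1.extend (θ p.1, p.2))) -
      Real.log (S.detRatioA lam adv p.1))))
    (((hS.measurable_logA_extend hθ).sub
      (hS.measurable_logA.comp measurable_fst)).const_mul 2).ennreal_ofReal

theorem measurable_infoNext {θ : Hist Par 𝒳 t → Par} (hθ : Measurable θ) :
    Measurable fun h => infoNext S lam adv h (θ h) :=
  measurable_lintegral_episode hS.model hS.adversary hθ
    (f := fun p => ENNReal.ofReal (2 * Real.log (S.detRatioA lam adv (p.1.extend (θ p.1, p.2)))))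
    ((hS.measurable_logA_extend hθ).const_mul 2).ennreal_ofReal

/-! #### Information gains -/

/-- The log-determinant grows along histories, so the gain at the final time covers earlier times.
-/
theorem lintegral_logA_le {pol : Policy Par 𝒳} (hpol : ∀ t, Measurable (pol t)) (htT : t ≤ T) :
    ∫⁻ h, ENNReal.ofReal (2 * Real.log (S.detRatioA lam adv h)) ∂S.histLaw adv pol t ≤
      S.gainA lam adv T := by
  refine (monotone_lintegral_histLaw (S := S) hS.model hS.adversary hpol
    (F := fun t h => ENNReal.ofReal (2 * Real.log (S.detRatioA lam adv h)))
    (fun t => (hS.measurable_logA.const_mul 2).ennreal_ofReal) (fun t h e => ?_) htT).trans ?_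
  · have := log_detRatioA_le_extend (S := S) hS.lam_pos hS.fits h e
    exact ENNReal.ofReal_le_ofReal (by linarith)
  · simp only [ENNReal.ofReal_mul zero_le_two, ENNReal.ofReal_ofNat]
    rw [lintegral_const_mul _ hS.measurable_logA.ennreal_ofReal, Model.gainA]
    gcongr
    exact le_iSup₂_of_le pol hpol le_rfl

theorem lintegral_logA_sq_le {pol : Policy Par 𝒳} (hpol : ∀ t, Measurable (pol t)) (htT : t ≤ T) :
    ∫⁻ h, ENNReal.ofReal (2 * Real.log (S.detRatioA lam adv h) ^ 2) ∂S.histLaw adv pol t ≤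
      S.gainA₂ lam adv T := by
  refine (monotone_lintegral_histLaw (S := S) hS.model hS.adversary hpol
    (F := fun t h => ENNReal.ofReal (2 * Real.log (S.detRatioA lam adv h) ^ 2))
    (fun t => ((hS.measurable_logA.pow_const 2).const_mul 2).ennreal_ofReal)
    (fun t h e => ?_) htT).trans ?_
  · have h1 := log_detRatioA_le_extend (S := S) hS.lam_pos hS.fits h e
    have h2 := hS.log_detRatioA_nonneg h
    refine ENNReal.ofReal_le_ofReal ?_
    gcongr
  · simp only [ENNReal.ofReal_mul zero_le_two, ENNReal.ofReal_ofNat]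
    rw [lintegral_const_mul _ (hS.measurable_logA.pow_const 2).ennreal_ofReal, Model.gainA₂]
    gcongr
    exact le_iSup₂_of_le pol hpol le_rfl

/-- The expected increments telescope. -/
theorem sum_lintegral_infoStep_le {pol : Policy Par 𝒳} (hpol : ∀ t, Measurable (pol t)) (T : ℕ) :
    ∑ t ∈ Finset.range T, ∫⁻ h, infoStep S lam adv h (pol t h) ∂S.histLaw adv pol t ≤
      S.gainA lam adv T := by
  refine (sum_lintegral_histLaw_le (S := S) hS.model hS.adversary hpol
    (F := fun t h => ENNReal.ofReal (2 * Real.log (S.detRatioA lam adv h)))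
    (D := fun t h => infoStep S lam adv h (pol t h))
    (fun t => (hS.measurable_logA.const_mul 2).ennreal_ofReal) (fun t h => ?_) T).trans
    (hS.lintegral_logA_le hpol le_rfl)
  have h1 : ENNReal.ofReal (2 * Real.log (S.detRatioA lam adv h)) =
      ∫⁻ _, ENNReal.ofReal (2 * Real.log (S.detRatioA lam adv h))
        ∂S.episodeLaw (pol t h) (adv t h).x₀ := by simp
  rw [h1, infoStep, ← lintegral_add_right _ measurable_const]
  refine lintegral_mono fun x => ?_
  have h2 := log_detRatioA_le_extend (S := S) hS.lam_pos hS.fits h (pol t h, x)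
  have h3 := hS.log_detRatioA_nonneg h
  rw [← ENNReal.ofReal_add (by linarith) (by linarith)]
  exact ENNReal.ofReal_le_ofReal (by linarith)

theorem sum_lintegral_stepB_le {pol : Policy Par 𝒳} (hpol : ∀ t, Measurable (pol t)) (T : ℕ) :
    ∑ t ∈ Finset.range T, ∫⁻ h, ENNReal.ofReal (min 1 (stepB S lam h (pol t h)))
      ∂S.histLaw adv pol t ≤ S.gainB lam adv T := by
  refine (sum_lintegral_histLaw_le (S := S) hS.model hS.adversary hpol
    (F := fun t h => ENNReal.ofReal (2 * Real.log (S.detRatioB lam h)))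
    (D := fun t h => ENNReal.ofReal (min 1 (stepB S lam h (pol t h))))
    (fun t => (hS.measurable_logB.const_mul 2).ennreal_ofReal) (fun t h => ?_) T).trans ?_
  · have h1 : ∀ a : ℝ≥0∞, a = ∫⁻ _, a ∂S.episodeLaw (pol t h) (adv t h).x₀ := by simp
    rw [h1 (_ + _)]
    refine lintegral_mono fun x => ?_
    have h2 := min_one_stepB_le (S := S) hS.lam_pos h (pol t h, x)
    have h3 := hS.log_detRatioB_nonneg h
    rw [← ENNReal.ofReal_add (le_min zero_le_one (stepB_nonneg hS.lam_pos _ _)) (by linarith)]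
    exact ENNReal.ofReal_le_ofReal (by simp only at h2; linarith)
  · simp only [ENNReal.ofReal_mul zero_le_two, ENNReal.ofReal_ofNat]
    rw [lintegral_const_mul _ hS.measurable_logB.ennreal_ofReal, Model.gainB]
    gcongr
    exact le_iSup₂_of_le pol hpol le_rfl

/-- Allows a one-episode deviation to `θ` after the same past. -/
theorem lintegral_infoNext_le {pol : Policy Par 𝒳} (hpol : ∀ t, Measurable (pol t)) (htT : t < T)
    {θ : Hist Par 𝒳 t → Par} (hθ : Measurable θ) :
    ∫⁻ h, infoNext S lam adv h (θ h) ∂S.histLaw adv pol t ≤ S.gainA lam adv T := by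
  -- The deviating algorithm has the same law of the first `t` episodes and still counts in the
  -- supremum that defines the gain.
  let pol' : Policy Par 𝒳 := Function.update pol t θ
  have h1 : ∀ s, Measurable (pol' s) := by
    intro s
    rcases eq_or_ne s t with rfl | hs
    · simpa [pol'] using hθ
    · simpa [pol', hs] using hpol s
  have h2 := hS.lintegral_logA_le h1 (Nat.succ_le_of_lt htT)
  rw [lintegral_histLaw_succ hS.model hS.adversary h1
    (hS.measurable_logA.const_mul 2).ennreal_ofReal] at h2
  rw [histLaw_congr (S := S) (adv := adv) (pol := pol) (pol' := pol') t fun s hs => by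
    simp [pol', hs.ne]]
  refine le_trans (le_of_eq (lintegral_congr fun h => ?_)) h2
  simp [pol', infoNext]

/-! #### The three parts of the regret -/

/-- Cauchy–Schwarz separates the random radius, whose second moment brings in γ₂, from the power of
the step information. Squaring turns the exponent α/2 into α, which is then linearized. -/
theorem lintegral_spectrum_le {pol : Policy Par 𝒳} (hpol : ∀ t, Measurable (pol t)) (htT : t ≤ T)
    (hA₂ : S.gainA₂ lam adv T ≠ ⊤)
    {η : ℝ} (hη : 0 < η) :
    ∫⁻ h, ENNReal.ofReal
      ((Λmax + L * (1 + 80 * (1 + C⁻¹) * S.σ ^ 2 *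
        (d + Real.log T + Real.log (S.detRatioA lam adv h)))) *
          min 1 (stepB S lam h (pol t h)) ^ (α / 2)) ∂S.histLaw adv pol t ≤
      ENNReal.ofReal (√(4 * Λmax ^ 2 + 4 * L ^ 2 + 4 * L ^ 2 * (80 * (1 + C⁻¹) * S.σ ^ 2) ^ 2 *
          ((d + Real.log T) ^ 2 + (S.gainA₂ lam adv T).toReal)) *
        √(η ^ α + η ^ (α - 1) * (∫⁻ h, ENNReal.ofReal (min 1 (stepB S lam h (pol t h)))
          ∂S.histLaw adv pol t).toReal)) := by
  have := isProbabilityMeasure_histLaw hS.model hS.adversary hpol t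
  set k := 80 * (1 + C⁻¹) * S.σ ^ 2 with hk
  have hC : 0 ≤ C⁻¹ := inv_nonneg.2 hS.C_pos.le
  have hk0 : 0 ≤ k := by positivity
  have hL := hS.L_nonneg
  have hΛ := hS.Λmax_nonneg
  have hT0 : 0 ≤ Real.log T := Real.log_natCast_nonneg T
  have hα := hS.α_pos
  have hw0 : ∀ h : Hist Par 𝒳 t, 0 ≤ min 1 (stepB S lam h (pol t h)) := fun h =>
    le_min zero_le_one (stepB_nonneg hS.lam_pos _ _)
  have hwm : Measurable fun h : Hist Par 𝒳 t => min 1 (stepB S lam h (pol t h)) :=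
    measurable_const.min (measurable_stepB hS.lam_pos hS.model (hpol t))
  have ha : ∀ h : Hist Par 𝒳 t, 0 ≤ Λmax + L * (1 + k *
      (d + Real.log T + Real.log (S.detRatioA lam adv h))) := by
    intro h
    have := hS.log_detRatioA_nonneg h
    positivity
  have ham : Measurable fun h : Hist Par 𝒳 t => Λmax + L * (1 + k *
      (d + Real.log T + Real.log (S.detRatioA lam adv h))) :=
    (((hS.measurable_logA.const_add _).const_mul k).const_add 1 |>.const_mul L).const_add Λmax
  have hCS := lintegral_mul_le_sqrt (S.histLaw adv pol t)
    (f := fun h => ENNReal.ofReal (Λmax + L * (1 + k *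
      (d + Real.log T + Real.log (S.detRatioA lam adv h)))))
    (g := fun h => ENNReal.ofReal (min 1 (stepB S lam h (pol t h)) ^ (α / 2)))
    ham.ennreal_ofReal.aemeasurable (hwm.pow_const _).ennreal_ofReal.aemeasurable
  simp only [ENNReal.ofReal_mul (ha _)]
  refine hCS.trans ?_
  rw [ENNReal.ofReal_mul (Real.sqrt_nonneg _), ← ofReal_rpow_half (by positivity),
    ← ofReal_rpow_half (by positivity)]
  gcongr
  · calc _ ≤ ∫⁻ h, (ENNReal.ofReal (4 * Λmax ^ 2 + 4 * L ^ 2 +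
          4 * L ^ 2 * k ^ 2 * (d + Real.log T) ^ 2) + ENNReal.ofReal (2 * L ^ 2 * k ^ 2) *
          ENNReal.ofReal (2 * Real.log (S.detRatioA lam adv h) ^ 2)) ∂S.histLaw adv pol t := by
          refine lintegral_mono fun h => ?_
          rw [← ENNReal.ofReal_pow (ha h), ← ENNReal.ofReal_mul (by positivity),
            ← ENNReal.ofReal_add (by positivity) (by positivity)]
          refine ENNReal.ofReal_le_ofReal ?_
          set l := Real.log (S.detRatioA lam adv h)
          -- This is (a + b + c)² ≤ 4a² + 4b² + 2c².
          have e1 : (Λmax + L * (1 + k * (d + Real.log T + l))) ^ 2 ≤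
              4 * Λmax ^ 2 + 4 * L ^ 2 + 2 * (L * k * (d + Real.log T + l)) ^ 2 := by
            nlinarith [sq_nonneg (Λmax - L), sq_nonneg (Λmax + L - L * k * (d + Real.log T + l))]
          have e2 : (L * k * (d + Real.log T + l)) ^ 2 ≤
              (L * k) ^ 2 * (2 * (d + Real.log T) ^ 2 + 2 * l ^ 2) := by
            rw [mul_pow]
            gcongr
            nlinarith [sq_nonneg (d + Real.log T - l)]
          nlinarith
      _ ≤ _ := by
          rw [lintegral_add_left measurable_const, lintegral_const, measure_univ, mul_one,
            lintegral_const_mul _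
              ((hS.measurable_logA.pow_const 2).const_mul 2).ennreal_ofReal]
          have e3 := hS.lintegral_logA_sq_le hpol htT
          rw [← ENNReal.ofReal_toReal hA₂] at e3
          refine (add_le_add le_rfl (mul_le_mul_right e3 _)).trans ?_
          rw [← ENNReal.ofReal_mul (by positivity),
            ← ENNReal.ofReal_add (by positivity) (by positivity)]
          refine ENNReal.ofReal_le_ofReal ?_
          have e4 : 0 ≤ L ^ 2 * k ^ 2 * (S.gainA₂ lam adv T).toReal := by positivity
          nlinarith
  · have hfin : ∫⁻ h, ENNReal.ofReal (min 1 (stepB S lam h (pol t h))) ∂S.histLaw adv pol t ≠ ⊤ := by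
      refine ((lintegral_mono fun h => ENNReal.ofReal_le_one.2 (min_le_left _ _)).trans_lt ?_).ne
      simp
    calc _ ≤ ∫⁻ h, (ENNReal.ofReal (η ^ α) + ENNReal.ofReal (η ^ (α - 1)) *
          ENNReal.ofReal (min 1 (stepB S lam h (pol t h)))) ∂S.histLaw adv pol t := by
          refine lintegral_mono fun h => ?_
          rw [← ENNReal.ofReal_pow (Real.rpow_nonneg (hw0 h) _), ← ENNReal.ofReal_mul
            (by positivity), ← ENNReal.ofReal_add (by positivity)
            (mul_nonneg (by positivity) (hw0 h))]
          refine ENNReal.ofReal_le_ofReal ?_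
          rw [← Real.rpow_natCast, ← Real.rpow_mul (hw0 h)]
          have : α / 2 * ((2 : ℕ) : ℝ) = α := by push_cast; ring
          rw [this]
          exact rpow_le_add_mul hα hS.α_le hη (hw0 h)
      _ = _ := by
          rw [lintegral_add_left measurable_const, lintegral_const, measure_univ, mul_one,
            lintegral_const_mul _ hwm.ennreal_ofReal, ENNReal.ofReal_add (by positivity)
              (by positivity), ENNReal.ofReal_mul (by positivity), ENNReal.ofReal_toReal hfin]

/-- The radius and the information step are correlated, so Cauchy–Schwarz is applied before their
means are bounded separately. -/
theorem lintegral_cost_le {pol : Policy Par 𝒳} (hpol : ∀ t, Measurable (pol t)) (htT : t < T)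
    (hA : S.gainA lam adv T ≠ ⊤) :
    ∫⁻ h, 2 * (ENNReal.ofReal Vmax ^ (1 / 2 : ℝ) * (5 * (ENNReal.ofReal
        (80 * (d + Real.log T + Real.log (S.detRatioA lam adv h)) + H) *
          infoStep S lam adv h (pol t h))) ^ (1 / 2 : ℝ)) ∂S.histLaw adv pol t ≤
      ENNReal.ofReal (2 * (√Vmax * (√5 *
        (√(80 * (d + Real.log T + (S.gainA lam adv T).toReal) + H) *
        √(∫⁻ h, infoStep S lam adv h (pol t h) ∂S.histLaw adv pol t).toReal)))) := by
  have := isProbabilityMeasure_histLaw hS.model hS.adversary hpol t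
  have hT0 : 0 ≤ Real.log T := Real.log_natCast_nonneg T
  have hfin : ∫⁻ h, infoStep S lam adv h (pol t h) ∂S.histLaw adv pol t ≠ ⊤ := by
    refine (lt_of_le_of_lt ?_ (lt_top_iff_ne_top.2 hA)).ne
    exact (Finset.single_le_sum (f := fun t => ∫⁻ h, infoStep S lam adv h (pol t h)
      ∂S.histLaw adv pol t) (fun _ _ => zero_le) (Finset.mem_range.2 htT)).trans
      (hS.sum_lintegral_infoStep_le hpol T)
  have hm1 : Measurable fun h : Hist Par 𝒳 t => ENNReal.ofReal
        (80 * (d + Real.log T + Real.log (S.detRatioA lam adv h)) + H) :=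
    (((hS.measurable_logA.const_add _).const_mul 80).add_const _).ennreal_ofReal
  have hm2 := hS.measurable_infoStep (hpol t)
  have hCS := lintegral_mul_le_sqrt (S.histLaw adv pol t)
    (f := fun h => ENNReal.ofReal
        (80 * (d + Real.log T + Real.log (S.detRatioA lam adv h)) + H) ^ (1 / 2 : ℝ))
    (g := fun h => infoStep S lam adv h (pol t h) ^ (1 / 2 : ℝ))
    (hm1.pow_const _).aemeasurable (hm2.pow_const _).aemeasurable
  simp only [rpow_half_sq] at hCS
  simp only [ENNReal.mul_rpow_of_nonneg _ _ (by norm_num : (0 : ℝ) ≤ 1 / 2)]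
  have hm3 : Measurable fun h : Hist Par 𝒳 t => ENNReal.ofReal
        (80 * (d + Real.log T + Real.log (S.detRatioA lam adv h)) + H) ^ (1 / 2 : ℝ) *
          infoStep S lam adv h (pol t h) ^ (1 / 2 : ℝ) :=
    (hm1.pow_const (1 / 2 : ℝ)).mul (hm2.pow_const (1 / 2 : ℝ))
  rw [lintegral_const_mul _ ((hm3.const_mul _).const_mul _),
    lintegral_const_mul _ (hm3.const_mul _), lintegral_const_mul _ hm3,
    ENNReal.ofReal_mul zero_le_two, ENNReal.ofReal_mul (Real.sqrt_nonneg _),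
    ENNReal.ofReal_mul (Real.sqrt_nonneg _), ENNReal.ofReal_mul (Real.sqrt_nonneg _),
    ← ofReal_rpow_half hS.V_pos.le, ← ofReal_rpow_half (by norm_num),
    ← ofReal_rpow_half (by positivity), ← ofReal_rpow_half (by positivity),
    ENNReal.ofReal_toReal hfin, ENNReal.ofReal_ofNat, ENNReal.ofReal_ofNat]
  gcongr 2 * (_ * (_ * ?_))
  refine hCS.trans ?_
  gcongr
  -- 80 log det is written as 40 (2 log det) to match the factor 2 in the gain.
  calc _ ≤ ∫⁻ h, (ENNReal.ofReal (80 * (d + Real.log T) + H) + 40 *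
        ENNReal.ofReal (2 * Real.log (S.detRatioA lam adv h))) ∂S.histLaw adv pol t := by
        refine lintegral_mono fun h => ?_
        have := hS.log_detRatioA_nonneg h
        rw [← ENNReal.ofReal_ofNat 40, ← ENNReal.ofReal_mul (by norm_num),
          ← ENNReal.ofReal_add (by positivity) (by positivity)]
        exact ENNReal.ofReal_le_ofReal (by linarith)
    _ ≤ _ := by
        rw [lintegral_add_left measurable_const, lintegral_const, measure_univ, mul_one,
          lintegral_const_mul _ (hS.measurable_logA.const_mul 2).ennreal_ofReal]
        have e3 := hS.lintegral_logA_le hpol htT.le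
        rw [← ENNReal.ofReal_toReal hA] at e3
        refine (add_le_add le_rfl (mul_le_mul_right e3 _)).trans ?_
        rw [← ENNReal.ofReal_ofNat 40, ← ENNReal.ofReal_mul (by norm_num),
          ← ENNReal.ofReal_add (by positivity) (by positivity)]
        refine ENNReal.ofReal_le_ofReal ?_
        have : 0 ≤ (S.gainA lam adv T).toReal := ENNReal.toReal_nonneg
        linarith

/-- Cauchy–Schwarz against the indicator of the failure event: the square root of its probability
multiplies the root of an expected information. -/
theorem lintegral_bad_le {pol : Policy Par 𝒳} (hpol : ∀ t, Measurable (pol t)) (htT : t < T)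
    (hA : S.gainA lam adv T ≠ ⊤) {θ : Hist Par 𝒳 t → Par} (hθ : Measurable θ)
    {B : Set (Hist Par 𝒳 t)} (hB : MeasurableSet B) {p : ℝ} (hp : 0 ≤ p)
    (hBp : S.histLaw adv pol t B ≤ ENNReal.ofReal p) :
    ∫⁻ h, B.indicator (fun h => ENNReal.ofReal Λmax +
      2 * (ENNReal.ofReal Vmax ^ (1 / 2 : ℝ) * (10 * (ENNReal.ofReal (d + H) *
        (infoNext S lam adv h (pol t h) + infoNext S lam adv h (θ h)))) ^ (1 / 2 : ℝ))) h
        ∂S.histLaw adv pol t ≤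
      ENNReal.ofReal (Λmax * p + 2 * (√Vmax * (√p *
        √(20 * ((d + H) * (S.gainA lam adv T).toReal))))) := by
  have := isProbabilityMeasure_histLaw hS.model hS.adversary hpol t
  have hΛ := hS.Λmax_nonneg
  set g : Hist Par 𝒳 t → ℝ≥0∞ := fun h => 10 * (ENNReal.ofReal (d + H) *
        (infoNext S lam adv h (pol t h) + infoNext S lam adv h (θ h))) with hg
  have hgm : Measurable g :=
    (((hS.measurable_infoNext (hpol t)).add (hS.measurable_infoNext hθ)).const_mul _).const_mul _
  have hCS := lintegral_mul_le_sqrt (S.histLaw adv pol t)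
    (f := B.indicator 1) (g := fun h => g h ^ (1 / 2 : ℝ))
    (measurable_one.indicator hB).aemeasurable (hgm.pow_const _).aemeasurable
  simp only [rpow_half_sq] at hCS
  have e1 : ∀ h, B.indicator (1 : Hist Par 𝒳 t → ℝ≥0∞) h ^ 2 = B.indicator 1 h := by
    intro h
    by_cases hh : h ∈ B <;> simp [hh]
  have e2 : ∀ h, B.indicator (fun h => ENNReal.ofReal Λmax +
      2 * (ENNReal.ofReal Vmax ^ (1 / 2 : ℝ) * g h ^ (1 / 2 : ℝ))) h =
      ENNReal.ofReal Λmax * B.indicator 1 h +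
      2 * (ENNReal.ofReal Vmax ^ (1 / 2 : ℝ) * (B.indicator 1 h * g h ^ (1 / 2 : ℝ))) := by
    intro h
    by_cases hh : h ∈ B <;> simp [hh]
  simp only [e1] at hCS
  rw [lintegral_indicator_one hB] at hCS
  have hm1 : Measurable fun h => B.indicator (1 : Hist Par 𝒳 t → ℝ≥0∞) h * g h ^ (1 / 2 : ℝ) :=
    (measurable_one.indicator hB).mul (hgm.pow_const _)
  refine (le_of_eq (lintegral_congr e2)).trans ?_
  rw [lintegral_add_left ((measurable_one.indicator hB).const_mul _),
    lintegral_const_mul _ (measurable_one.indicator hB), lintegral_indicator_one hB,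
    lintegral_const_mul _ (hm1.const_mul _), lintegral_const_mul _ hm1,
    ENNReal.ofReal_add (by positivity) (by positivity), ENNReal.ofReal_mul hΛ,
    ENNReal.ofReal_mul zero_le_two, ENNReal.ofReal_mul (Real.sqrt_nonneg _),
    ENNReal.ofReal_mul (Real.sqrt_nonneg _),
    ← ofReal_rpow_half hS.V_pos.le, ← ofReal_rpow_half hp,
    ← ofReal_rpow_half (by positivity), ENNReal.ofReal_ofNat]
  gcongr _ * ?_ + 2 * (_ * ?_)
  refine hCS.trans ?_
  gcongr
  have hm2 : Measurable fun h => infoNext S lam adv h (pol t h) + infoNext S lam adv h (θ h) :=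
    (hS.measurable_infoNext (hpol t)).add (hS.measurable_infoNext hθ)
  simp only [hg]
  rw [lintegral_const_mul _ (hm2.const_mul _), lintegral_const_mul _ hm2,
    lintegral_add_left (hS.measurable_infoNext (hpol t))]
  have e3 := hS.lintegral_infoNext_le hpol htT (hpol t)
  have e4 := hS.lintegral_infoNext_le hpol htT hθ
  rw [← ENNReal.ofReal_toReal hA] at e3 e4
  calc _ ≤ 10 * (ENNReal.ofReal (d + H) * (ENNReal.ofReal (S.gainA lam adv T).toReal +
        ENNReal.ofReal (S.gainA lam adv T).toReal)) := by gcongr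
    _ = _ := by
      rw [← ENNReal.ofReal_add (by positivity) (by positivity), ← ENNReal.ofReal_mul
        (by positivity), ← ENNReal.ofReal_ofNat 10, ← ENNReal.ofReal_mul (by norm_num)]
      congr 1
      ring

/-- The expected regret of one episode of the algorithm. -/
theorem lintegral_value_le {pol : Policy Par 𝒳} (hKS : S.IsKSLC3 lam adv pol T) (htT : t < T)
    (hA : S.gainA lam adv T ≠ ⊤) (hA₂ : S.gainA₂ lam adv T ≠ ⊤) {η ε : ℝ} (hη : 0 < η)
    (hε : 0 < ε) :
    ∫⁻ h, value S (pol t h) (adv t h) ∂S.histLaw adv pol t ≤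
      ∫⁻ h, S.optValue (adv t h) ∂S.histLaw adv pol t + ENNReal.ofReal (
      √(4 * Λmax ^ 2 + 4 * L ^ 2 + 4 * L ^ 2 * (80 * (1 + C⁻¹) * S.σ ^ 2) ^ 2 *
          ((d + Real.log T) ^ 2 + (S.gainA₂ lam adv T).toReal)) *
        √(η ^ α + η ^ (α - 1) * (∫⁻ h, ENNReal.ofReal (min 1 (stepB S lam h (pol t h)))
          ∂S.histLaw adv pol t).toReal) +
      2 * (√Vmax * (√5 * (√(80 * (d + Real.log T + (S.gainA lam adv T).toReal) + H) *
        √(∫⁻ h, infoStep S lam adv h (pol t h) ∂S.histLaw adv pol t).toReal))) +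
      (Λmax * ((max 1 t : ℕ) : ℝ)⁻¹ + 2 * (√Vmax * (√((max 1 t : ℕ) : ℝ)⁻¹ *
        √(20 * ((d + H) * (S.gainA lam adv T).toReal))))) + ε) := by
  obtain ⟨hpol, Mhat, hMhat⟩ := hKS
  have : Nonempty Par := ⟨pol 0 Fin.elim0⟩
  have := isProbabilityMeasure_histLaw hS.model hS.adversary hpol t
  have hT0 : 0 ≤ Real.log T := Real.log_natCast_nonneg T
  have hε' : ENNReal.ofReal ε ≠ 0 := (ENNReal.ofReal_pos.2 hε).ne'
  -- The infimum need not be attained, and the comparator must be measurable to be playable by an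
  -- algorithm; hence the loss ε.
  obtain ⟨sel, hsel, hsel'⟩ := hS.exists_selection hε' t
  -- Episode 0 has no ellipsoid and is counted as a failure, which explains the probability 1 /
  -- max(1, t).
  let B : Set (Hist Par 𝒳 t) := {h | t = 0 ∨ (t : ℝ≥0∞) < histSelfNorm S lam Mstar adv H h}
  have hWm := measurable_histSelfNorm (S := S) (t := t) hS.lam_pos hS.fits hS.model hS.adversary
    hS.gauss Mstar
  have hB : MeasurableSet B :=
    (MeasurableSet.const _).union (measurableSet_lt measurable_const hWm)
  have hBp : S.histLaw adv pol t B ≤ ENNReal.ofReal ((max 1 t : ℕ) : ℝ)⁻¹ := by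
    rcases eq_or_ne t 0 with rfl | ht
    · simpa using prob_le_one
    · have h1 := histLaw_lt_histSelfNorm_le (S := S) (adv := adv) hS.lam_pos hS.fits hS.model
        hS.adversary hS.σ_pos hS.gauss hS.koopman hS.represents hpol t
      have h2 : B = {h | (t : ℝ≥0∞) < histSelfNorm S lam Mstar adv H h} := by
        ext h; simp [B, ht]
      rw [h2, max_eq_right (Nat.one_le_iff_ne_zero.2 ht), ENNReal.ofReal_inv_of_pos
        (by exact_mod_cast Nat.pos_of_ne_zero ht), ENNReal.ofReal_natCast]
      exact h1
  let g1 : Hist Par 𝒳 t → ℝ≥0∞ := fun h => ENNReal.ofReal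
      ((Λmax + L * (1 + 80 * (1 + C⁻¹) * S.σ ^ 2 *
        (d + Real.log T + Real.log (S.detRatioA lam adv h)))) *
          min 1 (stepB S lam h (pol t h)) ^ (α / 2))
  let g2 : Hist Par 𝒳 t → ℝ≥0∞ := fun h =>
      2 * (ENNReal.ofReal Vmax ^ (1 / 2 : ℝ) * (5 * (ENNReal.ofReal
        (80 * (d + Real.log T + Real.log (S.detRatioA lam adv h)) + H) *
          infoStep S lam adv h (pol t h))) ^ (1 / 2 : ℝ))
  let g3 : Hist Par 𝒳 t → ℝ≥0∞ := B.indicator fun h => ENNReal.ofReal Λmax +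
      2 * (ENNReal.ofReal Vmax ^ (1 / 2 : ℝ) * (10 * (ENNReal.ofReal (d + H) *
        (infoNext S lam adv h (pol t h) + infoNext S lam adv h (sel h)))) ^ (1 / 2 : ℝ))
  have hwm : Measurable fun h : Hist Par 𝒳 t => min 1 (stepB S lam h (pol t h)) :=
    measurable_const.min (measurable_stepB hS.lam_pos hS.model (hpol t))
  have m1 : Measurable g1 := by
    refine Measurable.ennreal_ofReal (Measurable.mul ?_ (hwm.pow_const _))
    exact (((hS.measurable_logA.const_add _).const_mul _).const_add 1 |>.const_mul L).const_add Λmax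
  have m2 : Measurable g2 := by
    refine Measurable.const_mul (Measurable.const_mul (Measurable.pow_const (Measurable.const_mul
      (Measurable.mul ?_ (hS.measurable_infoStep (hpol t))) _) _) _) _
    exact (((hS.measurable_logA.const_add _).const_mul 80).add_const _).ennreal_ofReal
  have m3 : Measurable g3 := by
    refine Measurable.indicator (Measurable.const_add (Measurable.const_mul (Measurable.const_mul
      (Measurable.pow_const (Measurable.const_mul (Measurable.const_mul ?_ _) _) _) _) _) _) hB
    exact (hS.measurable_infoNext (hpol t)).add (hS.measurable_infoNext hsel)
  have key : ∀ᵐ h ∂S.histLaw adv pol t, value S (pol t h) (adv t h) ≤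
      S.optValue (adv t h) + (g1 h + g2 h + g3 h + ENNReal.ofReal ε) := by
    filter_upwards [hMhat t htT, ae_feat_initial hS.model hS.adversary hS.gauss hpol t] with h h1 h0
    by_cases hh : h ∈ B
    · refine (hS.value_le_of_bad h (pol t h) (sel h) (hsel' h)).trans ?_
      refine add_le_add le_rfl ?_
      rw [add_assoc, add_comm (ENNReal.ofReal ε)]
      refine add_le_add (le_add_of_nonneg_of_le zero_le ?_) le_rfl
      simp only [g3]
      rw [Set.indicator_of_mem hh]
    · have hh' : ¬(t = 0 ∨ (t : ℝ≥0∞) < histSelfNorm S lam Mstar adv H h) := hh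
      rw [not_or, not_lt] at hh'
      have hne : (S.ball lam adv h).Nonempty := ⟨Mstar, (mem_ball_of_histSelfNorm_le hS.lam_pos
        hS.fits hS.σ_pos hS.lam_le hS.mem_ball hh'.1 h hh'.2).1⟩
      obtain ⟨h2, h3⟩ := h1 hne
      refine (hS.value_le_of_good hh'.1 htT.le h hh'.2 h0 h2 h3).trans ?_
      refine add_le_add le_rfl ?_
      rw [add_assoc (g1 h + g2 h)]
      exact le_self_add
  refine (lintegral_mono_ae key).trans ?_
  rw [lintegral_add_left hS.measurable_optValue, lintegral_add_right _ measurable_const,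
    lintegral_add_right _ m3, lintegral_add_right _ m2, lintegral_const, measure_univ, mul_one]
  have hVs := Real.sqrt_nonneg Vmax
  have hΛ := hS.Λmax_nonneg
  have hη' := Real.rpow_nonneg hη.le α
  rw [ENNReal.ofReal_add (by positivity) hε.le, ENNReal.ofReal_add (by positivity) (by positivity),
    ENNReal.ofReal_add (by positivity) (by positivity)]
  gcongr
  · exact hS.lintegral_spectrum_le hpol htT.le hA₂ hη
  · exact hS.lintegral_cost_le hpol htT hA
  · exact hS.lintegral_bad_le hpol htT hA hsel hB (by positivity) hBp

end Setting

end Expect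

/-! ### The regret bound -/

theorem sum_sqrt_le (T : ℕ) {a : ℕ → ℝ} (ha : ∀ t, 0 ≤ a t) :
    ∑ t ∈ Finset.range T, √(a t) ≤ √(T * ∑ t ∈ Finset.range T, a t) := by
  have h := Real.sum_sqrt_mul_sqrt_le (Finset.range T) (f := fun _ => (1 : ℝ)) (g := a)
    (fun _ => zero_le_one) ha
  rw [Real.sqrt_mul (Nat.cast_nonneg T)]
  simpa using h

theorem sum_sqrt_inv_le (T : ℕ) :
    ∑ t ∈ Finset.range T, √((max 1 t : ℕ) : ℝ)⁻¹ ≤ 3 * √T := by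
  induction T with
  | zero => simp
  | succ T ih =>
    rw [Finset.sum_range_succ]
    rcases Nat.eq_zero_or_pos T with rfl | hT
    · simp
    · rw [max_eq_right hT, Real.sqrt_inv]
      have hT' : (1 : ℝ) ≤ T := by exact_mod_cast hT
      have h1 : 0 < √(T : ℝ) := Real.sqrt_pos.2 (by linarith)
      have h2 : √((T + 1 : ℕ) : ℝ) ^ 2 = T + 1 := by
        rw [Real.sq_sqrt (by positivity)]; push_cast; ring
      have h3 : √(T : ℝ) ^ 2 = T := Real.sq_sqrt (by linarith)
      have h4 : √((T + 1 : ℕ) : ℝ) ≤ 2 * √(T : ℝ) := by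
        refine Real.sqrt_le_iff.2 ⟨by positivity, ?_⟩
        rw [mul_pow, h3]; push_cast; linarith
      -- From √(T+1) ≤ 2√T, as (√(T+1) - √T)(√(T+1) + √T) = 1 and the second factor is at most 3√T.
      have h5 : (√(T : ℝ))⁻¹ ≤ 3 * (√((T + 1 : ℕ) : ℝ) - √(T : ℝ)) := by
        rw [inv_le_iff_one_le_mul₀ h1]
        have h6 : √(T : ℝ) ≤ √((T + 1 : ℕ) : ℝ) := Real.sqrt_le_sqrt (by push_cast; linarith)
        nlinarith
      linarith

/-- The choice η = (1 + γ)/T balances T η^α against η^(α-1) γ; both are at most η^(α-1)(1 + γ), and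
η^(α-1) ≤ T^(1-α). -/
theorem spectrum_sum_le {α γ w : ℝ} (hα1 : α ≤ 1) (hγ : 0 ≤ γ) {T : ℕ} (hT : 0 < T)
    (hw : w ≤ γ) :
    √(T * (T * ((1 + γ) / T) ^ α + ((1 + γ) / T) ^ (α - 1) * w)) ≤
      √(2 * (1 + γ)) * (T : ℝ) ^ (1 - α / 2) := by
  have hT' : (0 : ℝ) < T := by exact_mod_cast hT
  set η := (1 + γ) / T with hη
  have hη0 : 0 < η := by positivity
  have h1 : (T : ℝ) * (T * η ^ α + η ^ (α - 1) * w) ≤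
      2 * (1 + γ) * ((T : ℝ) ^ (1 - α / 2)) ^ 2 := by
    have e1 : η ^ α = η ^ (α - 1) * η := by
      rw [← Real.rpow_add_one hη0.ne', sub_add_cancel]
    have e2 : (T : ℝ) * η = 1 + γ := by rw [hη]; field_simp
    have e3 : 0 ≤ η ^ (α - 1) := Real.rpow_nonneg hη0.le _
    have e4 : (T : ℝ) * η ^ α + η ^ (α - 1) * w ≤ η ^ (α - 1) * (2 * (1 + γ)) := by
      have : (T : ℝ) * η ^ α = η ^ (α - 1) * (1 + γ) := by rw [e1, ← e2]; ring
      rw [this]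
      nlinarith
    have e5 : η ^ (α - 1) ≤ (T : ℝ) ^ (1 - α) := by
      rw [hη, div_eq_mul_inv, Real.mul_rpow (by positivity) (by positivity),
        Real.inv_rpow hT'.le, ← Real.rpow_neg hT'.le, neg_sub]
      have : (1 + γ) ^ (α - 1) ≤ 1 := Real.rpow_le_one_of_one_le_of_nonpos (by linarith)
        (by linarith)
      exact mul_le_of_le_one_left (by positivity) this
    have e6 : (T : ℝ) * (T : ℝ) ^ (1 - α) = ((T : ℝ) ^ (1 - α / 2)) ^ 2 := by
      rw [← Real.rpow_natCast, ← Real.rpow_mul hT'.le, mul_comm, ← Real.rpow_add_one hT'.ne']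
      congr 1
      push_cast
      ring
    calc _ ≤ (T : ℝ) * (η ^ (α - 1) * (2 * (1 + γ))) := by gcongr
      _ ≤ (T : ℝ) * ((T : ℝ) ^ (1 - α) * (2 * (1 + γ))) := by gcongr
      _ = _ := by rw [← e6]; ring
  calc _ ≤ √(2 * (1 + γ) * ((T : ℝ) ^ (1 - α / 2)) ^ 2) := Real.sqrt_le_sqrt h1
    _ = _ := by rw [Real.sqrt_mul (by positivity), Real.sqrt_sq (by positivity)]

theorem betaTilde₁_nonneg {σ : ℝ} {d T : ℕ} {γA : ℝ} (hA : 0 ≤ γA) : 0 ≤ betaTilde₁ σ d T γA := by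
  have := Real.log_natCast_nonneg T
  unfold betaTilde₁
  positivity

/-- Here 25600 = 4 · 80², and 2 · 25600 ≤ 230². -/
theorem spectrum_const_le {σ L Λmax C γA γA₂ γB : ℝ} {d T : ℕ} (hL : 0 ≤ L) (hΛ : 0 ≤ Λmax)
    (hC : 0 < C) (hA : 0 ≤ γA) (hA₂ : 0 ≤ γA₂) (hB : 0 ≤ γB) :
    √(4 * Λmax ^ 2 + 4 * L ^ 2 + 4 * L ^ 2 * (80 * (1 + C⁻¹) * σ ^ 2) ^ 2 *
      ((d + Real.log T) ^ 2 + γA₂)) * √(2 * (1 + γB)) ≤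
      230 * dTilde₁ σ d T L Λmax C γA γA₂ γB := by
  have hl := Real.log_natCast_nonneg T
  have hC' : 0 < C⁻¹ := inv_pos.2 hC
  rw [← Real.sqrt_mul (by positivity)]
  refine Real.sqrt_le_iff.2 ⟨mul_nonneg (by norm_num) (Real.sqrt_nonneg _), ?_⟩
  have hb := betaTilde₁_nonneg (σ := σ) (d := d) (T := T) hA
  have e1 : (0 : ℝ) ≤ (L ^ 2 + Λmax * L) * (1 + C⁻¹) * betaTilde₁ σ d T γA := by positivity
  have e2 : (d + Real.log T) ^ 2 ≤ (d + Real.log T + γA) ^ 2 := by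
    exact pow_le_pow_left₀ (by positivity) (by linarith) 2
  have e3 : L ^ 2 * (1 + C⁻¹) ^ 2 * (σ ^ 4 * ((d + Real.log T) ^ 2 + γA₂)) ≤
      L ^ 2 * (1 + C⁻¹) ^ 2 * betaTilde₂ σ d T γA γA₂ := by
    unfold betaTilde₂
    gcongr
  have e0 : 0 ≤ L ^ 2 * (1 + C⁻¹) ^ 2 * (σ ^ 4 * ((d + Real.log T) ^ 2 + γA₂)) := by positivity
  have e4 : 4 * Λmax ^ 2 + 4 * L ^ 2 + 4 * L ^ 2 * (80 * (1 + C⁻¹) * σ ^ 2) ^ 2 *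
      ((d + Real.log T) ^ 2 + γA₂) ≤ 25600 * (L ^ 2 * (1 + C⁻¹) ^ 2 * betaTilde₂ σ d T γA γA₂ +
      (L ^ 2 + Λmax * L) * (1 + C⁻¹) * betaTilde₁ σ d T γA + Λmax ^ 2 + L ^ 2) := by
    have : 4 * L ^ 2 * (80 * (1 + C⁻¹) * σ ^ 2) ^ 2 * ((d + Real.log T) ^ 2 + γA₂) =
      25600 * (L ^ 2 * (1 + C⁻¹) ^ 2 * (σ ^ 4 * ((d + Real.log T) ^ 2 + γA₂))) := by ring
    rw [this]
    nlinarith [sq_nonneg Λmax, sq_nonneg L]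
  set D := L ^ 2 * (1 + C⁻¹) ^ 2 * betaTilde₂ σ d T γA γA₂ +
      (L ^ 2 + Λmax * L) * (1 + C⁻¹) * betaTilde₁ σ d T γA + Λmax ^ 2 + L ^ 2
  have hD : 0 ≤ D := by
    have := e0.trans e3
    positivity
  have e5 : (230 * dTilde₁ σ d T L Λmax C γA γA₂ γB) ^ 2 = 230 ^ 2 * ((1 + γB) * D) := by
    rw [mul_pow, dTilde₁, Real.sq_sqrt (mul_nonneg (by linarith) hD)]
  rw [e5]
  calc _ ≤ 25600 * D * (2 * (1 + γB)) := by gcongr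
    _ ≤ _ := by nlinarith [mul_nonneg hD (by linarith : 0 ≤ 1 + γB)]

theorem le_dTilde₁ {σ L Λmax C γA γA₂ γB : ℝ} {d T : ℕ} (hL : 0 ≤ L) (hΛ : 0 ≤ Λmax)
    (hC : 0 < C) (hA : 0 ≤ γA) (hA₂ : 0 ≤ γA₂) (hB : 0 ≤ γB) :
    Λmax ≤ dTilde₁ σ d T L Λmax C γA γA₂ γB := by
  have hC' : 0 < C⁻¹ := inv_pos.2 hC
  refine Real.le_sqrt_of_sq_le ?_
  have hb := betaTilde₁_nonneg (σ := σ) (d := d) (T := T) hA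
  have e1 : (0 : ℝ) ≤ (L ^ 2 + Λmax * L) * (1 + C⁻¹) * betaTilde₁ σ d T γA := by positivity
  have e2 : 0 ≤ L ^ 2 * (1 + C⁻¹) ^ 2 * betaTilde₂ σ d T γA γA₂ := by
    unfold betaTilde₂; positivity
  set X := L ^ 2 * (1 + C⁻¹) ^ 2 * betaTilde₂ σ d T γA γA₂ +
      (L ^ 2 + Λmax * L) * (1 + C⁻¹) * betaTilde₁ σ d T γA + Λmax ^ 2 + L ^ 2
  have hX : Λmax ^ 2 ≤ X := by simp only [X]; nlinarith [sq_nonneg L]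
  nlinarith [sq_nonneg Λmax]

/-- The constants combine as 5 · 80 = 20², doubled to 40; the factor `H` of `dTilde₂` is gained for
free. -/
theorem cost_const_le {V γA D : ℝ} {d T H : ℕ} (hV : 0 < V) (hA : 0 ≤ γA) (hH : 0 < H)
    (hD : D ≤ T * γA) :
    2 * (√V * (√5 * (√(80 * (d + Real.log T + γA) + H) * √D))) ≤
      40 * dTilde₂ d T H V γA * √T := by
  have hl := Real.log_natCast_nonneg T
  have hH' : (1 : ℝ) ≤ H := by exact_mod_cast hH
  have e1 : √D ≤ √(T * γA) := Real.sqrt_le_sqrt hD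
  have e2 : √(80 * (d + Real.log T + γA) + H) ≤ √(80 * (γA + d + Real.log T + H)) :=
    Real.sqrt_le_sqrt (by linarith)
  calc _ ≤ 2 * (√V * (√5 * (√(80 * (γA + d + Real.log T + H)) * √(T * γA)))) := by gcongr
    _ = 40 * (√(γA * V * (γA + d + Real.log T + H)) * √T) := by
        rw [← Real.sqrt_mul (by positivity), ← Real.sqrt_mul (by positivity),
          ← Real.sqrt_mul hV.le, ← Real.sqrt_mul (by positivity)]
        have : V * (5 * (80 * (γA + d + Real.log T + H) * (T * γA))) =
            20 ^ 2 * (γA * V * (γA + d + Real.log T + H) * T) := by ring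
        rw [this, Real.sqrt_mul (by positivity), Real.sqrt_sq (by norm_num)]
        ring
    _ ≤ 40 * (dTilde₂ d T H V γA * √T) := by
        unfold dTilde₂
        gcongr
        nlinarith
    _ = _ := by ring

/-- Uses 20 ≤ (9/2)². -/
theorem bad_const_le {V γA : ℝ} {d T H : ℕ} (hV : 0 < V) (hA : 0 ≤ γA) (hH : 0 < H) :
    2 * (√V * √(20 * ((d + H) * γA))) ≤ 9 * dTilde₂ d T H V γA := by
  have hl := Real.log_natCast_nonneg T
  have hH' : (1 : ℝ) ≤ H := by exact_mod_cast hH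
  rw [← Real.sqrt_mul hV.le]
  have e1 : √(V * (20 * ((d + H) * γA))) ≤ 9 / 2 * dTilde₂ d T H V γA := by
    refine Real.sqrt_le_iff.2 ⟨mul_nonneg (by norm_num) (Real.sqrt_nonneg _), ?_⟩
    rw [dTilde₂, mul_pow, Real.sq_sqrt (by positivity)]
    have e2 : γA * V * (d + H) ≤ γA * H * V * (γA + d + Real.log T + H) := by
      gcongr
      · nlinarith
      · linarith
    have e3 : 0 ≤ γA * V * (d + H) := by positivity
    nlinarith
  linarith

/-- The per-episode bounds add up. -/
theorem sum_episode_bounds_le {σ L α Λmax C V γA γA₂ γB δ : ℝ} {d T H : ℕ} (hL : 0 ≤ L)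
    (hα1 : α ≤ 1) (hΛ : 0 ≤ Λmax) (hC : 0 < C) (hV : 0 < V) (hH : 0 < H) (hA : 0 ≤ γA)
    (hA₂ : 0 ≤ γA₂) (hB : 0 ≤ γB) (hT : 0 < T) {w D : ℕ → ℝ} (hw0 : ∀ t, 0 ≤ w t)
    (hD0 : ∀ t, 0 ≤ D t) (hw : ∑ t ∈ Finset.range T, w t ≤ γB)
    (hD : ∑ t ∈ Finset.range T, D t ≤ γA) :
    ∑ t ∈ Finset.range T, (√(4 * Λmax ^ 2 + 4 * L ^ 2 + 4 * L ^ 2 *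
          (80 * (1 + C⁻¹) * σ ^ 2) ^ 2 * ((d + Real.log T) ^ 2 + γA₂)) *
            √(((1 + γB) / T) ^ α + ((1 + γB) / T) ^ (α - 1) * w t) +
        2 * (√V * (√5 * (√(80 * (d + Real.log T + γA) + H) * √(D t)))) +
        (Λmax * ((max 1 t : ℕ) : ℝ)⁻¹ + 2 * (√V * (√((max 1 t : ℕ) : ℝ)⁻¹ *
        √(20 * ((d + H) * γA))))) + δ / T) ≤
      300 * (dTilde₁ σ d T L Λmax C γA γA₂ γB + dTilde₂ d T H V γA) * (T : ℝ) ^ (1 - α / 2) + δ := by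
  have hT' : (1 : ℝ) ≤ T := by exact_mod_cast hT
  set D₁ := dTilde₁ σ d T L Λmax C γA γA₂ γB with hD₁
  set D₂ := dTilde₂ d T H V γA with hD₂
  have hD₁0 : 0 ≤ D₁ := Real.sqrt_nonneg _
  have hD₂0 : 0 ≤ D₂ := Real.sqrt_nonneg _
  set η := (1 + γB) / T with hη
  have hη0 : 0 < η := by positivity
  have hηα : 0 ≤ η ^ α := Real.rpow_nonneg hη0.le _
  have hηα1 : 0 ≤ η ^ (α - 1) := Real.rpow_nonneg hη0.le _
  have hTp : 0 ≤ (T : ℝ) ^ (1 - α / 2) := by positivity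
  have hTα : √(T : ℝ) ≤ (T : ℝ) ^ (1 - α / 2) := by
    rw [Real.sqrt_eq_rpow]
    exact Real.rpow_le_rpow_of_exponent_le hT' (by linarith)
  have t1 := spectrum_const_le (σ := σ) (d := d) (T := T) hL hΛ hC hA hA₂ hB
  rw [← hD₁] at t1
  set P := √(4 * Λmax ^ 2 + 4 * L ^ 2 + 4 * L ^ 2 * (80 * (1 + C⁻¹) * σ ^ 2) ^ 2 *
          ((d + Real.log T) ^ 2 + γA₂)) with hP
  have hP0 : 0 ≤ P := Real.sqrt_nonneg _
  have t1' : P * ∑ t ∈ Finset.range T, √(η ^ α + η ^ (α - 1) * w t) ≤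
      230 * D₁ * (T : ℝ) ^ (1 - α / 2) := by
    have e1 : ∑ t ∈ Finset.range T, √(η ^ α + η ^ (α - 1) * w t) ≤
        √(2 * (1 + γB)) * (T : ℝ) ^ (1 - α / 2) := by
      refine (sum_sqrt_le T fun t => add_nonneg hηα (mul_nonneg hηα1 (hw0 t))).trans ?_
      rw [Finset.sum_add_distrib, ← Finset.mul_sum, Finset.sum_const, Finset.card_range,
        nsmul_eq_mul]
      exact spectrum_sum_le hα1 hB hT hw
    calc _ ≤ P * (√(2 * (1 + γB)) * (T : ℝ) ^ (1 - α / 2)) :=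
          mul_le_mul_of_nonneg_left e1 hP0
      _ = P * √(2 * (1 + γB)) * (T : ℝ) ^ (1 - α / 2) := by ring
      _ ≤ _ := mul_le_mul_of_nonneg_right t1 hTp
  have t2 : 2 * (√V * (√5 * (√(80 * (d + Real.log T + γA) + H) *
      ∑ t ∈ Finset.range T, √(D t)))) ≤ 40 * D₂ * (T : ℝ) ^ (1 - α / 2) := by
    calc _ ≤ 2 * (√V * (√5 * (√(80 * (d + Real.log T + γA) + H) *
          √(T * ∑ t ∈ Finset.range T, D t)))) := by
          have := sum_sqrt_le T hD0
          gcongr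
      _ ≤ 40 * D₂ * √T := cost_const_le hV hA hH (by gcongr)
      _ ≤ _ := by gcongr
  have hs : ∑ t ∈ Finset.range T, √((max 1 t : ℕ) : ℝ)⁻¹ ≤ 3 * (T : ℝ) ^ (1 - α / 2) :=
    (sum_sqrt_inv_le T).trans (by gcongr)
  have hs' : ∑ t ∈ Finset.range T, ((max 1 t : ℕ) : ℝ)⁻¹ ≤
      ∑ t ∈ Finset.range T, √((max 1 t : ℕ) : ℝ)⁻¹ := by
    refine Finset.sum_le_sum fun t _ => Real.le_sqrt_of_sq_le ?_
    have h1 : (1 : ℝ) ≤ ((max 1 t : ℕ) : ℝ) := by exact_mod_cast le_max_left 1 t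
    have h2 : ((max 1 t : ℕ) : ℝ)⁻¹ ≤ 1 := inv_le_one_of_one_le₀ h1
    exact pow_le_of_le_one (by positivity) h2 two_ne_zero
  have t3 : Λmax * ∑ t ∈ Finset.range T, ((max 1 t : ℕ) : ℝ)⁻¹ ≤
      3 * D₁ * (T : ℝ) ^ (1 - α / 2) := by
    calc _ ≤ D₁ * (3 * (T : ℝ) ^ (1 - α / 2)) :=
          mul_le_mul (le_dTilde₁ hL hΛ hC hA hA₂ hB) (hs'.trans hs) (by positivity) hD₁0
      _ = _ := by ring
  have t4 : 2 * (√V * ((∑ t ∈ Finset.range T, √((max 1 t : ℕ) : ℝ)⁻¹) *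
      √(20 * ((d + H) * γA)))) ≤ 27 * D₂ * (T : ℝ) ^ (1 - α / 2) := by
    calc _ = 2 * (√V * √(20 * ((d + H) * γA))) *
          ∑ t ∈ Finset.range T, √((max 1 t : ℕ) : ℝ)⁻¹ := by ring
      _ ≤ 9 * D₂ * (3 * (T : ℝ) ^ (1 - α / 2)) :=
          mul_le_mul (bad_const_le hV hA hH) hs (by positivity) (by positivity)
      _ = _ := by ring
  have t5 : ∑ t ∈ Finset.range T, δ / T = δ := by
    rw [Finset.sum_const, Finset.card_range, nsmul_eq_mul]
    field_simp
  have p1 := mul_nonneg hD₁0 hTp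
  have p2 := mul_nonneg hD₂0 hTp
  simp only [Finset.sum_add_distrib, ← Finset.mul_sum, ← Finset.sum_mul]
  rw [t5]
  -- The totals are 230 + 3 for `D₁` and 40 + 27 for `D₂`, both below 300.
  linarith

/-! ### Assembling the expected regret -/

section Main

variable {Par : Type uP} {𝒳 : Type uX} [MeasurableSpace Par] [MeasurableSpace 𝒳] {d : ℕ}
  {H' : Type uH} [NormedAddCommGroup H'] [InnerProductSpace ℝ H'] [CompleteSpace H']
  {S : Model.{uΩ} Par 𝒳 d H'} {adv : Adversary Par 𝒳 d} {Mstar : HSOp d H'}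
  {L α Λmax C Vmax lam : ℝ} {H : ℕ} {T : ℕ}

theorem toReal_le_add {x o : ℝ≥0∞} {b : ℝ} (ho : o ≠ ⊤) (hb : 0 ≤ b)
    (h : x ≤ o + ENNReal.ofReal b) : x.toReal ≤ o.toReal + b := by
  have h1 := ENNReal.toReal_mono (ENNReal.add_ne_top.2 ⟨ho, ENNReal.ofReal_ne_top⟩) h
  rwa [ENNReal.toReal_add ho ENNReal.ofReal_ne_top, ENNReal.toReal_ofReal hb] at h1

/-- The expected regret, for each value of `T`. -/
theorem Setting.integral_regret_le (hS : Setting S adv Mstar L α Λmax C Vmax lam H)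
    {pol : Policy Par 𝒳} (hKS : S.IsKSLC3 lam adv pol T) (hA : S.gainA lam adv T ≠ ⊤)
    (hA₂ : S.gainA₂ lam adv T ≠ ⊤) (hB : S.gainB lam adv T ≠ ⊤) :
    ∫ h, S.regret adv h ∂S.histLaw adv pol T ≤
      300 * (dTilde₁ S.σ d T L Λmax C (S.gainA lam adv T).toReal
            (S.gainA₂ lam adv T).toReal (S.gainB lam adv T).toReal +
          dTilde₂ d T H Vmax (S.gainA lam adv T).toReal) * (T : ℝ) ^ (1 - α / 2) := by
  have hpol := hKS.1
  have : Nonempty Par := ⟨pol 0 Fin.elim0⟩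
  set gA := (S.gainA lam adv T).toReal with hgA
  set gA₂ := (S.gainA₂ lam adv T).toReal with hgA₂
  set gB := (S.gainB lam adv T).toReal with hgB
  have hgA0 : 0 ≤ gA := ENNReal.toReal_nonneg
  have hgA₂0 : 0 ≤ gA₂ := ENNReal.toReal_nonneg
  have hgB0 : 0 ≤ gB := ENNReal.toReal_nonneg
  rw [(hS.integral_regret pol hpol T).2]
  rcases Nat.eq_zero_or_pos T with hT | hT
  · subst hT
    simp only [Finset.range_zero, Finset.sum_empty, sub_zero]
    have h1 : 0 ≤ dTilde₁ S.σ d 0 L Λmax C gA gA₂ gB := Real.sqrt_nonneg _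
    have h2 : 0 ≤ dTilde₂ d 0 H Vmax gA := Real.sqrt_nonneg _
    positivity
  have hT' : (1 : ℝ) ≤ T := by exact_mod_cast hT
  set w : ℕ → ℝ := fun t => (∫⁻ h, ENNReal.ofReal (min 1 (stepB S lam h (pol t h)))
    ∂S.histLaw adv pol t).toReal with hw
  set D : ℕ → ℝ := fun t => (∫⁻ h, infoStep S lam adv h (pol t h) ∂S.histLaw adv pol t).toReal
    with hD
  have hw0 : ∀ t, 0 ≤ w t := fun t => ENNReal.toReal_nonneg
  have hD0 : ∀ t, 0 ≤ D t := fun t => ENNReal.toReal_nonneg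
  have hsum : ∀ {f : ℕ → ℝ≥0∞} {g : ℝ≥0∞}, g ≠ ⊤ → ∑ t ∈ Finset.range T, f t ≤ g →
      ∑ t ∈ Finset.range T, (f t).toReal ≤ g.toReal := by
    intro f g hg hfg
    have hne : ∀ t ∈ Finset.range T, f t ≠ ⊤ := fun t ht =>
      ((Finset.single_le_sum (fun _ _ => zero_le) ht).trans hfg |>.trans_lt hg.lt_top).ne
    rw [← ENNReal.toReal_sum hne]
    exact ENNReal.toReal_mono hg hfg
  have hwsum : ∑ t ∈ Finset.range T, w t ≤ gB := hsum hB (hS.sum_lintegral_stepB_le hpol T)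
  have hDsum : ∑ t ∈ Finset.range T, D t ≤ gA := hsum hA (hS.sum_lintegral_infoStep_le hpol T)
  set η := (1 + gB) / T with hη
  have hη0 : 0 < η := by positivity
  have hΛ := hS.Λmax_nonneg
  -- The near-optimal selection costs δ / T per episode; δ is arbitrary.
  refine le_of_forall_pos_le_add fun δ hδ => ?_
  have hε : 0 < δ / T := by positivity
  have hstep : ∀ t ∈ Finset.range T,
      (∫⁻ h, value S (pol t h) (adv t h) ∂S.histLaw adv pol t).toReal ≤
      (∫⁻ h, S.optValue (adv t h) ∂S.histLaw adv pol t).toReal +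
      (√(4 * Λmax ^ 2 + 4 * L ^ 2 + 4 * L ^ 2 * (80 * (1 + C⁻¹) * S.σ ^ 2) ^ 2 *
          ((d + Real.log T) ^ 2 + gA₂)) * √(η ^ α + η ^ (α - 1) * w t) +
        2 * (√Vmax * (√5 * (√(80 * (d + Real.log T + gA) + H) * √(D t)))) +
        (Λmax * ((max 1 t : ℕ) : ℝ)⁻¹ + 2 * (√Vmax * (√((max 1 t : ℕ) : ℝ)⁻¹ *
        √(20 * ((d + H) * gA))))) + δ / T) := by
    intro t ht
    have hpr := isProbabilityMeasure_histLaw hS.model hS.adversary hpol t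
    have hopt : ∫⁻ h, S.optValue (adv t h) ∂S.histLaw adv pol t ≠ ⊤ := by
      refine ((lintegral_mono fun h => (hS.optValue_le (pol t h) h).trans
        (hS.value_le (pol t h) h)).trans_lt ?_).ne
      simpa using hS.value_bound_ne_top.lt_top
    have h1 := hS.lintegral_value_le hKS (Finset.mem_range.1 ht) hA hA₂ hη0 hε
    refine toReal_le_add hopt ?_ h1
    have q1 := mul_nonneg (Real.sqrt_nonneg (4 * Λmax ^ 2 + 4 * L ^ 2 + 4 * L ^ 2 *
      (80 * (1 + C⁻¹) * S.σ ^ 2) ^ 2 * ((d + Real.log T) ^ 2 + gA₂))) (Real.sqrt_nonneg (η ^ α + η ^ (α - 1) * w t))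
    have q2 : 0 ≤ 2 * (√Vmax * (√5 * (√(80 * (d + Real.log T + gA) + H) * √(D t)))) := by
      positivity
    have q3 : 0 ≤ Λmax * ((max 1 t : ℕ) : ℝ)⁻¹ + 2 * (√Vmax * (√((max 1 t : ℕ) : ℝ)⁻¹ *
        √(20 * ((d + H) * gA)))) := by positivity
    exact add_nonneg (add_nonneg (add_nonneg q1 q2) q3) hε.le
  have hsum1 := Finset.sum_le_sum hstep
  rw [Finset.sum_add_distrib] at hsum1
  have hsum2 := sum_episode_bounds_le (σ := S.σ) (d := d) (δ := δ) hS.L_nonneg hS.α_le hΛ hS.C_pos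
    hS.V_pos hS.H_pos hgA0 hgA₂0 hgB0 hT hw0 hD0 hwsum hDsum
  linarith

/-! ### Polylogarithmic information gains -/

/-- Under the root, 1 + γ_ℬ contributes one power of `R` and the bracket two; R³ ≤ (R³)² makes the
root simple. -/
theorem dTilde₁_le {σ L Λmax C A R γA γA₂ γB : ℝ} {d T : ℕ} (hL : 0 ≤ L) (hΛ : 0 ≤ Λmax)
    (hC : 0 < C) (hA : 0 ≤ A) (hR : 1 ≤ R) (h1 : 0 ≤ γA) (h2 : 0 ≤ γA₂)
    (h1' : γA ≤ A * R) (h2' : γA₂ ≤ A * R) (h3' : γB ≤ A * R) (hl : Real.log T ≤ R) :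
    dTilde₁ σ d T L Λmax C γA γA₂ γB ≤
      √((1 + A) * (L ^ 2 * (1 + C⁻¹) ^ 2 * (σ ^ 4 * ((d + 1 + A) ^ 2 + A)) +
        (L ^ 2 + Λmax * L) * (1 + C⁻¹) * (σ ^ 2 * (d + 1 + A)) + Λmax ^ 2 + L ^ 2)) * R ^ 3 := by
  have hC' : 0 < C⁻¹ := inv_pos.2 hC
  have hl0 := Real.log_natCast_nonneg T
  have hd : (0 : ℝ) ≤ d := Nat.cast_nonneg d
  have hR0 : 0 ≤ R := by linarith
  have e1 : d + Real.log T + γA ≤ (d + 1 + A) * R := by nlinarith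
  have e0 : 0 ≤ d + Real.log T + γA := by positivity
  have hR2 : R ≤ R ^ 2 := by nlinarith
  have hR2' : 1 ≤ R ^ 2 := by nlinarith
  have b2 : betaTilde₂ σ d T γA γA₂ ≤ σ ^ 4 * ((d + 1 + A) ^ 2 + A) * R ^ 2 := by
    unfold betaTilde₂
    rw [mul_assoc]
    gcongr
    calc _ ≤ ((d + 1 + A) * R) ^ 2 + A * R ^ 2 := by
          gcongr
          exact h2'.trans (by gcongr)
      _ = _ := by ring
  have b1 : betaTilde₁ σ d T γA ≤ σ ^ 2 * (d + 1 + A) * R ^ 2 := by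
    unfold betaTilde₁
    rw [mul_assoc]
    gcongr
    exact e1.trans (by gcongr)
  have b1' := betaTilde₁_nonneg (σ := σ) (d := d) (T := T) h1
  have b2' : 0 ≤ betaTilde₂ σ d T γA γA₂ := by unfold betaTilde₂; positivity
  set K := L ^ 2 * (1 + C⁻¹) ^ 2 * (σ ^ 4 * ((d + 1 + A) ^ 2 + A)) +
        (L ^ 2 + Λmax * L) * (1 + C⁻¹) * (σ ^ 2 * (d + 1 + A)) + Λmax ^ 2 + L ^ 2 with hK
  have hK0 : 0 ≤ K := by positivity
  have e2 : L ^ 2 * (1 + C⁻¹) ^ 2 * betaTilde₂ σ d T γA γA₂ +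
      (L ^ 2 + Λmax * L) * (1 + C⁻¹) * betaTilde₁ σ d T γA + Λmax ^ 2 + L ^ 2 ≤ K * R ^ 2 := by
    calc _ ≤ L ^ 2 * (1 + C⁻¹) ^ 2 * (σ ^ 4 * ((d + 1 + A) ^ 2 + A) * R ^ 2) +
        (L ^ 2 + Λmax * L) * (1 + C⁻¹) * (σ ^ 2 * (d + 1 + A) * R ^ 2) + Λmax ^ 2 * R ^ 2 +
        L ^ 2 * R ^ 2 := by
          gcongr
          · exact le_mul_of_one_le_right (sq_nonneg _) hR2'
          · exact le_mul_of_one_le_right (sq_nonneg _) hR2'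
      _ = _ := by rw [hK]; ring
  have e3 : 1 + γB ≤ (1 + A) * R := by nlinarith
  rw [dTilde₁]
  calc _ ≤ √((1 + A) * K * (R ^ 3) ^ 2) := by
        refine Real.sqrt_le_sqrt ?_
        calc _ ≤ ((1 + A) * R) * (K * R ^ 2) := by gcongr
          _ = (1 + A) * K * R ^ 3 := by ring
          _ ≤ (1 + A) * K * (R ^ 3) ^ 2 := by
            gcongr
            exact le_self_pow₀ (one_le_pow₀ hR) two_ne_zero
    _ = _ := by rw [Real.sqrt_mul (by positivity), Real.sqrt_sq (by positivity)]

theorem dTilde₂_le {V A R γA : ℝ} {d T H : ℕ} (hV : 0 ≤ V) (hA : 0 ≤ A) (hR : 1 ≤ R)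
    (h1 : 0 ≤ γA) (h1' : γA ≤ A * R) (hl : Real.log T ≤ R) :
    dTilde₂ d T H V γA ≤ √(A * H * V * (A + d + 1 + H)) * R ^ 3 := by
  have hl0 := Real.log_natCast_nonneg T
  have hd : (0 : ℝ) ≤ d := Nat.cast_nonneg d
  have hH : (0 : ℝ) ≤ H := Nat.cast_nonneg H
  have hR0 : 0 ≤ R := by linarith
  have e1 : γA + d + Real.log T + H ≤ (A + d + 1 + H) * R := by nlinarith
  rw [dTilde₂]
  calc _ ≤ √(A * H * V * (A + d + 1 + H) * (R ^ 3) ^ 2) := by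
        refine Real.sqrt_le_sqrt ?_
        calc _ ≤ (A * R) * H * V * ((A + d + 1 + H) * R) := by gcongr
          _ = A * H * V * (A + d + 1 + H) * R ^ 2 := by ring
          _ ≤ _ := by
            gcongr
            exact le_self_pow₀ hR three_ne_zero
    _ = _ := by rw [Real.sqrt_mul (by positivity), Real.sqrt_sq (by positivity)]

/-- Absolute values make the constant nonnegative and the exponent at least one, whatever the signs
of `a` and `p`. -/
theorem toReal_le_of_le_polylog {g : ℝ≥0∞} {a p u : ℝ} (hu : 1 ≤ u)
    (h : g ≤ ENNReal.ofReal (a * u ^ p)) : g.toReal ≤ |a| * u ^ (|p| + 1) := by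
  have h1 := ENNReal.toReal_mono ENNReal.ofReal_ne_top h
  refine h1.trans ?_
  rw [ENNReal.toReal_ofReal']
  have h0 : 0 ≤ u ^ p := Real.rpow_nonneg (by linarith) _
  have h2 : u ^ p ≤ u ^ (|p| + 1) :=
    Real.rpow_le_rpow_of_exponent_le hu (by linarith [le_abs_self p])
  refine max_le ?_ (by positivity)
  calc a * u ^ p ≤ |a| * u ^ p := by gcongr; exact le_abs_self a
    _ ≤ _ := by gcongr

end Main

end KSNR

end

theorem mainTheorem1 :
    ∃ C₁ : ℝ, 0 < C₁ ∧
      ∀ (Par : Type uP) [MeasurableSpace Par] (𝒳 : Type uX) [MeasurableSpace 𝒳] (d : ℕ)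
        (H' : Type uH) [NormedAddCommGroup H'] [InnerProductSpace ℝ H'] [CompleteSpace H']
        (S : Model.{uΩ} Par 𝒳 d H') (adv : Adversary Par 𝒳 d) (Mstar : HSOp d H')
        (L α Λmax C Vmax lam : ℝ) (H : ℕ),
        S.MeasurableModel → MeasurableAdversary adv →
        0 < S.σ → S.GaussianFeatures → S.IsKoopmanRealization →
        S.RKHS → S.Represents Mstar → Mstar ≠ 0 → Mstar ∈ S.Ball₀ →
        (∀ t h, S.Realizable (adv t h)) →
        0 ≤ L → 0 < α → α ≤ 1 → 0 ≤ Λmax → S.HolderCost L α Λmax →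
        0 < C → 0 < H → (∀ t h, S.Excites (adv t h) C H) →
        0 < Vmax → (∀ t h, S.MomentBound (adv t h) Vmax) →
        lam = S.σ ^ 2 / ‖HSOp.op Mstar‖ ^ 2 →
        ∀ pol : Policy Par 𝒳,
          (∀ T : ℕ, S.IsKSLC3 lam adv pol T →
            S.gainA lam adv T ≠ ⊤ → S.gainA₂ lam adv T ≠ ⊤ → S.gainB lam adv T ≠ ⊤ →
            Integrable (S.regret adv (T := T)) (S.histLaw adv pol T) ∧
            ∫ h, S.regret adv h ∂S.histLaw adv pol T ≤
              C₁ * (dTilde₁ S.σ d T L Λmax C (S.gainA lam adv T).toReal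
                    (S.gainA₂ lam adv T).toReal (S.gainB lam adv T).toReal +
                  dTilde₂ d T H Vmax (S.gainA lam adv T).toReal) *
                (T : ℝ) ^ (1 - α / 2)) ∧
          (α = 1 → (∀ T, S.IsKSLC3 lam adv pol T) →
            (∃ a p : ℝ, ∀ T : ℕ, 1 ≤ T →
              S.gainA lam adv T ≤ ENNReal.ofReal (a * (1 + Real.log T) ^ p) ∧
              S.gainA₂ lam adv T ≤ ENNReal.ofReal (a * (1 + Real.log T) ^ p) ∧
              S.gainB lam adv T ≤ ENNReal.ofReal (a * (1 + Real.log T) ^ p)) →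
            ∃ b q : ℝ, ∀ T : ℕ, 1 ≤ T →
              ∫ h, S.regret adv h ∂S.histLaw adv pol T ≤
                b * (1 + Real.log T) ^ q * Real.sqrt T) := by
  refine ⟨300, by norm_num, ?_⟩
  intro Par _ 𝒳 _ d H' _ _ _ S adv Mstar L α Λmax C Vmax lam H hM hAdv hσ hG hK _ hR hne hmem hreal
    hL hα hα1 hΛ hHol hC hH hexc hV hmom hlam pol
  have hS : Setting S adv Mstar L α Λmax C Vmax lam H :=
    { model := hM, adversary := hAdv, σ_pos := hσ, gauss := hG, koopman := hK, represents := hR,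
      mem_ball := hmem, realizable := hreal, L_nonneg := hL, α_pos := hα, α_le := hα1,
      Λmax_nonneg := hΛ, holder := hHol, C_pos := hC, H_pos := hH, excites := hexc, V_pos := hV,
      moment := hmom, lam_pos := lam_pos hσ hne hlam, lam_le := lam_mul_norm_sq_le hne hlam }
  refine ⟨fun T hKS hA hA₂ hB => ⟨(hS.integral_regret pol hKS.1 T).1,
    hS.integral_regret_le hKS hA hA₂ hB⟩, ?_⟩
  rintro rfl hKS ⟨a, p, hgain⟩
  refine ⟨300 * (√((1 + |a|) * (L ^ 2 * (1 + C⁻¹) ^ 2 * (S.σ ^ 4 * ((d + 1 + |a|) ^ 2 + |a|)) +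
      (L ^ 2 + Λmax * L) * (1 + C⁻¹) * (S.σ ^ 2 * (d + 1 + |a|)) + Λmax ^ 2 + L ^ 2)) +
      √(|a| * H * Vmax * (|a| + d + 1 + H))), 3 * (|p| + 1), fun T hT => ?_⟩
  obtain ⟨h1, h2, h3⟩ := hgain T hT
  have hl0 := Real.log_natCast_nonneg T
  have hu : (1 : ℝ) ≤ 1 + Real.log T := by linarith
  -- The extra one in the exponent lets `R` dominate log T too, so one quantity bounds all factors
  -- of both dimensions.
  set R := (1 + Real.log T) ^ (|p| + 1) with hRdef
  have hR1 : 1 ≤ R := Real.one_le_rpow hu (by positivity)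
  have hlR : Real.log T ≤ R := by
    have h4 : (1 + Real.log T) ^ (1 : ℝ) ≤ R :=
      Real.rpow_le_rpow_of_exponent_le hu (by linarith [abs_nonneg p])
    rw [Real.rpow_one] at h4
    linarith
  have hR3 : (1 + Real.log T) ^ (3 * (|p| + 1)) = R ^ 3 := by
    rw [hRdef, ← Real.rpow_natCast, ← Real.rpow_mul (by linarith)]
    congr 1
    push_cast
    ring
  have hmain := hS.integral_regret_le (hKS T) (h1.trans_lt ENNReal.ofReal_lt_top).ne
    (h2.trans_lt ENNReal.ofReal_lt_top).ne (h3.trans_lt ENNReal.ofReal_lt_top).ne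
  refine hmain.trans ?_
  have hd1 := dTilde₁_le (σ := S.σ) (d := d) (T := T) hL hΛ hC (abs_nonneg a) hR1
    ENNReal.toReal_nonneg ENNReal.toReal_nonneg
    (toReal_le_of_le_polylog hu h1) (toReal_le_of_le_polylog hu h2)
    (toReal_le_of_le_polylog hu h3) hlR
  have hd2 := dTilde₂_le (d := d) (T := T) (H := H) hV.le (abs_nonneg a) hR1
    ENNReal.toReal_nonneg (toReal_le_of_le_polylog hu h1) hlR
  have hsq : (T : ℝ) ^ (1 - 1 / 2 : ℝ) = √T := by
    rw [Real.sqrt_eq_rpow]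
    norm_num
  rw [hR3, hsq]
  refine mul_le_mul_of_nonneg_right ?_ (Real.sqrt_nonneg _)
  rw [mul_assoc 300, add_mul]
  gcongr
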